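/- **Setting.** Let $d\in\mathbb N$, $s_1,s_2\in(0,\infty)$, $T>0$, and let $\Omega\subset\mathbb R^d$ be a bounded polyhedral Lipschitz domain. A *tagged simplex* $S=(x_0,\dots,x_d)_\gamma$ is a closed $d$-simplex with ordered vertices and a type $\gamma\in\{0,\dots,d-1\}$; its refinement edge is $\mathrm{RE}(S)=\overline{x_0x_d}$. The Maubach–Traxler bisection $\mathrm{BISECT}(d,S)$ consists of $$\Bigl(x_0,\tfrac{x_0+x_d}2,x_1,\dots,x_\gamma,x_{\gamma+1},\dots,x_{d-1}\Bigr)_{(\gamma+1)\bmod d},\qquad \Bigl(x_d,\tfrac{x_0+x_d}2,x_1,\dots,x_\gamma,x_{d-1},\dots,x_{\gamma+1}\Bigr)_{(\gamma+1)\bmod d},$$ and $\mathrm{BISECT}(1,I)$ halves an interval $I$ (half-open into two half-open intervals, closed into a half-open and a closed one). The *reflection* of $S$ is $(x_d,x_1,\dots,x_\gamma,x_{d-1},\dots,x_{\gamma+1},x_0)_\gamma$. Two tagged simplices are *neighbours* if they share a hyperface, and *reflected neighbours* if moreover they have the same type and the ordered vertices of one of them, or of its reflection, agree with those of the other in all but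 one position. Let $\mathcal T_0$ be a conforming triangulation of $\Omega$ into tagged simplices of one common type which is *well-labeled*: for neighbours $S,S'\in\mathcal T_0$, if $\mathrm{RE}(S)$ or $\mathrm{RE}(S')$ lies in $S\cap S'$, then $S,S'$ are reflected neighbours; otherwise the neighbouring children of $S$ and $S'$ are reflected neighbours. Let $\mathcal I_0=\{[t_0,t_1),\dots,[t_{N-2},t_{N-1}),[t_{N-1},t_N]\}$ with $0=t_0<\dots<t_N=T$, and $\mathcal P_0=\{I\times S: I\in\mathcal I_0,\ S\in\mathcal T_0\}$. Put $$\kappa_{\mathcal P_0}=\max_{I\times S\in\mathcal P_0}\frac{\operatorname{diam}S}{\rho_S},\qquad \mu(\mathcal P_0)=\Bigl\{\max_{I\times S\in\mathcal P_0}|I|,\ \min_{I\times S\in\mathcal P_0}|I|,\ \max_{I\times S\in\mathcal P_0}|S|,\ \min_{I\times S\in\mathcal P_0}|S|\Bigr\},$$ where $\rho_S$ is the supremum of the radii of balls contained in $S$. **Atomic refinement.** The level $\ell(I\times S)=\ell(S)$ is the number of bisections by which $S$ arises from an element of $\mathcal T_0$. $\mathrm{ATOMIC\_SPLIT}(I\times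 S)$ is the set of all prisms $I'\times S'$ with $S'\in\mathrm{BISECT}(d,S)$ and $I'$ one of the $2^m$ intervals obtained by bisecting $I$ $m$ times, where $m=\lceil\frac{n s_2}{s_1d}\rceil-\lceil\frac{(n-1)s_2}{s_1d}\rceil$ and $n=\ell(S)+1$. **Necessary refinements.** For a finite set $\mathcal P$ of prisms and a prism $I\times S$, let $\mathcal N(I\times S,\mathcal P)=\mathcal N_t\cup\mathcal N_{x}$. Here $\mathcal N_t=\mathcal N_t(I\times S,\mathcal P)$ is the set of the $I'\times S'\in\mathcal P\setminus\{I\times S\}$ with $\#(\overline I\cap\overline{I'})=1$, $\dim(S\cap S')=d$ and $\ell(I'\times S')=\ell(I\times S)-1$. Further, $\mathcal N_x=\mathcal N_x(I\times S,\mathcal P)$ is the set of the $I'\times S'\in\mathcal P\setminus\{I\times S\}$ with $|I\cap I'|>0$ and, if $d\ge2$, $\dim(S\cap S')=d-1$ and $\mathrm{RE}(S)\subset S'$; if $d=1$, $\#(S\cap S')=1$ and $\ell(I'\times S')=\ell(I\times S)-1$. **$\mathrm{PATCH\_REFINE}(\mathcal P,I\times S)$.** Start with $K=\emptyset$, $F=\{I\times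 S\}$. While $F\ne\emptyset$: put $F_{new}=\emptyset$; for every $R'\in F$ and every $R''\in\mathcal N(R',\mathcal P)\setminus(K\cup F)$ do the following. If $\ell(R'')=\ell(R')$, add $R''$ to $F_{new}$. Otherwise put $\mathcal P_{old}=\mathcal P$, replace $\mathcal P$ by $\mathrm{PATCH\_REFINE}(\mathcal P,R'')$ and, if $R''\in\mathcal N_x(R',\mathcal P_{old})$, add to $F_{new}$ all $R'''\in\mathrm{ATOMIC\_SPLIT}(R'')$ with $R'''\in\mathcal N(R',\mathcal P)$. Then replace $K$ by $K\cup F$ and $F$ by $F_{new}$. When $F=\emptyset$, return $(\mathcal P\setminus K)\cup\bigcup_{R\in K}\mathrm{ATOMIC\_SPLIT}(R)$. The elements in for-loops are visited in arbitrary order. **$\mathrm{MARKED\_REFINE}$.** Let $\mathrm{MARK}$ be any rule that assigns to every finite set $\mathcal P$ of prisms a subset $\mathrm{MARK}(\mathcal P)\subset\mathcal P$. Starting from $\mathcal P_0$, the $k$-th loop ($k\ge1$) takes $\mathcal M_{k-1}=\mathrm{MARK}(\mathcal P_{k-1})$ and, starting with $\mathcal P=\mathcal P_{k-1}$, replaces,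 for each $R\in\mathcal M_{k-1}$ in turn (in arbitrary order), $\mathcal P$ by $\mathrm{PATCH\_REFINE}(\mathcal P,R)$ if $R$ still belongs to the current $\mathcal P$; the result is $\mathcal P_k$. (If $\mathcal M_{k-1}=\emptyset$ the algorithm stops, i.e. $\mathcal P_k=\mathcal P_{k-1}$.) **Theorem.** There is a constant $C>0$, depending only on $d$, $s_1$, $s_2$, $\kappa_{\mathcal P_0}$ and $\mu(\mathcal P_0)$, such that for all such $\mathcal P_0$, all rules $\mathrm{MARK}$, all $k\in\mathbb N_0$ and all meshes $\mathcal P_1,\dots,\mathcal P_k$ produced by the first $k$ loops, $$\#\mathcal P_k-\#\mathcal P_0\le C\sum_{i=1}^{k}\#\mathcal M_{i-1};$$ moreover the next loop can always be completed, i.e. it has a terminating execution from $\mathcal P_k$, so that meshes $\mathcal P_k$ exist for every $k$. -/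

import Mathlib

noncomputable section

namespace SpaceTimeMesh

/-! ### Time intervals and their bisection -/

/-- A bounded time interval: `[lo, hi]` if `closedRight` is true, `[lo, hi)` otherwise. -/
structure TimeInterval where
  lo : ℝ
  hi : ℝ
  closedRight : Bool

/-- The set of points of a time interval. -/
def TimeInterval.toSet (I : TimeInterval) : Set ℝ :=
  if I.closedRight = true then Set.Icc I.lo I.hi else Set.Ico I.lo I.hi

open Classical in
/-- One-dimensional bisection: a half-open interval is split into two half-open ones, a closed one
into a half-open and a closed one. -/
def TimeInterval.bisect (I : TimeInterval) : Finset TimeInterval :=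
  {⟨I.lo, (I.lo + I.hi) / 2, false⟩, ⟨(I.lo + I.hi) / 2, I.hi, I.closedRight⟩}

open Classical in
/-- The intervals obtained from `I` by `m` successive bisections of every interval. -/
def TimeInterval.bisectIter (I : TimeInterval) : ℕ → Finset TimeInterval
  | 0 => {I}
  | m + 1 => (I.bisectIter m).biUnion TimeInterval.bisect

/-! ### Tagged simplices and the Maubach–Traxler bisection -/

/-- A tagged `d`-simplex `(x₀, …, x_d)_γ` in `ℝ^d`: an ordered list of vertices, a tag (type) `γ`,
and the level, i.e. the number of bisections by which it arose from the initial triangulation. -/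
structure TaggedSimplex (d : ℕ) where
  vert : Fin (d + 1) → EuclideanSpace ℝ (Fin d)
  tag : ℕ
  level : ℕ

namespace TaggedSimplex

variable {d : ℕ}

/-- The `j`-th vertex `x_j`, for `0 ≤ j ≤ d`. -/
def x (S : TaggedSimplex d) (j : ℕ) : EuclideanSpace ℝ (Fin d) := S.vert (Fin.ofNat (d + 1) j)

/-- The vertex set. -/
def vertices (S : TaggedSimplex d) : Set (EuclideanSpace ℝ (Fin d)) := Set.range S.vert

/-- The closed simplex as a set of points. -/
def carrier (S : TaggedSimplex d) : Set (EuclideanSpace ℝ (Fin d)) := convexHull ℝ S.vertices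

/-- The refinement edge, with end points `x₀` and `x_d`. -/
def refinementEdge (S : TaggedSimplex d) : Set (EuclideanSpace ℝ (Fin d)) :=
  segment ℝ (S.x 0) (S.x d)

/-- First child `(x₀, (x₀+x_d)/2, x₁, …, x_γ, x_{γ+1}, …, x_{d-1})_{(γ+1) mod d}`. -/
def child₁ (S : TaggedSimplex d) : TaggedSimplex d where
  vert := fun i =>
    if (i : ℕ) = 0 then S.x 0
    else if (i : ℕ) = 1 then midpoint ℝ (S.x 0) (S.x d)
    else S.x ((i : ℕ) - 1)
  tag := (S.tag + 1) % d
  level := S.level + 1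

/-- Second child `(x_d, (x₀+x_d)/2, x₁, …, x_γ, x_{d-1}, …, x_{γ+1})_{(γ+1) mod d}`. -/
def child₂ (S : TaggedSimplex d) : TaggedSimplex d where
  vert := fun i =>
    if (i : ℕ) = 0 then S.x d
    else if (i : ℕ) = 1 then midpoint ℝ (S.x 0) (S.x d)
    else if (i : ℕ) ≤ S.tag + 1 then S.x ((i : ℕ) - 1)
    else S.x (d + S.tag + 1 - (i : ℕ))
  tag := (S.tag + 1) % d
  level := S.level + 1

open Classical in
/-- The bisection `BISECT(d, S)`. -/
def bisect (S : TaggedSimplex d) : Finset (TaggedSimplex d) := {S.child₁, S.child₂}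

/-- The reflection `(x_d, x₁, …, x_γ, x_{d-1}, …, x_{γ+1}, x₀)_γ`, which has the same children. -/
def reflect (S : TaggedSimplex d) : TaggedSimplex d where
  vert := fun i =>
    if (i : ℕ) = 0 then S.x d
    else if (i : ℕ) = d then S.x 0
    else if (i : ℕ) ≤ S.tag then S.x (i : ℕ)
    else S.x (d + S.tag - (i : ℕ))
  tag := S.tag
  level := S.level

/-- Two simplices of a conforming triangulation are neighbours if they share a hyperface, i.e. have
exactly `d` common vertices. -/
def Neighbor (S S' : TaggedSimplex d) : Prop := (S.vertices ∩ S'.vertices).ncard = d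

/-- Reflected neighbours: neighbours of the same type such that the vertex sequence of `S` or of its
reflection coincides with the one of `S'` in all but one position. -/
def ReflectedNeighbor (S S' : TaggedSimplex d) : Prop :=
  S.Neighbor S' ∧ S.tag = S'.tag ∧
    ({i | S.vert i ≠ S'.vert i}.ncard = 1 ∨ {i | S.reflect.vert i ≠ S'.vert i}.ncard = 1)

open Classical in
/-- The matching condition for two neighbours `S`, `S'`: if one of the refinement edges lies in the
common hyperface, then `S` and `S'` are reflected neighbours; otherwise their neighbouring children
are reflected neighbours. -/
def Match (S S' : TaggedSimplex d) : Prop :=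
  if ({S.x 0, S.x d} ⊆ S'.vertices ∨ {S'.x 0, S'.x d} ⊆ S.vertices) then ReflectedNeighbor S S'
  else ∀ C ∈ S.bisect, ∀ C' ∈ S'.bisect, C.Neighbor C' → ReflectedNeighbor C C'

/-- `diam(S) / ρ_S`, where `ρ_S` is the supremum of the radii of balls contained in `S`. -/
def shape (S : TaggedSimplex d) : ℝ :=
  Metric.diam S.carrier / sSup {ρ : ℝ | 0 < ρ ∧ ∃ c ∈ S.carrier, Metric.ball c ρ ⊆ S.carrier}

end TaggedSimplex

/-! ### Prisms, meshes and initial meshes -/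

/-- A prism `I × S`. -/
abbrev Prism (d : ℕ) := TimeInterval × TaggedSimplex d

/-- A finite collection of prisms. -/
abbrev Mesh (d : ℕ) := Finset (Prism d)

/-- The level of a prism: the number of atomic splits by which it arose, i.e. the level of its
spatial simplex. -/
def Prism.level {d : ℕ} (R : Prism d) : ℕ := R.2.level

/-- A bounded Lipschitz domain: a nonempty, bounded, connected open set that is, near each of its
boundary points and after a rotation, the open region above the graph of a Lipschitz function. -/
def IsBoundedLipschitzDomain {d : ℕ} (Ω : Set (EuclideanSpace ℝ (Fin d))) : Prop :=
  IsOpen Ω ∧ IsConnected Ω ∧ Bornology.IsBounded Ω ∧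
    ∀ p ∈ frontier Ω, ∃ e : EuclideanSpace ℝ (Fin d), ‖e‖ = 1 ∧
      ∃ (K : NNReal) (φ : EuclideanSpace ℝ (Fin d) → ℝ), LipschitzWith K φ ∧
        ∀ᶠ y in nhds p, (y ∈ Ω ↔ φ (y - inner ℝ e y • e) < inner ℝ e y)

/-- The data of an initial tensor-product mesh: a partition `0 = t₀ < … < t_N = T` of `[0, T]`, and a
conforming, well-labeled triangulation of a bounded (polyhedral) Lipschitz domain `Ω`, all of whose
simplices are of the same type and of level zero. -/
structure InitialMesh (d : ℕ) where
  T : ℝ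
  T_pos : 0 < T
  N : ℕ
  t : Fin (N + 1) → ℝ
  t_zero : t 0 = 0
  t_last : t (Fin.last N) = T
  t_strictMono : StrictMono t
  Ω : Set (EuclideanSpace ℝ (Fin d))
  domain : IsBoundedLipschitzDomain Ω
  tri : Finset (TaggedSimplex d)
  nondegenerate : ∀ S ∈ tri, AffineIndependent ℝ S.vert
  covers : ⋃ S ∈ tri, S.carrier = closure Ω
  /-- Two different simplices meet in a common (possibly empty) face of dimension at most `d - 1`. -/
  conforming : ∀ S ∈ tri, ∀ S' ∈ tri, S ≠ S' →
    ∃ A, A ⊂ S.vertices ∧ A ⊂ S'.vertices ∧ S.carrier ∩ S'.carrier = convexHull ℝ A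
  γ : ℕ
  γ_lt : γ < d
  tag_eq : ∀ S ∈ tri, S.tag = γ
  level_eq : ∀ S ∈ tri, S.level = 0
  well_labeled : ∀ S ∈ tri, ∀ S' ∈ tri, S.Neighbor S' → S.Match S'

open Classical in
/-- The temporal partition `[t₀, t₁), …, [t_{N-2}, t_{N-1}), [t_{N-1}, t_N]`. -/
def InitialMesh.intervals {d : ℕ} (D : InitialMesh d) : Finset TimeInterval :=
  Finset.univ.image fun i : Fin D.N =>
    (⟨D.t i.castSucc, D.t i.succ, decide ((i : ℕ) + 1 = D.N)⟩ : TimeInterval)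

/-- The tensor-product mesh `𝒫₀`. -/
def InitialMesh.mesh {d : ℕ} (D : InitialMesh d) : Mesh d := D.intervals ×ˢ D.tri

section Parameters

variable {d : ℕ}

/-- The shape-regularity constant `κ_𝒫 = sup_{I × S ∈ 𝒫} diam(S) / ρ_S`. -/
def shapeRegularity (P : Mesh d) : ℝ :=
  sSup ((fun R : Prism d => R.2.shape) '' (P : Set (Prism d)))

/-- `μ₁(𝒫) = max |I|`. -/
def mu₁ (P : Mesh d) : ℝ :=
  sSup ((fun R : Prism d => MeasureTheory.volume.real R.1.toSet) '' (P : Set (Prism d)))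

/-- `μ₂(𝒫) = min |I|`. -/
def mu₂ (P : Mesh d) : ℝ :=
  sInf ((fun R : Prism d => MeasureTheory.volume.real R.1.toSet) '' (P : Set (Prism d)))

/-- `μ₃(𝒫) = max |S|`. -/
def mu₃ (P : Mesh d) : ℝ :=
  sSup ((fun R : Prism d => MeasureTheory.volume.real R.2.carrier) '' (P : Set (Prism d)))

/-- `μ₄(𝒫) = min |S|`. -/
def mu₄ (P : Mesh d) : ℝ :=
  sInf ((fun R : Prism d => MeasureTheory.volume.real R.2.carrier) '' (P : Set (Prism d)))

end Parameters

/-! ### Atomic refinement and necessary refinements of neighbours -/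

section Refinement

variable {d : ℕ}

/-- `ATOMIC_SPLIT(I × S, d, s₁, s₂)`: `S` is bisected once and `I` is bisected
`⌈n s₂ / (s₁ d)⌉ - ⌈(n - 1) s₂ / (s₁ d)⌉` times, where `n = ℓ(S) + 1`. -/
def atomicSplit (s₁ s₂ : ℝ) (R : Prism d) : Mesh d :=
  R.1.bisectIter (⌈((R.2.level : ℝ) + 1) * s₂ / (s₁ * d)⌉₊ - ⌈(R.2.level : ℝ) * s₂ / (s₁ * d)⌉₊)
    ×ˢ R.2.bisect

/-- The dimension of a nonempty convex set. -/
def convexDim (A : Set (EuclideanSpace ℝ (Fin d))) : ℕ := Module.finrank ℝ (vectorSpan ℝ A)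

open Classical in
/-- `𝒩_t(R, P)`: the prisms of `P` that touch `R` in time and are one level coarser. -/
def temporalNeighbors (R : Prism d) (P : Mesh d) : Mesh d :=
  P.filter fun R' => R' ≠ R ∧ (closure R.1.toSet ∩ closure R'.1.toSet).ncard = 1 ∧
    convexDim (R.2.carrier ∩ R'.2.carrier) = d ∧ R'.level + 1 = R.level

open Classical in
/-- `𝒩_x(R, P)`: for `d ≥ 2`, the prisms of `P` that overlap `R` in time and share with it a spatial
hyperface containing the refinement edge; for `d = 1`, the prisms of `P` that overlap `R` in time,
touch it in space and are one level coarser. -/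
def spatialNeighbors (R : Prism d) (P : Mesh d) : Mesh d :=
  P.filter fun R' => R' ≠ R ∧ 0 < MeasureTheory.volume (R.1.toSet ∩ R'.1.toSet) ∧
    if d = 1 then (R.2.carrier ∩ R'.2.carrier).ncard = 1 ∧ R'.level + 1 = R.level
    else convexDim (R.2.carrier ∩ R'.2.carrier) = d - 1 ∧ R.2.refinementEdge ⊆ R'.2.carrier

open Classical in
/-- `𝒩(R, P)`: the necessary refinements of neighbours. -/
def neighbors (R : Prism d) (P : Mesh d) : Mesh d := temporalNeighbors R P ∪ spatialNeighbors R P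

end Refinement

/-! ### Loops

Algorithms are described by the relation between the program state before and after an execution
that terminates. -/

/-- Execution of `body` for the entries of a list, one after the other. -/
inductive ForList {α σ : Type} (body : α → σ → σ → Prop) : List α → σ → σ → Prop
  | nil (s : σ) : ForList body [] s s
  | cons {a : α} {l : List α} {s s' s'' : σ} :
      body a s s' → ForList body l s' s'' → ForList body (a :: l) s s''

open Classical in
/-- A `for`-loop over a finite set, whose elements are visited in an arbitrary order. -/
def ForEach {α σ : Type} (body : α → σ → σ → Prop) (A : Finset α) (s s' : σ) : Prop :=
  ∃ l : List α, l.Nodup ∧ l.toFinset = A ∧ ForList body l s s'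

/-! ### The algorithms -/

section Algorithms

variable {d : ℕ}

open Classical in
/-- Body of the innermost `for`-loop of `PATCH_REFINE`, for the considered prism `R'` and its
neighbour `R''`. The state is the pair `(P, F_new)`; `call` is the recursive call. -/
inductive NeighborStep (s₁ s₂ : ℝ) (call : Mesh d → Prism d → Mesh d → Prop) (R' R'' : Prism d) :
    Mesh d × Mesh d → Mesh d × Mesh d → Prop
  | same (P Fnew : Mesh d) : R'.level = R''.level →
      NeighborStep s₁ s₂ call R' R'' (P, Fnew) (P, Fnew ∪ {R''})
  | recurse (P P' Fnew : Mesh d) : R'.level ≠ R''.level → call P R'' P' →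
      NeighborStep s₁ s₂ call R' R'' (P, Fnew)
        (P', if R'' ∈ spatialNeighbors R' P then
            Fnew ∪ (atomicSplit s₁ s₂ R'').filter (fun R''' => R''' ∈ neighbors R' P')
          else Fnew)

open Classical in
/-- Body of the `for`-loop over `F`, for given `K` and `F`. -/
def frontStep (s₁ s₂ : ℝ) (call : Mesh d → Prism d → Mesh d → Prop) (K F : Mesh d) (R' : Prism d)
    (s s' : Mesh d × Mesh d) : Prop :=
  ForEach (NeighborStep s₁ s₂ call R') (neighbors R' s.1 \ (K ∪ F)) s s'

open Classical in
/-- The `while`-loop of `PATCH_REFINE`: `WhileLoop s₁ s₂ call P K F P' K'` says that, entered with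
`(P, K, F)`, it terminates with `P'` and `K'`. -/
inductive WhileLoop (s₁ s₂ : ℝ) (call : Mesh d → Prism d → Mesh d → Prop) :
    Mesh d → Mesh d → Mesh d → Mesh d → Mesh d → Prop
  | done (P K : Mesh d) : WhileLoop s₁ s₂ call P K ∅ P K
  | loop {P K F P₁ Fnew P' K' : Mesh d} : F ≠ ∅ →
      ForEach (frontStep s₁ s₂ call K F) F (P, ∅) (P₁, Fnew) →
      WhileLoop s₁ s₂ call P₁ (K ∪ F) Fnew P' K' →
      WhileLoop s₁ s₂ call P K F P' K'

open Classical in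
/-- `PATCH_REFINE` with recursion depth at most `n`: after the `while`-loop, all prisms in `K` are
replaced by their atomic splits. -/
def PatchRefineDepth (s₁ s₂ : ℝ) : ℕ → Mesh d → Prism d → Mesh d → Prop
  | 0 => fun _ _ _ => False
  | n + 1 => fun P R P' => ∃ P₁ K : Mesh d,
      WhileLoop s₁ s₂ (PatchRefineDepth s₁ s₂ n) P ∅ {R} P₁ K ∧
        P' = (P₁ \ K) ∪ K.biUnion (atomicSplit s₁ s₂)

/-- `PatchRefine s₁ s₂ P R P'`: `PATCH_REFINE(P, R, d, s₁, s₂)` terminates with the mesh `P'`. -/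
def PatchRefine (s₁ s₂ : ℝ) (P : Mesh d) (R : Prism d) (P' : Mesh d) : Prop :=
  ∃ n : ℕ, PatchRefineDepth s₁ s₂ n P R P'

/-- One loop of `MARKED_REFINE` for the marking routine `mark`: it leads from the mesh `P` to `P'`.
(If nothing is marked, the algorithm stops, that is, the mesh stays the same.) -/
def MarkedLoop (s₁ s₂ : ℝ) (mark : Mesh d → Mesh d) (P P' : Mesh d) : Prop :=
  ForEach (fun R Q Q' => (R ∈ Q ∧ PatchRefine s₁ s₂ Q R Q') ∨ (R ∉ Q ∧ Q' = Q)) (mark P) P P'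

end Algorithms

end SpaceTimeMesh

end

open SpaceTimeMesh

/-!
The refinements reachable from the initial mesh form a forest whose nodes are prisms, the children of a
prism being its atomic splits, and a mesh is described by the set `Q` of the nodes that have been
split (`RefinementTree.leaves`).

*Matching.* Two simplices of the same level that share a hyperface are always in a matching position
(`TaggedSimplex.Good`): either they agree in all but one vertex, up to reflection, or the children that
contain the hyperface do. This holds initially because the triangulation is well-labeled, and it is
inherited by children (`TaggedSimplex.Good.children`, `InitialMesh.simplices_good`). In particular,
simplices of the same level sharing a refinement edge within a common hyperface are bisected along the
same edge.

*The algorithm.* Consequently the necessary refinements of a prism `X` in a mesh are the prisms of the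
same level that have to be split simultaneously with `X`, and prisms of exactly one level less that have
to be split before (`InitialMesh.tree_compatible`). For any tree with this property, every call of
`PATCH_REFINE` for `R` terminates for some order of the loops, and every terminating execution splits
`R` together with prisms `Y` that are connected to `R` by a chain of dependencies of decreasing level
(`RefinementTree.patchRefine_sound`, `RefinementTree.patchRefine_total`).

*Locality.* A prism of level `n` has spatial size of order `2 ^ (-n / d)` and temporal size of order
`2 ^ (-n * s₂ / (s₁ * d))`, with constants controlled by the shape-regularity and the extremal volumes
of the initial mesh. By a geometric series, all prisms split by a call for `R` are, measured at their
own scale, at a bounded distance from `R` (`RefinementTree.Gauge.reach_le`), and by comparison of volumes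
only boundedly many nodes of one level are near a given prism.

*Counting.* Let `M` be the set of prisms for which `PATCH_REFINE` was called. Each `R ∈ M` distributes
shares to the nodes `Y` of lower or equal level near it, decaying geometrically in the difference of the
levels; so the shares of one `R` sum up to at most a constant. Conversely every split prism `Y` receives at
least a full share: the call that split `Y` is for some `R`, whose parent was split by an earlier call,
and so on down to level zero; this history stays near `Y` until it reaches the level of `Y` or until its
members have paid enough (`RefinementTree.IsHistory.one_le_sum`). Hence `Q` has at most a constant times
as many elements as `M`, and each split creates a bounded number of prisms.
-/

namespace SpaceTimeMesh

/-! ### Convex hulls of finite sets, faces and dimensions -/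

section Faces

variable {E : Type*} [NormedAddCommGroup E] [NormedSpace ℝ E]

/-- A face cut out of a convex hull by a supporting hyperplane is spanned by the generators that
lie in the hyperplane. -/
theorem mem_convexHull_zeros_of_nonneg {W : Set E} {f : E →ᵃ[ℝ] ℝ} (hf : ∀ w ∈ W, 0 ≤ f w)
    {p : E} (hp : p ∈ convexHull ℝ W) (h0 : f p = 0) :
    p ∈ convexHull ℝ {w ∈ W | f w = 0} := by
  rw [convexHull_eq] at hp
  obtain ⟨ι, t, w, z, hw0, hw1, hz, rfl⟩ := hp
  rw [Finset.centerMass_eq_of_sum_1 _ _ hw1] at h0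
  have hsum : f (∑ i ∈ t, w i • z i) = ∑ i ∈ t, w i * f (z i) := by
    have h2 := t.map_affineCombination z w hw1 f
    rw [Finset.affineCombination_eq_linear_combination _ _ _ hw1,
      Finset.affineCombination_eq_linear_combination _ _ _ hw1] at h2
    simpa using h2
  rw [hsum, Finset.sum_eq_zero_iff_of_nonneg
    (fun i hi => mul_nonneg (hw0 i hi) (hf _ (hz i hi)))] at h0
  rw [← Finset.centerMass_filter_ne_zero]
  refine Finset.centerMass_mem_convexHull _ (fun i hi => hw0 i (Finset.mem_filter.1 hi).1) ?_ ?_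
  · rw [Finset.sum_filter_ne_zero, hw1]; exact one_pos
  · intro i hi
    rw [Finset.mem_filter] at hi
    exact ⟨hz i hi.1, (mul_eq_zero.1 (h0 i hi.1)).resolve_left hi.2⟩

theorem nonneg_of_mem_convexHull {W : Set E} {f : E →ᵃ[ℝ] ℝ} (hf : ∀ w ∈ W, 0 ≤ f w)
    {p : E} (hp : p ∈ convexHull ℝ W) : 0 ≤ f p := by
  have hc : Convex ℝ (f ⁻¹' Set.Ici 0) := (convex_Ici (0 : ℝ)).affine_preimage f
  exact convexHull_min (fun w hw => hf w hw) hc hp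

theorem eq_zero_of_mem_convexHull {W : Set E} {f : E →ᵃ[ℝ] ℝ} (hf : ∀ w ∈ W, f w = 0)
    {p : E} (hp : p ∈ convexHull ℝ W) : f p = 0 := by
  have hc : Convex ℝ (f ⁻¹' {0}) := (convex_singleton (0 : ℝ)).affine_preimage f
  exact convexHull_min (fun w hw => hf w hw) hc hp

theorem AffineMap.map_midpoint_real (f : E →ᵃ[ℝ] ℝ) (a b : E) :
    f (midpoint ℝ a b) = (f a + f b) / 2 := by
  rw [f.map_midpoint, midpoint_eq_smul_add]
  simp [smul_eq_mul]; ring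

/-- The convex hull of a set containing `a` and `b` is covered by the two halves obtained by
replacing `b`, respectively `a`, by the midpoint of `a` and `b`. -/
theorem convexHull_insert_insert_subset (a b : E) (W : Set E) :
    convexHull ℝ (insert a (insert b W)) ⊆
      convexHull ℝ (insert a (insert (midpoint ℝ a b) W)) ∪
        convexHull ℝ (insert b (insert (midpoint ℝ a b) W)) := by
  have hseg : segment ℝ a b ⊆ segment ℝ a (midpoint ℝ a b) ∪ segment ℝ b (midpoint ℝ a b) := by
    intro p hp
    rw [segment_eq_image_lineMap] at hp
    obtain ⟨t, ⟨ht0, ht1⟩, rfl⟩ := hp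
    by_cases h : t ≤ 1 / 2
    · left
      rw [segment_eq_image_lineMap]
      refine ⟨2 * t, ⟨by linarith, by linarith⟩, ?_⟩
      rw [midpoint_eq_smul_add, AffineMap.lineMap_apply_module, AffineMap.lineMap_apply_module]
      simp only [invOf_eq_inv]
      module
    · right
      rw [segment_eq_image_lineMap]
      refine ⟨2 * (1 - t), ⟨by linarith, by linarith⟩, ?_⟩
      rw [midpoint_eq_smul_add, AffineMap.lineMap_apply_module, AffineMap.lineMap_apply_module]
      simp only [invOf_eq_inv]
      module
  have hpair : ∀ c e : E, (insert c (insert e W) : Set E) = {c, e} ∪ W := by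
    intro c e; ext; simp [or_assoc]
  simp only [hpair]
  rcases W.eq_empty_or_nonempty with rfl | hW
  · simpa [convexHull_pair] using hseg
  · intro p hp
    rw [convexHull_union (by simp) hW, mem_convexJoin, convexHull_pair] at hp
    obtain ⟨q, hq, r, hr, hp⟩ := hp
    rcases hseg hq with h | h
    · left
      rw [convexHull_union (by simp) hW, mem_convexJoin, convexHull_pair]
      exact ⟨q, h, r, hr, hp⟩
    · right
      rw [convexHull_union (by simp) hW, mem_convexJoin, convexHull_pair]
      exact ⟨q, h, r, hr, hp⟩

end Faces

section Dimension

variable {d : ℕ}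

theorem convexDim_mono {A B : Set (EuclideanSpace ℝ (Fin d))} (h : A ⊆ B) :
    convexDim A ≤ convexDim B :=
  Submodule.finrank_mono (vectorSpan_mono ℝ h)

theorem convexDim_le (A : Set (EuclideanSpace ℝ (Fin d))) : convexDim A ≤ d :=
  (Submodule.finrank_le (vectorSpan ℝ A)).trans (by simp)

theorem convexDim_convexHull (W : Set (EuclideanSpace ℝ (Fin d))) :
    convexDim (convexHull ℝ W) = convexDim W := by
  unfold convexDim
  rw [← direction_affineSpan, affineSpan_convexHull, direction_affineSpan]

theorem convexDim_le_of_ncard {W : Set (EuclideanSpace ℝ (Fin d))} (hW : W.Finite) {k : ℕ}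
    (h : W.ncard ≤ k + 1) : convexDim W ≤ k := by
  classical
  rcases W.eq_empty_or_nonempty with rfl | hne
  · rw [convexDim, vectorSpan_empty, finrank_bot]; exact Nat.zero_le k
  · have hpos := (Set.ncard_pos hW).2 hne
    have := finrank_vectorSpan_image_finset_le ℝ (id : EuclideanSpace ℝ (Fin d) → _)
      hW.toFinset (n := W.ncard - 1) (by rw [← Set.ncard_eq_toFinset_card W hW]; omega)
    rw [Finset.image_id, hW.coe_toFinset] at this
    exact this.trans (by omega)

/-- The dimension of a face of a nondegenerate simplex. -/
theorem convexDim_of_subset_range {v : Fin (d + 1) → EuclideanSpace ℝ (Fin d)}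
    (hv : AffineIndependent ℝ v) {W : Set (EuclideanSpace ℝ (Fin d))} (hW : W ⊆ Set.range v)
    {k : ℕ} (h : W.ncard = k + 1) : convexDim W = k := by
  classical
  have hfin : W.Finite := (Set.finite_range v).subset hW
  have hi : AffineIndependent ℝ ((↑) : W → EuclideanSpace ℝ (Fin d)) := hv.range.mono hW
  have : Fintype W := hfin.fintype
  have := hi.finrank_vectorSpan (n := k) (by rw [← Nat.card_eq_fintype_card]; exact h)
  rwa [Subtype.range_coe] at this

end Dimension
/-! ### Vertex sequences of children and reflections -/

namespace TaggedSimplex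

variable {d : ℕ} {S S' C C' : TaggedSimplex d}

theorem vert_eq_x (S : TaggedSimplex d) (i : Fin (d + 1)) : S.vert i = S.x i := by
  simp [x]

theorem x_eq_vert (S : TaggedSimplex d) {j : ℕ} (hj : j ≤ d) :
    S.x j = S.vert ⟨j, Nat.lt_succ_of_le hj⟩ := by
  simp only [x]; congr 1; ext; simp [Nat.mod_eq_of_lt (Nat.lt_succ_of_le hj)]

theorem x_mem_vertices (S : TaggedSimplex d) (j : ℕ) : S.x j ∈ S.vertices := ⟨_, rfl⟩

theorem mem_vertices_iff {p : EuclideanSpace ℝ (Fin d)} :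
    p ∈ S.vertices ↔ ∃ j ≤ d, S.x j = p := by
  constructor
  · rintro ⟨i, rfl⟩; exact ⟨i, Nat.lt_succ_iff.1 i.2, (S.vert_eq_x i).symm⟩
  · rintro ⟨j, -, rfl⟩; exact S.x_mem_vertices j

theorem ext_x (hv : ∀ j ≤ d, S.x j = S'.x j) (ht : S.tag = S'.tag) (hl : S.level = S'.level) :
    S = S' := by
  cases S; cases S'
  simp only [mk.injEq]
  refine ⟨funext fun i => ?_, ht, hl⟩
  have := hv i (Nat.lt_succ_iff.1 i.2)
  simpa only [← vert_eq_x] using this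

/-- The midpoint of the refinement edge. -/
noncomputable def mid (S : TaggedSimplex d) : EuclideanSpace ℝ (Fin d) := midpoint ℝ (S.x 0) (S.x d)

theorem child₁_x_zero : S.child₁.x 0 = S.x 0 := by
  rw [x_eq_vert _ (Nat.zero_le d)]; simp [child₁]

theorem child₁_x_one (hd : 1 ≤ d) : S.child₁.x 1 = S.mid := by
  rw [x_eq_vert _ hd]; simp [child₁, mid]

theorem child₁_x {j : ℕ} (h2 : 2 ≤ j) (hj : j ≤ d) : S.child₁.x j = S.x (j - 1) := by
  rw [x_eq_vert _ hj]; simp only [child₁]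
  rw [if_neg (by omega), if_neg (by omega)]

theorem child₂_x_zero : S.child₂.x 0 = S.x d := by
  rw [x_eq_vert _ (Nat.zero_le d)]; simp [child₂]

theorem child₂_x_one (hd : 1 ≤ d) : S.child₂.x 1 = S.mid := by
  rw [x_eq_vert _ hd]; simp [child₂, mid]

theorem child₂_x_of_le {j : ℕ} (h2 : 2 ≤ j) (hj : j ≤ d) (ht : j ≤ S.tag + 1) :
    S.child₂.x j = S.x (j - 1) := by
  rw [x_eq_vert _ hj]; simp only [child₂]
  rw [if_neg (by omega), if_neg (by omega), if_pos ht]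

theorem child₂_x_of_lt {j : ℕ} (h2 : 2 ≤ j) (hj : j ≤ d) (ht : S.tag + 1 < j) :
    S.child₂.x j = S.x (d + S.tag + 1 - j) := by
  rw [x_eq_vert _ hj]; simp only [child₂]
  rw [if_neg (by omega), if_neg (by omega), if_neg (by omega)]

theorem reflect_x_zero : S.reflect.x 0 = S.x d := by
  rw [x_eq_vert _ (Nat.zero_le d)]; simp [reflect]

theorem reflect_x_last (hd : 1 ≤ d) : S.reflect.x d = S.x 0 := by
  rw [x_eq_vert _ le_rfl]; simp only [reflect]
  rw [if_neg (by omega)]; simp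

theorem reflect_x_of_le {j : ℕ} (h1 : 1 ≤ j) (hj : j < d) (ht : j ≤ S.tag) :
    S.reflect.x j = S.x j := by
  rw [x_eq_vert _ hj.le]; simp only [reflect]
  rw [if_neg (by omega), if_neg (by omega), if_pos ht]

theorem reflect_x_of_lt {j : ℕ} (h1 : 1 ≤ j) (hj : j < d) (ht : S.tag < j) :
    S.reflect.x j = S.x (d + S.tag - j) := by
  rw [x_eq_vert _ hj.le]; simp only [reflect]
  rw [if_neg (by omega), if_neg (by omega), if_neg (by omega)]

theorem reflect_mid (hd : 1 ≤ d) : S.reflect.mid = S.mid := by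
  rw [mid, mid, reflect_x_zero, reflect_x_last hd, midpoint_comm]

theorem reflect_child₁ (hd : 1 ≤ d) : S.reflect.child₁ = S.child₂ := by
  refine ext_x (fun j hj => ?_) rfl rfl
  rcases Nat.lt_or_ge j 2 with h | h
  · interval_cases j
    · rw [child₁_x_zero, child₂_x_zero, reflect_x_zero]
    · rw [child₁_x_one hd, child₂_x_one hd, reflect_mid hd]
  · rw [child₁_x h hj]
    rcases Nat.lt_or_ge (S.tag + 1) j with ht | ht
    · rw [child₂_x_of_lt h hj ht, reflect_x_of_lt (by omega) (by omega) (by omega)]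
      congr 1; omega
    · rw [child₂_x_of_le h hj ht, reflect_x_of_le (by omega) (by omega) (by omega)]

theorem reflect_child₂ (hd : 1 ≤ d) : S.reflect.child₂ = S.child₁ := by
  refine ext_x (fun j hj => ?_) rfl rfl
  rcases Nat.lt_or_ge j 2 with h | h
  · interval_cases j
    · rw [child₁_x_zero, child₂_x_zero, reflect_x_last hd]
    · rw [child₁_x_one hd, child₂_x_one hd, reflect_mid hd]
  · rw [child₁_x h hj]
    have ht' : S.reflect.tag = S.tag := rfl
    rcases Nat.lt_or_ge (S.tag + 1) j with ht | ht
    · rw [child₂_x_of_lt (S := S.reflect) h hj ht, ht', reflect_x_of_lt (by omega) (by omega) (by omega)]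
      congr 1; omega
    · rw [child₂_x_of_le (S := S.reflect) h hj ht, reflect_x_of_le (by omega) (by omega) (by omega)]

theorem mem_bisect : C ∈ S.bisect ↔ C = S.child₁ ∨ C = S.child₂ := by
  simp [bisect]

theorem reflect_bisect (hd : 1 ≤ d) : S.reflect.bisect = S.bisect := by
  ext C; rw [mem_bisect, mem_bisect, reflect_child₁ hd, reflect_child₂ hd, or_comm]

theorem reflect_vertices (hd : 1 ≤ d) (ht : S.tag < d) : S.reflect.vertices = S.vertices := by
  have key : ∀ R : TaggedSimplex d, R.tag < d → R.reflect.vertices ⊆ R.vertices := by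
    intro R _ p hp
    obtain ⟨j, hj, rfl⟩ := mem_vertices_iff.1 hp
    rcases Nat.eq_zero_or_pos j with rfl | h0
    · rw [reflect_x_zero]; exact x_mem_vertices _ _
    rcases hj.eq_or_lt with rfl | hjd
    · rw [reflect_x_last hd]; exact x_mem_vertices _ _
    rcases Nat.lt_or_ge R.tag j with h | h
    · rw [reflect_x_of_lt h0 hjd h]; exact x_mem_vertices _ _
    · rw [reflect_x_of_le h0 hjd h]; exact x_mem_vertices _ _
  refine (key S ht).antisymm ?_
  intro p hp
  obtain ⟨j, hj, rfl⟩ := mem_vertices_iff.1 hp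
  rcases Nat.eq_zero_or_pos j with rfl | h0
  · rw [← reflect_x_last hd]; exact x_mem_vertices _ _
  rcases hj.eq_or_lt with h | hjd
  · rw [h, ← reflect_x_zero]; exact x_mem_vertices _ _
  rcases Nat.lt_or_ge S.tag j with h | h
  · have := reflect_x_of_lt (S := S) (j := d + S.tag - j) (by omega) (by omega) (by omega)
    rw [show d + S.tag - (d + S.tag - j) = j by omega] at this
    rw [← this]; exact x_mem_vertices _ _
  · rw [← reflect_x_of_le h0 hjd h]; exact x_mem_vertices _ _

/-! ### Adjacent vertex sequences -/

/-- Two tagged simplices of the same type whose vertex sequences agree off the position `j`. -/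
def AgreeOff (S S' : TaggedSimplex d) (j : ℕ) : Prop :=
  S.tag = S'.tag ∧ ∀ i ≤ d, i ≠ j → S.x i = S'.x i

/-- The vertex sequences agree off one position, possibly after a reflection. -/
def Adj (S S' : TaggedSimplex d) : Prop :=
  ∃ j ≤ d, AgreeOff S S' j ∨ AgreeOff S.reflect S' j

theorem AgreeOff.adj {j : ℕ} (h : AgreeOff S S' j) (hj : j ≤ d) : Adj S S' := ⟨j, hj, Or.inl h⟩

theorem AgreeOff.mid_eq {j : ℕ} (h : AgreeOff S S' j) (h0 : 0 < j) (hj : j < d) :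
    S.mid = S'.mid := by
  rw [mid, mid, h.2 0 (by omega) (by omega), h.2 d le_rfl (by omega)]

theorem AgreeOff.child₁ {j : ℕ} (h : AgreeOff S S' j) (h0 : 0 < j) (hj : j < d) :
    AgreeOff S.child₁ S'.child₁ (j + 1) := by
  refine ⟨by simp only [TaggedSimplex.child₁, h.1], fun i hi hij => ?_⟩
  rcases Nat.lt_or_ge i 2 with h2 | h2
  · interval_cases i
    · rw [child₁_x_zero, child₁_x_zero, h.2 0 (by omega) (by omega)]
    · rw [child₁_x_one hi, child₁_x_one hi, h.mid_eq h0 hj]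
  · rw [child₁_x h2 hi, child₁_x h2 hi, h.2 _ (by omega) (by omega)]

theorem AgreeOff.child₂ {j : ℕ} (h : AgreeOff S S' j) (h0 : 0 < j) (hj : j < d) :
    ∃ j', 2 ≤ j' ∧ j' ≤ d ∧ S.child₂.x j' = S.x j ∧ S'.child₂.x j' = S'.x j ∧
      AgreeOff S.child₂ S'.child₂ j' := by
  have ht : S.child₂.tag = S'.child₂.tag := by simp only [TaggedSimplex.child₂, h.1]
  have hs := h.1
  rcases Nat.lt_or_ge S.tag j with hjt | hjt
  · refine ⟨d + S.tag + 1 - j, by omega, by omega, ?_, ?_, ht, fun i hi hij => ?_⟩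
    · rw [child₂_x_of_lt (by omega) (by omega) (by omega)]; congr 1; omega
    · rw [child₂_x_of_lt (by omega) (by omega) (by omega)]; congr 1; omega
    rcases Nat.lt_or_ge i 2 with h2 | h2
    · interval_cases i
      · rw [child₂_x_zero, child₂_x_zero, h.2 d le_rfl (by omega)]
      · rw [child₂_x_one hi, child₂_x_one hi, h.mid_eq h0 hj]
    rcases Nat.lt_or_ge (S.tag + 1) i with hit | hit
    · rw [child₂_x_of_lt h2 hi hit, child₂_x_of_lt h2 hi (by omega), hs,
        h.2 _ (by omega) (by omega)]
    · rw [child₂_x_of_le h2 hi hit, child₂_x_of_le h2 hi (by omega),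
        h.2 _ (by omega) (by omega)]
  · refine ⟨j + 1, by omega, by omega, ?_, ?_, ht, fun i hi hij => ?_⟩
    · rw [child₂_x_of_le (by omega) (by omega) (by omega)]; congr 1
    · rw [child₂_x_of_le (by omega) (by omega) (by omega)]; congr 1
    rcases Nat.lt_or_ge i 2 with h2 | h2
    · interval_cases i
      · rw [child₂_x_zero, child₂_x_zero, h.2 d le_rfl (by omega)]
      · rw [child₂_x_one hi, child₂_x_one hi, h.mid_eq h0 hj]
    rcases Nat.lt_or_ge (S.tag + 1) i with hit | hit
    · rw [child₂_x_of_lt h2 hi hit, child₂_x_of_lt h2 hi (by omega), hs,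
        h.2 _ (by omega) (by omega)]
    · rw [child₂_x_of_le h2 hi hit, child₂_x_of_le h2 hi (by omega),
        h.2 _ (by omega) (by omega)]

/-- If the sequences differ in the first position only, the second children contain the common
hyperface, and they differ only in the midpoints. -/
theorem AgreeOff.child₂_of_zero (h : AgreeOff S S' 0) (hd : 1 ≤ d) :
    AgreeOff S.child₂ S'.child₂ 1 := by
  have hs := h.1
  refine ⟨by simp only [TaggedSimplex.child₂, h.1], fun i hi hij => ?_⟩
  rcases Nat.lt_or_ge i 2 with h2 | h2
  · interval_cases i
    · rw [child₂_x_zero, child₂_x_zero, h.2 d le_rfl (by omega)]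
    · exact absurd rfl hij
  rcases Nat.lt_or_ge (S.tag + 1) i with hit | hit
  · rw [child₂_x_of_lt h2 hi hit, child₂_x_of_lt h2 hi (by omega), hs,
      h.2 _ (by omega) (by omega)]
  · rw [child₂_x_of_le h2 hi hit, child₂_x_of_le h2 hi (by omega),
      h.2 _ (by omega) (by omega)]

theorem AgreeOff.child₁_of_last (h : AgreeOff S S' d) (hd : 1 ≤ d) :
    AgreeOff S.child₁ S'.child₁ 1 := by
  refine ⟨by simp only [TaggedSimplex.child₁, h.1], fun i hi hij => ?_⟩
  rcases Nat.lt_or_ge i 2 with h2 | h2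
  · interval_cases i
    · rw [child₁_x_zero, child₁_x_zero, h.2 0 (by omega) (by omega)]
    · exact absurd rfl hij
  · rw [child₁_x h2 hi, child₁_x h2 hi, h.2 _ (by omega) (by omega)]

/-- The children of two siblings that contain the common hyperface of the siblings are adjacent. -/
theorem adj_siblings (hd : 2 ≤ d) (ht : S.tag < d) : Adj S.child₁.child₂ S.child₂.child₂ := by
  have t1 : S.child₁.tag = (S.tag + 1) % d := rfl
  have t2 : S.child₂.tag = (S.tag + 1) % d := rfl
  rcases Nat.lt_or_ge (S.tag + 1) d with h1 | h1
  swap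
  · -- type `d - 1`: the siblings differ in the first position only
    have : AgreeOff S.child₁ S.child₂ 0 := by
      refine ⟨rfl, fun i hi hi0 => ?_⟩
      rcases Nat.lt_or_ge i 2 with h2 | h2
      · interval_cases i
        · exact absurd rfl hi0
        · rw [child₁_x_one hi, child₂_x_one hi]
      · rw [child₁_x h2 hi, child₂_x_of_le h2 hi (by omega)]
    exact (this.child₂_of_zero (by omega)).adj (by omega)
  rw [Nat.mod_eq_of_lt h1] at t1 t2
  rcases Nat.lt_or_ge (S.tag + 2) d with h3 | h3
  swap
  · have : AgreeOff S.child₁ S.child₂ 0 := by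
      refine ⟨rfl, fun i hi hi0 => ?_⟩
      rcases Nat.lt_or_ge i 2 with h2 | h2
      · interval_cases i
        · exact absurd rfl hi0
        · rw [child₁_x_one hi, child₂_x_one hi]
      rcases Nat.lt_or_ge (S.tag + 1) i with hit | hit
      · rw [child₁_x h2 hi, child₂_x_of_lt h2 hi hit]; congr 1; omega
      · rw [child₁_x h2 hi, child₂_x_of_le h2 hi hit]
    exact (this.child₂_of_zero (by omega)).adj (by omega)
  refine ⟨1, by omega, Or.inr ⟨rfl, fun i hi hi1 => ?_⟩⟩
  have t3 : S.child₁.child₂.tag = S.tag + 2 := by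
    have : S.child₁.child₂.tag = (S.child₁.tag + 1) % d := rfl
    rw [this, t1, Nat.mod_eq_of_lt h3]
  rcases Nat.eq_zero_or_pos i with rfl | h0
  · rw [reflect_x_zero, child₂_x_of_lt (by omega) le_rfl (by omega), t1,
      child₁_x (by omega) (by omega), child₂_x_zero, child₂_x_of_lt (by omega) le_rfl (by omega)]
    congr 1; omega
  rcases hi.eq_or_lt with h | hid
  · subst h
    rw [reflect_x_last (by omega), child₂_x_zero, child₁_x (by omega) le_rfl,
      child₂_x_of_lt (by omega) le_rfl (by omega), t2,
      child₂_x_of_lt (by omega) (by omega) (by omega)]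
    congr 1; omega
  rcases Nat.lt_or_ge (S.tag + 2) i with hit | hit
  · rw [reflect_x_of_lt h0 hid (by omega), t3, child₂_x_of_lt (by omega) (by omega) (by omega), t1,
      child₁_x (by omega) (by omega), child₂_x_of_lt (by omega) (by omega) (by omega), t2,
      child₂_x_of_lt (by omega) (by omega) (by omega)]
    congr 1; omega
  · rw [reflect_x_of_le h0 hid (by omega), child₂_x_of_le (by omega) (by omega) (by omega),
      child₂_x_of_le (by omega) (by omega) (by omega)]
    rcases Nat.lt_or_ge (i - 1) 2 with h2 | h2
    · rw [show i - 1 = 1 by omega, child₁_x_one (by omega), child₂_x_one (by omega)]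
    · rw [child₁_x h2 (by omega), child₂_x_of_le h2 (by omega) (by omega)]

end TaggedSimplex
/-! ### Nondegenerate simplices -/

namespace TaggedSimplex

variable {d : ℕ} {S S' C C' : TaggedSimplex d}

theorem exists_coord (h : AffineIndependent ℝ S.vert) {j : ℕ} (hj : j ≤ d) :
    ∃ c : EuclideanSpace ℝ (Fin d) →ᵃ[ℝ] ℝ, c (S.x j) = 1 ∧ ∀ i ≤ d, i ≠ j → c (S.x i) = 0 := by
  have htop : affineSpan ℝ (Set.range S.vert) = ⊤ := by
    rw [h.affineSpan_eq_top_iff_card_eq_finrank_add_one]; simp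
  let b : AffineBasis (Fin (d + 1)) ℝ (EuclideanSpace ℝ (Fin d)) := ⟨S.vert, h, htop⟩
  refine ⟨b.coord ⟨j, Nat.lt_succ_of_le hj⟩, ?_, fun i hi hij => ?_⟩
  · rw [x_eq_vert _ hj]
    exact b.coord_apply_eq _
  · rw [x_eq_vert _ hi]
    exact b.coord_apply_ne (by simpa using hij.symm)

theorem x_inj (h : AffineIndependent ℝ S.vert) {i j : ℕ} (hi : i ≤ d) (hj : j ≤ d)
    (hij : S.x i = S.x j) : i = j := by
  rw [x_eq_vert _ hi, x_eq_vert _ hj] at hij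
  simpa using h.injective hij

theorem vertices_finite (S : TaggedSimplex d) : S.vertices.Finite := Set.finite_range _

theorem ncard_vertices (h : AffineIndependent ℝ S.vert) : S.vertices.ncard = d + 1 := by
  rw [vertices, ← Set.image_univ, Set.ncard_image_of_injective _ h.injective, Set.ncard_univ]
  simp

theorem vertices_subset_carrier (S : TaggedSimplex d) : S.vertices ⊆ S.carrier :=
  subset_convexHull ℝ _

theorem convexDim_carrier (h : AffineIndependent ℝ S.vert) : convexDim S.carrier = d := by
  rw [carrier, convexDim_convexHull]
  exact convexDim_of_subset_range h subset_rfl (ncard_vertices h)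

/-- A vertex of a nondegenerate simplex lies in a face only if it is a vertex of that face. -/
theorem mem_of_mem_convexHull (h : AffineIndependent ℝ S.vert)
    {W : Set (EuclideanSpace ℝ (Fin d))} (hW : W ⊆ S.vertices) {v : EuclideanSpace ℝ (Fin d)}
    (hv : v ∈ S.vertices) (hvW : v ∈ convexHull ℝ W) : v ∈ W := by
  by_contra hn
  obtain ⟨j, hj, rfl⟩ := mem_vertices_iff.1 hv
  obtain ⟨c, hc1, hc0⟩ := exists_coord h hj
  have : c (S.x j) = 0 := eq_zero_of_mem_convexHull (fun w hw => by
    obtain ⟨i, hi, rfl⟩ := mem_vertices_iff.1 (hW hw)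
    exact hc0 i hi (fun hij => hn (hij ▸ hw))) hvW
  linarith

/-- If two nondegenerate simplices intersect in the convex hull of common vertices, then these are
all the common vertices. -/
theorem inter_vertices_eq (h : AffineIndependent ℝ S.vert)
    {W : Set (EuclideanSpace ℝ (Fin d))} (hW : W ⊆ S.vertices) (hW' : W ⊆ S'.vertices)
    (hi : S.carrier ∩ S'.carrier ⊆ convexHull ℝ W) : S.vertices ∩ S'.vertices = W := by
  refine Set.Subset.antisymm (fun v hv => ?_) (Set.subset_inter hW hW')
  exact mem_of_mem_convexHull h hW hv.1
    (hi ⟨vertices_subset_carrier _ hv.1, vertices_subset_carrier _ hv.2⟩)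

theorem convexHull_subset_inter {W : Set (EuclideanSpace ℝ (Fin d))} (hW : W ⊆ S.vertices)
    (hW' : W ⊆ S'.vertices) : convexHull ℝ W ⊆ S.carrier ∩ S'.carrier :=
  Set.subset_inter (convexHull_mono hW) (convexHull_mono hW')

/-- The vertices that are not end points of the refinement edge. -/
def inner (S : TaggedSimplex d) : Set (EuclideanSpace ℝ (Fin d)) :=
  {p | ∃ i, 0 < i ∧ i < d ∧ S.x i = p}

theorem vertices_eq : S.vertices = insert (S.x 0) (insert (S.x d) S.inner) := by
  ext p
  rw [mem_vertices_iff]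
  simp only [Set.mem_insert_iff, inner, Set.mem_ofPred_eq]
  constructor
  · rintro ⟨j, hj, rfl⟩
    rcases Nat.eq_zero_or_pos j with rfl | h0
    · exact Or.inl rfl
    rcases hj.eq_or_lt with rfl | hjd
    · exact Or.inr (Or.inl rfl)
    · exact Or.inr (Or.inr ⟨j, h0, hjd, rfl⟩)
  · rintro (rfl | rfl | ⟨i, _, hi, rfl⟩)
    · exact ⟨0, by omega, rfl⟩
    · exact ⟨d, le_rfl, rfl⟩
    · exact ⟨i, hi.le, rfl⟩

theorem child₁_vertices (hd : 1 ≤ d) :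
    S.child₁.vertices = insert (S.x 0) (insert S.mid S.inner) := by
  ext p
  rw [mem_vertices_iff]
  simp only [Set.mem_insert_iff, inner, Set.mem_ofPred_eq]
  constructor
  · rintro ⟨j, hj, rfl⟩
    rcases Nat.lt_or_ge j 2 with h | h
    · interval_cases j
      · exact Or.inl child₁_x_zero
      · exact Or.inr (Or.inl (child₁_x_one hd))
    · exact Or.inr (Or.inr ⟨j - 1, by omega, by omega, (child₁_x h hj).symm⟩)
  · rintro (rfl | rfl | ⟨i, h0, hi, rfl⟩)
    · exact ⟨0, by omega, child₁_x_zero⟩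
    · exact ⟨1, hd, child₁_x_one hd⟩
    · exact ⟨i + 1, hi, child₁_x (by omega) hi⟩

theorem child₂_vertices (hd : 1 ≤ d) :
    S.child₂.vertices = insert (S.x d) (insert S.mid S.inner) := by
  have hr : S.reflect.inner = S.inner := by
    ext p
    simp only [inner, Set.mem_ofPred_eq]
    constructor
    · rintro ⟨i, h0, hi, rfl⟩
      rcases Nat.lt_or_ge S.tag i with h | h
      · exact ⟨d + S.tag - i, by omega, by omega, (reflect_x_of_lt h0 hi h).symm⟩
      · exact ⟨i, h0, hi, (reflect_x_of_le h0 hi h).symm⟩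
    · rintro ⟨i, h0, hi, rfl⟩
      rcases Nat.lt_or_ge S.tag i with h | h
      · refine ⟨d + S.tag - i, by omega, by omega, ?_⟩
        rw [reflect_x_of_lt (by omega) (by omega) (by omega)]; congr 1; omega
      · exact ⟨i, h0, hi, reflect_x_of_le h0 hi h⟩
  rw [← reflect_child₁ hd, child₁_vertices hd, reflect_x_zero, reflect_mid hd, hr]

theorem child_affineIndependent (hd : 1 ≤ d) (h : AffineIndependent ℝ S.vert)
    (hC : C ∈ S.bisect) : AffineIndependent ℝ C.vert := by
  have htop : affineSpan ℝ S.vertices = ⊤ := by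
    rw [vertices, h.affineSpan_eq_top_iff_card_eq_finrank_add_one]; simp
  have hline : ∀ a b : EuclideanSpace ℝ (Fin d), ∀ W : Set (EuclideanSpace ℝ (Fin d)),
      affineSpan ℝ (insert a (insert b W)) ≤
        affineSpan ℝ (insert a (insert (midpoint ℝ a b) W)) := by
    intro a b W
    rw [affineSpan_le]
    have hs := subset_affineSpan ℝ (insert a (insert (midpoint ℝ a b) W))
    rintro p (rfl | rfl | hp)
    · exact hs (by simp)
    · have hb := AffineMap.lineMap_mem (2 : ℝ) (hs (show a ∈ _ by simp))
        (hs (show midpoint ℝ a p ∈ _ by simp))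
      have : AffineMap.lineMap a (midpoint ℝ a p) (2 : ℝ) = p := by
        rw [midpoint_eq_smul_add, AffineMap.lineMap_apply_module]
        simp only [invOf_eq_inv]
        module
      rwa [this] at hb
    · exact hs (by simp [hp])
  have hCtop : affineSpan ℝ (Set.range C.vert) = ⊤ := by
    change affineSpan ℝ C.vertices = ⊤
    rw [eq_top_iff, ← htop]
    rcases mem_bisect.1 hC with rfl | rfl
    · rw [child₁_vertices hd, vertices_eq]
      exact hline _ _ _
    · rw [child₂_vertices hd, vertices_eq, Set.insert_comm, mid, midpoint_comm]
      exact hline _ _ _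
  rw [affineIndependent_iff_finrank_vectorSpan_eq (n := d) ℝ C.vert (by simp),
    ← direction_affineSpan, hCtop, AffineSubspace.direction_top]
  simp

theorem mid_mem_carrier (S : TaggedSimplex d) : S.mid ∈ S.carrier :=
  (convex_convexHull ℝ _).midpoint_mem (vertices_subset_carrier _ (x_mem_vertices _ _))
    (vertices_subset_carrier _ (x_mem_vertices _ _))

theorem child_carrier_subset (hd : 1 ≤ d) (hC : C ∈ S.bisect) :
    C.carrier ⊆ S.carrier := by
  refine convexHull_min ?_ (convex_convexHull ℝ _)
  have hin : S.inner ⊆ S.carrier := by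
    rintro _ ⟨i, _, _, rfl⟩; exact vertices_subset_carrier _ (x_mem_vertices _ _)
  rcases mem_bisect.1 hC with rfl | rfl
  · rw [child₁_vertices hd]
    exact Set.insert_subset (vertices_subset_carrier _ (x_mem_vertices _ _))
      (Set.insert_subset S.mid_mem_carrier hin)
  · rw [child₂_vertices hd]
    exact Set.insert_subset (vertices_subset_carrier _ (x_mem_vertices _ _))
      (Set.insert_subset S.mid_mem_carrier hin)

theorem carrier_subset_union (hd : 1 ≤ d) :
    S.carrier ⊆ S.child₁.carrier ∪ S.child₂.carrier := by
  simp only [carrier]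
  rw [child₁_vertices hd, child₂_vertices hd, vertices_eq]
  exact convexHull_insert_insert_subset _ _ _

theorem child_tag_lt (hd : 1 ≤ d) (hC : C ∈ S.bisect) : C.tag < d := by
  rcases mem_bisect.1 hC with rfl | rfl <;> exact Nat.mod_lt _ hd

theorem child_level (hC : C ∈ S.bisect) : C.level = S.level + 1 := by
  rcases mem_bisect.1 hC with rfl | rfl <;> rfl

/-- The difference of the barycentric coordinates of the two end points of the refinement edge:
it separates the two children. -/
theorem exists_separating (hd : 1 ≤ d) (h : AffineIndependent ℝ S.vert) :
    ∃ f : EuclideanSpace ℝ (Fin d) →ᵃ[ℝ] ℝ, f (S.x 0) = 1 ∧ f (S.x d) = -1 ∧ f S.mid = 0 ∧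
      (∀ p ∈ S.inner, f p = 0) := by
  obtain ⟨a, ha1, ha0⟩ := exists_coord h (Nat.zero_le d)
  obtain ⟨b, hb1, hb0⟩ := exists_coord h (le_refl d)
  have e1 : (a - b) (S.x 0) = 1 := by
    simp [ha1, hb0 0 (by omega) (by omega)]
  have e2 : (a - b) (S.x d) = -1 := by
    simp [hb1, ha0 d le_rfl (by omega)]
  refine ⟨a - b, e1, e2, ?_, ?_⟩
  · rw [mid, AffineMap.map_midpoint_real, e1, e2]; norm_num
  · rintro _ ⟨i, h0, hi, rfl⟩
    simp [ha0 i hi.le (by omega), hb0 i hi.le (by omega)]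

theorem children_inter (hd : 1 ≤ d) (h : AffineIndependent ℝ S.vert) :
    S.child₁.carrier ∩ S.child₂.carrier ⊆ convexHull ℝ (insert S.mid S.inner) := by
  obtain ⟨f, f0, fd, fm, fi⟩ := exists_separating hd h
  rintro p ⟨hp1, hp2⟩
  rw [carrier, child₁_vertices hd] at hp1
  rw [carrier, child₂_vertices hd] at hp2
  have h1 : ∀ w ∈ insert (S.x 0) (insert S.mid S.inner), 0 ≤ f w := by
    rintro w (rfl | rfl | hw)
    · rw [f0]; norm_num
    · rw [fm]
    · rw [fi w hw]
  have h2 : ∀ w ∈ insert (S.x d) (insert S.mid S.inner), 0 ≤ (-f) w := by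
    rintro w (rfl | rfl | hw)
    · simp [fd]
    · simp [fm]
    · simp [fi w hw]
  have e1 := nonneg_of_mem_convexHull h1 hp1
  have e2 := nonneg_of_mem_convexHull h2 hp2
  have e3 : f p = 0 := by simp at e2; linarith
  refine convexHull_mono ?_ (mem_convexHull_zeros_of_nonneg h1 hp1 e3)
  rintro w ⟨rfl | hw, h0⟩
  · rw [f0] at h0; norm_num at h0
  · exact hw

theorem ncard_inner_le : S.inner.ncard ≤ d - 1 := by
  have : S.inner ⊆ S.x '' Set.Ioo 0 d := by
    rintro _ ⟨i, h0, hi, rfl⟩; exact ⟨i, ⟨h0, hi⟩, rfl⟩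
  refine (Set.ncard_le_ncard this ((Set.finite_Ioo 0 d).image _)).trans ?_
  refine (Set.ncard_image_le (Set.finite_Ioo 0 d)).trans ?_
  rw [← Finset.coe_Ioo, Set.ncard_coe_finset]; simp

theorem inner_finite : S.inner.Finite :=
  S.vertices_finite.subset (by
    rintro _ ⟨i, _, _, rfl⟩; exact x_mem_vertices _ _)

theorem convexDim_children_inter (hd : 1 ≤ d) (h : AffineIndependent ℝ S.vert) :
    convexDim (S.child₁.carrier ∩ S.child₂.carrier) ≤ d - 1 := by
  refine (convexDim_mono (children_inter hd h)).trans ?_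
  rw [convexDim_convexHull]
  refine convexDim_le_of_ncard (inner_finite.insert _) ?_
  exact (Set.ncard_insert_le _ _).trans (by have := S.ncard_inner_le; omega)

/-- A child does not contain both end points of the refinement edge. -/
theorem not_refinementEdge_subset_child (hd : 1 ≤ d)
    (h : AffineIndependent ℝ S.vert) (hC : C ∈ S.bisect) :
    ¬ (S.x 0 ∈ C.carrier ∧ S.x d ∈ C.carrier) := by
  obtain ⟨f, f0, fd, fm, fi⟩ := exists_separating hd h
  rintro ⟨m0, md⟩
  rcases mem_bisect.1 hC with rfl | rfl
  · rw [carrier, child₁_vertices hd] at md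
    have := nonneg_of_mem_convexHull (f := f) (by
      rintro w (rfl | rfl | hw)
      · rw [f0]; norm_num
      · rw [fm]
      · rw [fi w hw]) md
    rw [fd] at this; norm_num at this
  · rw [carrier, child₂_vertices hd] at m0
    have := nonneg_of_mem_convexHull (f := -f) (by
      rintro w (rfl | rfl | hw)
      · simp [fd]
      · simp [fm]
      · simp [fi w hw]) m0
    simp [f0] at this
    norm_num at this

theorem refinementEdge_subset_iff {A : Set (EuclideanSpace ℝ (Fin d))} (hA : Convex ℝ A) :
    S.refinementEdge ⊆ A ↔ S.x 0 ∈ A ∧ S.x d ∈ A :=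
  ⟨fun h => ⟨h (left_mem_segment ℝ _ _), h (right_mem_segment ℝ _ _)⟩,
    fun h => hA.segment_subset h.1 h.2⟩

theorem convex_carrier (S : TaggedSimplex d) : Convex ℝ S.carrier := convex_convexHull ℝ _

end TaggedSimplex
/-! ### Propagation of the matching condition -/

namespace TaggedSimplex

variable {d : ℕ} {S S' C C' : TaggedSimplex d}

theorem reflect_reflect (hd : 1 ≤ d) : S.reflect.reflect = S := by
  refine ext_x (fun j hj => ?_) rfl rfl
  have ht' : S.reflect.tag = S.tag := rfl
  rcases Nat.eq_zero_or_pos j with rfl | h0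
  · rw [reflect_x_zero, reflect_x_last hd]
  rcases hj.eq_or_lt with h | hjd
  · rw [h, reflect_x_last hd, reflect_x_zero]
  rcases Nat.lt_or_ge S.tag j with h | h
  · rw [reflect_x_of_lt (S := S.reflect) h0 hjd h, ht',
      reflect_x_of_lt (by omega) (by omega) (by omega)]
    congr 1; omega
  · rw [reflect_x_of_le (S := S.reflect) h0 hjd h, reflect_x_of_le h0 hjd h]

theorem AgreeOff.symm {j : ℕ} (h : AgreeOff S S' j) : AgreeOff S' S j :=
  ⟨h.1.symm, fun i hi hij => (h.2 i hi hij).symm⟩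

theorem AgreeOff.reflect {j : ℕ} (hd : 1 ≤ d) (h : AgreeOff S S' j) (hj : j ≤ d) :
    ∃ j' ≤ d, AgreeOff S.reflect S'.reflect j' := by
  have hs := h.1
  rcases Nat.eq_zero_or_pos j with rfl | h0
  · refine ⟨d, le_rfl, h.1, fun i hi hij => ?_⟩
    rcases Nat.eq_zero_or_pos i with rfl | i0
    · rw [reflect_x_zero, reflect_x_zero, h.2 d le_rfl (by omega)]
    rcases Nat.lt_or_ge S.tag i with hit | hit
    · rw [reflect_x_of_lt i0 (by omega) hit, reflect_x_of_lt i0 (by omega) (by omega), hs,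
        h.2 _ (by omega) (by omega)]
    · rw [reflect_x_of_le i0 (by omega) hit, reflect_x_of_le i0 (by omega) (by omega),
        h.2 _ (by omega) (by omega)]
  have key : ∀ j', j' ≤ d → (∀ i ≤ d, i ≠ j' → i = 0 → j ≠ d) →
      (∀ i ≤ d, i ≠ j' → i = d → j ≠ 0) →
      (∀ i, 0 < i → i < d → i ≠ j' → S.tag < i → d + S.tag - i ≠ j) →
      (∀ i, 0 < i → i < d → i ≠ j' → i ≤ S.tag → i ≠ j) →
      ∃ j' ≤ d, AgreeOff S.reflect S'.reflect j' := by
    intro j' hj' k1 k2 k3 k4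
    refine ⟨j', hj', h.1, fun i hi hij => ?_⟩
    rcases Nat.eq_zero_or_pos i with rfl | i0
    · rw [reflect_x_zero, reflect_x_zero, h.2 d le_rfl (k1 0 hi hij rfl).symm]
    rcases hi.eq_or_lt with rfl | hid
    · rw [reflect_x_last hd, reflect_x_last hd, h.2 0 (by omega) (k2 _ le_rfl hij rfl).symm]
    rcases Nat.lt_or_ge S.tag i with hit | hit
    · rw [reflect_x_of_lt i0 (by omega) hit, reflect_x_of_lt i0 (by omega) (by omega), hs,
        h.2 _ (by omega) (by rw [← hs]; exact k3 i i0 hid hij hit)]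
    · rw [reflect_x_of_le i0 (by omega) hit, reflect_x_of_le i0 (by omega) (by omega),
        h.2 _ (by omega) (k4 i i0 hid hij hit)]
  rcases hj.eq_or_lt with h1 | hjd
  · exact key 0 (by omega) (by omega) (by omega) (by omega) (by omega)
  rcases Nat.lt_or_ge S.tag j with h | h
  · exact key (d + S.tag - j) (by omega) (by omega) (by omega) (by omega) (by omega)
  · exact key j (by omega) (by omega) (by omega) (by omega) (by omega)

theorem Adj.symm (hd : 1 ≤ d) (h : Adj S S') : Adj S' S := by
  obtain ⟨j, hj, h | h⟩ := h
  · exact ⟨j, hj, Or.inl h.symm⟩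
  · obtain ⟨j', hj', h'⟩ := h.reflect hd hj
    rw [reflect_reflect hd] at h'
    exact ⟨j', hj', Or.inr h'.symm⟩

theorem affineIndependent_reflect (hd : 1 ≤ d) (ht : S.tag < d) (h : AffineIndependent ℝ S.vert) :
    AffineIndependent ℝ S.reflect.vert := by
  have h1 : Set.range S.reflect.vert = Set.range S.vert := reflect_vertices hd ht
  rw [affineIndependent_iff_finrank_vectorSpan_eq (n := d) ℝ _ (by simp), h1,
    ← affineIndependent_iff_finrank_vectorSpan_eq (n := d) ℝ _ (by simp)]
  exact h

theorem reflect_carrier (hd : 1 ≤ d) (ht : S.tag < d) : S.reflect.carrier = S.carrier := by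
  rw [carrier, reflect_vertices hd ht, carrier]

/-- The vertices of the hyperface opposite to the vertex `x_j`. -/
def face (S : TaggedSimplex d) (j : ℕ) : Set (EuclideanSpace ℝ (Fin d)) :=
  {p | ∃ i ≤ d, i ≠ j ∧ S.x i = p}

theorem face_subset (S : TaggedSimplex d) (j : ℕ) : S.face j ⊆ S.vertices := by
  rintro _ ⟨i, _, _, rfl⟩; exact x_mem_vertices _ _

theorem face_eq_diff (h : AffineIndependent ℝ S.vert) {j : ℕ} (hj : j ≤ d) :
    S.face j = S.vertices \ {S.x j} := by
  ext p
  constructor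
  · rintro ⟨i, hi, hij, rfl⟩
    exact ⟨x_mem_vertices _ _, fun he => hij (x_inj h hi hj he)⟩
  · rintro ⟨hp, hne⟩
    obtain ⟨i, hi, rfl⟩ := mem_vertices_iff.1 hp
    exact ⟨i, hi, fun he => hne (by rw [he]; rfl), rfl⟩

theorem ncard_face (h : AffineIndependent ℝ S.vert) {j : ℕ} (hj : j ≤ d) :
    (S.face j).ncard = d := by
  rw [face_eq_diff h hj, Set.ncard_sdiff_singleton_of_mem (x_mem_vertices _ _), ncard_vertices h]
  rfl

theorem exists_face_eq (h : AffineIndependent ℝ S.vert) {W : Set (EuclideanSpace ℝ (Fin d))}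
    (hW : W ⊆ S.vertices) (hc : W.ncard = d) : ∃ j ≤ d, W = S.face j := by
  have hne : W ≠ S.vertices := by
    intro he; rw [he, ncard_vertices h] at hc; omega
  obtain ⟨p, hp, hpW⟩ := Set.exists_of_ssubset (hW.ssubset_of_ne hne)
  obtain ⟨j, hj, rfl⟩ := mem_vertices_iff.1 hp
  refine ⟨j, hj, Set.eq_of_subset_of_ncard_le ?_ ?_ (S.vertices_finite.subset (face_subset _ _))⟩
  · rw [face_eq_diff h hj]
    exact fun q hq => ⟨hW hq, fun he => hpW (he ▸ hq)⟩
  · rw [ncard_face h hj, hc]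

theorem AgreeOff.face_eq {j : ℕ} (h : AgreeOff S S' j) : S.face j = S'.face j := by
  ext p
  constructor
  · rintro ⟨i, hi, hij, rfl⟩; exact ⟨i, hi, hij, (h.2 i hi hij).symm⟩
  · rintro ⟨i, hi, hij, rfl⟩; exact ⟨i, hi, hij, h.2 i hi hij⟩

/-- Two simplices that share a hyperface in a matching way: either they are adjacent, or no
refinement edge lies in the common hyperface and the children that contain it are adjacent. -/
def Good (S S' : TaggedSimplex d) : Prop :=
  (S.vertices ∩ S'.vertices).ncard = d ∧
    S.carrier ∩ S'.carrier = convexHull ℝ (S.vertices ∩ S'.vertices) ∧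
    (({S.x 0, S.x d} ⊆ S'.vertices ∨ {S'.x 0, S'.x d} ⊆ S.vertices) → Adj S S') ∧
    (¬ ({S.x 0, S.x d} ⊆ S'.vertices ∨ {S'.x 0, S'.x d} ⊆ S.vertices) →
      ∀ C ∈ S.bisect, ∀ C' ∈ S'.bisect, S.vertices ∩ S'.vertices ⊆ C.vertices →
        S.vertices ∩ S'.vertices ⊆ C'.vertices → Adj C C')

theorem Good.symm (hd : 1 ≤ d) (h : Good S S') : Good S' S := by
  obtain ⟨h1, h2, h3, h4⟩ := h
  rw [Set.inter_comm] at h1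
  refine ⟨h1, ?_, fun h => (h3 h.symm).symm hd, fun h C hC C' hC' k k' => ?_⟩
  · rw [Set.inter_comm, h2, Set.inter_comm]
  · rw [Set.inter_comm] at k k'
    exact (h4 (fun h' => h h'.symm) C' hC' C hC k' k).symm hd

theorem x_last_notMem_child₁ (hd : 1 ≤ d) (h : AffineIndependent ℝ S.vert) :
    S.x d ∉ S.child₁.carrier := fun hm =>
  not_refinementEdge_subset_child hd h (mem_bisect.2 (Or.inl rfl))
    ⟨vertices_subset_carrier _ (by rw [child₁_vertices hd]; simp), hm⟩

theorem x_zero_notMem_child₂ (hd : 1 ≤ d) (h : AffineIndependent ℝ S.vert) :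
    S.x 0 ∉ S.child₂.carrier := fun hm =>
  not_refinementEdge_subset_child hd h (mem_bisect.2 (Or.inr rfl))
    ⟨hm, vertices_subset_carrier _ (by rw [child₂_vertices hd]; simp)⟩

theorem eq_child₂_of_face_zero_subset (hd : 1 ≤ d) (h : AffineIndependent ℝ S.vert)
    (hC : C ∈ S.bisect) (hf : S.face 0 ⊆ C.vertices) : C = S.child₂ := by
  rcases mem_bisect.1 hC with rfl | rfl
  · exact absurd (vertices_subset_carrier _ (hf ⟨d, le_rfl, by omega, rfl⟩))
      (x_last_notMem_child₁ hd h)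
  · rfl

theorem eq_child₁_of_face_last_subset (hd : 1 ≤ d) (h : AffineIndependent ℝ S.vert)
    (hC : C ∈ S.bisect) (hf : S.face d ⊆ C.vertices) : C = S.child₁ := by
  rcases mem_bisect.1 hC with rfl | rfl
  · rfl
  · exact absurd (vertices_subset_carrier _ (hf ⟨0, by omega, by omega, rfl⟩))
      (x_zero_notMem_child₂ hd h)

theorem pair_subset_face {j : ℕ} (h0 : 0 < j) (hj : j < d) :
    {S.x 0, S.x d} ⊆ S.face j := by
  rintro p (rfl | rfl)
  · exact ⟨0, by omega, by omega, rfl⟩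
  · exact ⟨d, le_rfl, by omega, rfl⟩

theorem Good.of_agreeOff (hd : 1 ≤ d) (h : AffineIndependent ℝ S.vert)
    (h' : AffineIndependent ℝ S'.vert) {j : ℕ} (hj : j ≤ d) (ha : AgreeOff S S' j)
    (hi : S.carrier ∩ S'.carrier ⊆ convexHull ℝ (S.face j)) : Good S S' := by
  have hf' : S.face j ⊆ S'.vertices := ha.face_eq ▸ face_subset _ _
  have hV := inter_vertices_eq h (face_subset _ _) hf' hi
  refine ⟨by rw [hV, ncard_face h hj], ?_, fun _ => ha.adj hj, fun hn C hC C' hC' k k' => ?_⟩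
  · rw [hV]; exact hi.antisymm (convexHull_subset_inter (face_subset _ _) hf')
  · rw [hV] at k k'
    rcases Nat.eq_zero_or_pos j with rfl | h0
    · rw [eq_child₂_of_face_zero_subset hd h hC k,
        eq_child₂_of_face_zero_subset hd h' hC' (ha.face_eq ▸ k')]
      exact (ha.child₂_of_zero hd).adj hd
    rcases hj.eq_or_lt with rfl | hjd
    · rw [eq_child₁_of_face_last_subset hd h hC k,
        eq_child₁_of_face_last_subset hd h' hC' (ha.face_eq ▸ k')]
      exact (ha.child₁_of_last hd).adj hd
    · exact absurd (Or.inl ((pair_subset_face h0 hjd).trans hf')) hn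

theorem Good.of_reflect (hd : 1 ≤ d) (ht : S.tag < d) (h : Good S.reflect S') : Good S S' := by
  obtain ⟨h1, h2, h3, h4⟩ := h
  rw [reflect_vertices hd ht] at h1 h2 h3 h4
  rw [reflect_carrier hd ht] at h2
  rw [reflect_x_zero, reflect_x_last hd, Set.pair_comm] at h3 h4
  rw [reflect_bisect hd] at h4
  refine ⟨h1, h2, fun k => ?_, h4⟩
  obtain ⟨j, hj, hh⟩ := h3 k
  rw [reflect_reflect hd] at hh
  exact ⟨j, hj, hh.symm⟩

/-- Adjacent simplices that meet in a common hyperface match. -/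
theorem Good.of_adj (hd : 1 ≤ d) (ht : S.tag < d) (h : AffineIndependent ℝ S.vert)
    (h' : AffineIndependent ℝ S'.vert) (ha : Adj S S') {W : Set (EuclideanSpace ℝ (Fin d))}
    (hW : W ⊆ S.vertices) (hW' : W ⊆ S'.vertices) (hc : W.ncard = d)
    (hi : S.carrier ∩ S'.carrier ⊆ convexHull ℝ W) : Good S S' := by
  have key : ∀ R : TaggedSimplex d, AffineIndependent ℝ R.vert → R.vertices = S.vertices →
      R.carrier = S.carrier → (∃ j ≤ d, AgreeOff R S' j) → Good R S' := by
    rintro R hR hv hcar ⟨j, hj, hag⟩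
    refine Good.of_agreeOff hd hR h' hj hag ?_
    have hV := inter_vertices_eq (S := R) hR (hv ▸ hW) hW' (hcar ▸ hi)
    have hsub : R.face j ⊆ W := by
      rw [← hV]
      exact Set.subset_inter (face_subset _ _) (hag.face_eq ▸ face_subset _ _)
    have heq : R.face j = W := Set.eq_of_subset_of_ncard_le hsub
      (by rw [hc, ncard_face hR hj]) (S.vertices_finite.subset hW)
    rw [heq, hcar]; exact hi
  obtain ⟨j, hj, hag | hag⟩ := ha
  · exact key S h rfl rfl ⟨j, hj, hag⟩
  · exact Good.of_reflect hd ht (key _ (affineIndependent_reflect hd ht h)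
      (reflect_vertices hd ht) (reflect_carrier hd ht) ⟨j, hj, hag⟩)

theorem inner_subset_vertices : S.inner ⊆ S.vertices := by
  rintro _ ⟨i, _, _, rfl⟩; exact x_mem_vertices _ _

/-- The trace of a child on a hyperface of the parent that contains the refinement edge. -/
theorem child_inter_face_subset (hd : 1 ≤ d) (h : AffineIndependent ℝ S.vert) {j k : ℕ}
    (h0 : 0 < j) (hj : j < d) (hC : C ∈ S.bisect) (hk : C.x k = S.x j) :
    C.carrier ∩ convexHull ℝ (S.face j) ⊆ convexHull ℝ (C.face k) := by
  rintro p ⟨hp, hpf⟩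
  obtain ⟨c, c1, c0⟩ := exists_coord h hj.le
  have hcp : c p = 0 := eq_zero_of_mem_convexHull (fun w hw => by
    obtain ⟨i, hi, hij, rfl⟩ := hw
    exact c0 i hi hij) hpf
  have hmid : c S.mid = 0 := by
    rw [mid, AffineMap.map_midpoint_real, c0 0 (by omega) (by omega), c0 d le_rfl (by omega)]
    norm_num
  have hnn : ∀ w ∈ insert S.mid S.vertices, 0 ≤ c w := by
    rintro w (rfl | hw)
    · rw [hmid]
    · obtain ⟨i, hi, rfl⟩ := mem_vertices_iff.1 hw
      by_cases hij : i = j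
      · rw [hij, c1]; norm_num
      · rw [c0 i hi hij]
  have hCv : C.vertices ⊆ insert S.mid S.vertices := by
    rcases mem_bisect.1 hC with rfl | rfl
    · rw [child₁_vertices hd]
      rintro w (rfl | rfl | hw)
      · exact Or.inr (x_mem_vertices _ _)
      · exact Or.inl rfl
      · exact Or.inr (inner_subset_vertices hw)
    · rw [child₂_vertices hd]
      rintro w (rfl | rfl | hw)
      · exact Or.inr (x_mem_vertices _ _)
      · exact Or.inl rfl
      · exact Or.inr (inner_subset_vertices hw)
  refine convexHull_mono ?_
    (mem_convexHull_zeros_of_nonneg (fun w hw => hnn w (hCv hw)) hp hcp)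
  rintro w ⟨hw, hw0⟩
  obtain ⟨i, hi, rfl⟩ := mem_vertices_iff.1 hw
  refine ⟨i, hi, ?_, rfl⟩
  rintro rfl
  rw [hk, c1] at hw0
  norm_num at hw0

/-- The two halves of a bisected hyperface meet in dimension at most `d - 2`. -/
theorem convexDim_halves_le (hd : 2 ≤ d) (h : AffineIndependent ℝ S.vert) {j : ℕ}
    (h0 : 0 < j) (hj : j < d) :
    convexDim (S.child₁.carrier ∩ S.child₂.carrier ∩ convexHull ℝ (S.face j)) ≤ d - 2 := by
  obtain ⟨c, c1, c0⟩ := exists_coord h hj.le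
  have hmid : c S.mid = 0 := by
    rw [mid, AffineMap.map_midpoint_real, c0 0 (by omega) (by omega), c0 d le_rfl (by omega)]
    norm_num
  have hsub : S.child₁.carrier ∩ S.child₂.carrier ∩ convexHull ℝ (S.face j) ⊆
      convexHull ℝ (insert S.mid (S.inner \ {S.x j})) := by
    rintro p ⟨hp, hpf⟩
    have hcp : c p = 0 := eq_zero_of_mem_convexHull (fun w hw => by
      obtain ⟨i, hi, hij, rfl⟩ := hw
      exact c0 i hi hij) hpf
    refine convexHull_mono ?_ (mem_convexHull_zeros_of_nonneg ?_
      (children_inter (by omega) h hp) hcp)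
    · rintro w ⟨rfl | hw, hw0⟩
      · exact Or.inl rfl
      · refine Or.inr ⟨hw, ?_⟩
        rintro rfl
        rw [c1] at hw0; norm_num at hw0
    · rintro w (rfl | ⟨i, hi0, hi, rfl⟩)
      · rw [hmid]
      · by_cases hij : i = j
        · rw [hij, c1]; norm_num
        · rw [c0 i hi.le hij]
  refine (convexDim_mono hsub).trans ?_
  rw [convexDim_convexHull]
  refine convexDim_le_of_ncard ((inner_finite.subset Set.sdiff_subset).insert _) ?_
  refine (Set.ncard_insert_le _ _).trans ?_
  have h1 : (S.inner \ {S.x j}).ncard < S.inner.ncard :=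
    Set.ncard_sdiff_singleton_lt_of_mem ⟨j, h0, hj, rfl⟩ inner_finite
  have := S.ncard_inner_le
  omega

/-- If the vertex sequences of two parents agree off a position inside, then both parents are bisected
along the same edge, and the children match position by position. -/
theorem Good.children_of_agreeOff (hd : 2 ≤ d) (h : AffineIndependent ℝ S.vert)
    (h' : AffineIndependent ℝ S'.vert) {j : ℕ} (h0 : 0 < j) (hj : j < d) (ha : AgreeOff S S' j)
    (hi : S.carrier ∩ S'.carrier ⊆ convexHull ℝ (S.face j)) (hC : C ∈ S.bisect)
    (hC' : C' ∈ S'.bisect) (hdim : convexDim (C.carrier ∩ C'.carrier) = d - 1) : Good C C' := by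
  have hd1 : 1 ≤ d := by omega
  have hsub : C.carrier ∩ C'.carrier ⊆ convexHull ℝ (S.face j) :=
    (Set.inter_subset_inter (child_carrier_subset hd1 hC) (child_carrier_subset hd1 hC')).trans hi
  have nC := child_affineIndependent hd1 h hC
  have nC' := child_affineIndependent hd1 h' hC'
  have a1 := ha.child₁ h0 hj
  obtain ⟨k, k2, kd, e1, e2, a2⟩ := ha.child₂ h0 hj
  have c1 : S.child₁.x (j + 1) = S.x j := child₁_x (by omega) (by omega)
  have c1' : S'.child₁.x (j + 1) = S'.x j := child₁_x (by omega) (by omega)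
  have m1 : S.child₁ ∈ S.bisect := mem_bisect.2 (Or.inl rfl)
  have m2 : S.child₂ ∈ S.bisect := mem_bisect.2 (Or.inr rfl)
  have m1' : S'.child₁ ∈ S'.bisect := mem_bisect.2 (Or.inl rfl)
  have m2' : S'.child₂ ∈ S'.bisect := mem_bisect.2 (Or.inr rfl)
  -- the traces of the children of `S'` on the common hyperface lie in the children of `S`
  have t1 : S'.child₁.carrier ∩ convexHull ℝ (S.face j) ⊆ S.child₁.carrier := by
    rw [ha.face_eq]
    refine (child_inter_face_subset hd1 h' h0 hj m1' c1').trans ?_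
    rw [← a1.face_eq]; exact convexHull_mono (face_subset _ _)
  have t2 : S'.child₂.carrier ∩ convexHull ℝ (S.face j) ⊆ S.child₂.carrier := by
    rw [ha.face_eq]
    refine (child_inter_face_subset hd1 h' h0 hj m2' e2).trans ?_
    rw [← a2.face_eq]; exact convexHull_mono (face_subset _ _)
  have hhalf := convexDim_halves_le hd h h0 hj
  rcases mem_bisect.1 hC with rfl | rfl <;> rcases mem_bisect.1 hC' with rfl | rfl
  · exact Good.of_agreeOff hd1 nC nC' (by omega) a1 fun p hp =>
      child_inter_face_subset hd1 h h0 hj m1 c1 ⟨hp.1, hsub hp⟩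
  · have : S.child₁.carrier ∩ S'.child₂.carrier ⊆
        S.child₁.carrier ∩ S.child₂.carrier ∩ convexHull ℝ (S.face j) := fun p hp =>
      ⟨⟨hp.1, t2 ⟨hp.2, hsub hp⟩⟩, hsub hp⟩
    have := convexDim_mono this
    omega
  · have : S.child₂.carrier ∩ S'.child₁.carrier ⊆
        S.child₁.carrier ∩ S.child₂.carrier ∩ convexHull ℝ (S.face j) := fun p hp =>
      ⟨⟨t1 ⟨hp.2, hsub hp⟩, hp.1⟩, hsub hp⟩
    have := convexDim_mono this
    omega
  · exact Good.of_agreeOff hd1 nC nC' (by omega) a2 fun p hp =>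
      child_inter_face_subset hd1 h h0 hj m2 e1 ⟨hp.1, hsub hp⟩

/-- The second child does not contain the vertex `x_0`, so that it meets the hyperface opposite to
`x_d` in dimension at most `d - 2`. -/
theorem convexDim_child₂_face_last_le (hd : 2 ≤ d) (h : AffineIndependent ℝ S.vert) :
    convexDim (S.child₂.carrier ∩ convexHull ℝ (S.face d)) ≤ d - 2 := by
  obtain ⟨c, c1, c0⟩ := exists_coord h (le_refl d)
  have hmid : c S.mid = 1 / 2 := by
    rw [mid, AffineMap.map_midpoint_real, c0 0 (by omega) (by omega), c1]
    norm_num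
  have hin : ∀ w ∈ S.inner, c w = 0 := by
    rintro _ ⟨i, _, hi, rfl⟩; exact c0 i hi.le (by omega)
  have hsub : S.child₂.carrier ∩ convexHull ℝ (S.face d) ⊆ convexHull ℝ S.inner := by
    rintro p ⟨hp, hpf⟩
    have hcp : c p = 0 := eq_zero_of_mem_convexHull (fun w hw => by
      obtain ⟨i, hi, hij, rfl⟩ := hw
      exact c0 i hi hij) hpf
    rw [carrier, child₂_vertices (by omega)] at hp
    refine convexHull_mono ?_ (mem_convexHull_zeros_of_nonneg ?_ hp hcp)
    · rintro w ⟨rfl | rfl | hw, hw0⟩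
      · rw [c1] at hw0; norm_num at hw0
      · rw [hmid] at hw0; norm_num at hw0
      · exact hw
    · rintro w (rfl | rfl | hw)
      · rw [c1]; norm_num
      · rw [hmid]; norm_num
      · rw [hin w hw]
  refine (convexDim_mono hsub).trans ?_
  rw [convexDim_convexHull]
  exact convexDim_le_of_ncard inner_finite (by have := S.ncard_inner_le; omega)

/-- The counterpart of `convexDim_child₂_face_last_le` for the first child and the hyperface opposite
to `x_0`. -/
theorem convexDim_child₁_face_zero_le (hd : 2 ≤ d) (h : AffineIndependent ℝ S.vert) :
    convexDim (S.child₁.carrier ∩ convexHull ℝ (S.face 0)) ≤ d - 2 := by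
  obtain ⟨c, c1, c0⟩ := exists_coord h (Nat.zero_le d)
  have hmid : c S.mid = 1 / 2 := by
    rw [mid, AffineMap.map_midpoint_real, c0 d le_rfl (by omega), c1]
    norm_num
  have hin : ∀ w ∈ S.inner, c w = 0 := by
    rintro _ ⟨i, _, hi, rfl⟩; exact c0 i hi.le (by omega)
  have hsub : S.child₁.carrier ∩ convexHull ℝ (S.face 0) ⊆ convexHull ℝ S.inner := by
    rintro p ⟨hp, hpf⟩
    have hcp : c p = 0 := eq_zero_of_mem_convexHull (fun w hw => by
      obtain ⟨i, hi, hij, rfl⟩ := hw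
      exact c0 i hi hij) hpf
    rw [carrier, child₁_vertices (by omega)] at hp
    refine convexHull_mono ?_ (mem_convexHull_zeros_of_nonneg ?_ hp hcp)
    · rintro w ⟨rfl | rfl | hw, hw0⟩
      · rw [c1] at hw0; norm_num at hw0
      · rw [hmid] at hw0; norm_num at hw0
      · exact hw
    · rintro w (rfl | rfl | hw)
      · rw [c1]; norm_num
      · rw [hmid]; norm_num
      · rw [hin w hw]
  refine (convexDim_mono hsub).trans ?_
  rw [convexDim_convexHull]
  exact convexDim_le_of_ncard inner_finite (by have := S.ncard_inner_le; omega)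

theorem face_last_subset_child₁ (hd : 1 ≤ d) : S.face d ⊆ S.child₁.vertices := by
  rw [child₁_vertices hd]
  rintro _ ⟨i, hi, hid, rfl⟩
  rcases Nat.eq_zero_or_pos i with rfl | h0
  · exact Or.inl rfl
  · exact Or.inr (Or.inr ⟨i, h0, by omega, rfl⟩)

theorem face_zero_subset_child₂ (hd : 1 ≤ d) : S.face 0 ⊆ S.child₂.vertices := by
  rw [child₂_vertices hd]
  rintro _ ⟨i, hi, hid, rfl⟩
  rcases hi.eq_or_lt with rfl | h
  · exact Or.inl rfl
  · exact Or.inr (Or.inr ⟨i, by omega, h, rfl⟩)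

/-- If the refinement edge does not lie in a hyperface, then exactly one child contains this
hyperface, and the other one meets it in lower dimension. The refinement edge of the former lies
in the hyperface. -/
theorem child_of_face (hd : 2 ≤ d) (h : AffineIndependent ℝ S.vert)
    {W : Set (EuclideanSpace ℝ (Fin d))} (hW : W ⊆ S.vertices) (hc : W.ncard = d)
    (hn : ¬ {S.x 0, S.x d} ⊆ W) :
    ∃ C ∈ S.bisect, W ⊆ C.vertices ∧ C.x 0 ∈ W ∧ C.x d ∈ W ∧
      ∀ D ∈ S.bisect, d - 1 ≤ convexDim (D.carrier ∩ convexHull ℝ W) → D = C := by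
  obtain ⟨j, hj, rfl⟩ := exists_face_eq h hW hc
  rcases Nat.eq_zero_or_pos j with rfl | h0
  · refine ⟨_, mem_bisect.2 (Or.inr rfl), face_zero_subset_child₂ (by omega), ?_, ?_, ?_⟩
    · exact ⟨d, le_rfl, by omega, child₂_x_zero.symm⟩
    · rcases Nat.lt_or_ge (S.tag + 1) d with ht | ht
      · exact ⟨S.tag + 1, by omega, by omega, by
          rw [child₂_x_of_lt hd le_rfl ht]; congr 1; omega⟩
      · exact ⟨d - 1, by omega, by omega, by rw [child₂_x_of_le hd le_rfl ht]⟩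
    · intro D hD hdim
      rcases mem_bisect.1 hD with rfl | rfl
      · have := convexDim_child₁_face_zero_le hd h
        omega
      · rfl
  rcases hj.eq_or_lt with hjd | hjd
  · rw [hjd]
    refine ⟨_, mem_bisect.2 (Or.inl rfl), face_last_subset_child₁ (by omega), ?_, ?_, ?_⟩
    · exact ⟨0, by omega, by omega, child₁_x_zero.symm⟩
    · exact ⟨d - 1, by omega, by omega, by rw [child₁_x hd le_rfl]⟩
    · intro D hD hdim
      rcases mem_bisect.1 hD with rfl | rfl
      · rfl
      · have := convexDim_child₂_face_last_le hd h
        omega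
  · exact absurd (pair_subset_face h0 hjd) hn

/-- Children of matching simplices match. -/
theorem Good.children (hd : 2 ≤ d) (ht : S.tag < d) (h : AffineIndependent ℝ S.vert)
    (h' : AffineIndependent ℝ S'.vert) (hg : Good S S')
    (hC : C ∈ S.bisect) (hC' : C' ∈ S'.bisect)
    (hdim : convexDim (C.carrier ∩ C'.carrier) = d - 1) : Good C C' := by
  have hd1 : 1 ≤ d := by omega
  obtain ⟨g1, g2, g3, g4⟩ := hg
  by_cases hre : {S.x 0, S.x d} ⊆ S'.vertices ∨ {S'.x 0, S'.x d} ⊆ S.vertices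
  · have key : ∀ R : TaggedSimplex d, AffineIndependent ℝ R.vert → R.vertices = S.vertices →
        R.carrier = S.carrier → R.bisect = S.bisect →
        ({R.x 0, R.x d} : Set (EuclideanSpace ℝ (Fin d))) = {S.x 0, S.x d} →
        (∃ j ≤ d, AgreeOff R S' j) → Good C C' := by
      rintro R hR hv hcar hb hpair ⟨j, hj, hag⟩
      have hfV : R.face j = S.vertices ∩ S'.vertices := by
        refine Set.eq_of_subset_of_ncard_le (Set.subset_inter ?_ ?_) ?_
          (S.vertices_finite.subset Set.inter_subset_left)
        · rw [← hv]; exact face_subset _ _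
        · rw [hag.face_eq]; exact face_subset _ _
        · rw [g1, ncard_face hR hj]
      have hxj : R.x j ∉ S.vertices ∩ S'.vertices := by
        rw [← hfV, face_eq_diff hR hj]; simp
      have hxj' : S'.x j ∉ S.vertices ∩ S'.vertices := by
        rw [← hfV, hag.face_eq, face_eq_diff h' hj]; simp
      -- the vertex `x_j` opposite to the common hyperface is not on the refinement edge
      have hj0 : 0 < j ∧ j < d := by
        rcases hre with k | k
        · rw [← hpair] at k
          constructor
          · rcases Nat.eq_zero_or_pos j with rfl | h0
            · exact absurd ⟨hv ▸ x_mem_vertices _ _, k (by simp)⟩ hxj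
            · exact h0
          · rcases hj.eq_or_lt with rfl | h0
            · exact absurd ⟨hv ▸ x_mem_vertices _ _, k (by simp)⟩ hxj
            · exact h0
        · constructor
          · rcases Nat.eq_zero_or_pos j with rfl | h0
            · exact absurd ⟨k (by simp), x_mem_vertices _ _⟩ hxj'
            · exact h0
          · rcases hj.eq_or_lt with rfl | h0
            · exact absurd ⟨k (by simp), x_mem_vertices _ _⟩ hxj'
            · exact h0
      exact Good.children_of_agreeOff hd hR h' hj0.1 hj0.2 hag (by rw [hfV, hcar, g2])
        (hb ▸ hC) hC' hdim
    obtain ⟨j, hj, hag | hag⟩ := g3 hre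
    · exact key S h rfl rfl rfl rfl ⟨j, hj, hag⟩
    · exact key _ (affineIndependent_reflect hd1 ht h) (reflect_vertices hd1 ht)
        (reflect_carrier hd1 ht) (reflect_bisect hd1)
        (by rw [reflect_x_zero, reflect_x_last hd1, Set.pair_comm]) ⟨j, hj, hag⟩
  · have hsub : C.carrier ∩ C'.carrier ⊆ convexHull ℝ (S.vertices ∩ S'.vertices) := by
      rw [← g2]
      exact Set.inter_subset_inter (child_carrier_subset hd1 hC) (child_carrier_subset hd1 hC')
    -- by the uniqueness in `child_of_face`, the two children contain the common hyperface
    have hVC : S.vertices ∩ S'.vertices ⊆ C.vertices := by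
      obtain ⟨B, hB, hVB, -, -, huniq⟩ := child_of_face hd h Set.inter_subset_left g1
        (fun k => hre (Or.inl (k.trans Set.inter_subset_right)))
      have := huniq C hC (hdim ▸ convexDim_mono (Set.subset_inter Set.inter_subset_left hsub))
      rwa [this]
    have hVC' : S.vertices ∩ S'.vertices ⊆ C'.vertices := by
      obtain ⟨B, hB, hVB, -, -, huniq⟩ := child_of_face hd h' Set.inter_subset_right g1
        (fun k => hre (Or.inr (k.trans Set.inter_subset_left)))
      have := huniq C' hC' (hdim ▸ convexDim_mono (Set.subset_inter Set.inter_subset_right hsub))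
      rwa [this]
    exact Good.of_adj hd1 (child_tag_lt hd1 hC) (child_affineIndependent hd1 h hC)
      (child_affineIndependent hd1 h' hC') (g4 hre C hC C' hC' hVC hVC') hVC hVC' g1 hsub

/-- Siblings match. -/
theorem Good.siblings (hd : 2 ≤ d) (ht : S.tag < d) (h : AffineIndependent ℝ S.vert) :
    Good S.child₁ S.child₂ := by
  have hd1 : 1 ≤ d := by omega
  have m1 : S.child₁ ∈ S.bisect := mem_bisect.2 (Or.inl rfl)
  have m2 : S.child₂ ∈ S.bisect := mem_bisect.2 (Or.inr rfl)
  have n1 := child_affineIndependent hd1 h m1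
  have n2 := child_affineIndependent hd1 h m2
  have hf1 : S.child₁.face 0 = insert S.mid S.inner := by
    rw [face_eq_diff n1 (by omega), child₁_vertices hd1, child₁_x_zero,
      Set.insert_sdiff_of_mem _ (Set.mem_singleton _)]
    refine Set.sdiff_singleton_eq_self fun hm => ?_
    refine x_zero_notMem_child₂ hd1 h (vertices_subset_carrier _ ?_)
    rw [child₂_vertices hd1]; exact Or.inr hm
  have hf2 : S.child₂.face 0 = insert S.mid S.inner := by
    rw [face_eq_diff n2 (by omega), child₂_vertices hd1, child₂_x_zero,
      Set.insert_sdiff_of_mem _ (Set.mem_singleton _)]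
    refine Set.sdiff_singleton_eq_self fun hm => ?_
    refine x_last_notMem_child₁ hd1 h (vertices_subset_carrier _ ?_)
    rw [child₁_vertices hd1]; exact Or.inr hm
  have hi := children_inter hd1 h
  have hsub1 : insert S.mid S.inner ⊆ S.child₁.vertices := hf1 ▸ face_subset _ _
  have hsub2 : insert S.mid S.inner ⊆ S.child₂.vertices := hf2 ▸ face_subset _ _
  have hV := inter_vertices_eq n1 hsub1 hsub2 hi
  refine ⟨by rw [hV, ← hf1, ncard_face n1 (by omega)], ?_, fun hre => ?_,
    fun _ C hC C' hC' k k' => ?_⟩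
  · rw [hV]; exact hi.antisymm (convexHull_subset_inter hsub1 hsub2)
  · exfalso
    rcases hre with k | k
    · exact x_zero_notMem_child₂ hd1 h (vertices_subset_carrier _
        (k (by rw [child₁_x_zero]; simp)))
    · exact x_last_notMem_child₁ hd1 h (vertices_subset_carrier _
        (k (by rw [child₂_x_zero]; simp)))
  · rw [hV] at k k'
    rw [eq_child₂_of_face_zero_subset hd1 n1 hC (hf1 ▸ k),
      eq_child₂_of_face_zero_subset hd1 n2 hC' (hf2 ▸ k')]
    exact adj_siblings hd ht

/-- Matching simplices have the same refinement edge as soon as one of them contains the refinement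
edge of the other. -/
theorem Good.pair_eq (hd : 1 ≤ d) (h : AffineIndependent ℝ S.vert)
    (h' : AffineIndependent ℝ S'.vert) (hg : Good S S') (h0 : S.x 0 ∈ S'.carrier)
    (h1 : S.x d ∈ S'.carrier) :
    ({S.x 0, S.x d} : Set (EuclideanSpace ℝ (Fin d))) = {S'.x 0, S'.x d} := by
  obtain ⟨g1, g2, g3, -⟩ := hg
  have hmem : ∀ i, S.x i ∈ S'.carrier → S.x i ∈ S'.vertices := by
    intro i hi
    have : S.x i ∈ convexHull ℝ (S.vertices ∩ S'.vertices) := by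
      rw [← g2]; exact ⟨vertices_subset_carrier _ (x_mem_vertices _ _), hi⟩
    exact (mem_of_mem_convexHull h Set.inter_subset_left (x_mem_vertices _ _) this).2
  have m0 := hmem 0 h0
  have m1 := hmem d h1
  obtain ⟨j, hj, hag⟩ := g3 (Or.inl (by rintro p (rfl | rfl); exacts [m0, m1]))
  -- the vertex in the exceptional position is not a common one, as not all vertices are common
  have hj' : S'.x j ∉ S.vertices := by
    intro hm
    have hall : S'.vertices ⊆ S.vertices ∩ S'.vertices := by
      intro p hp
      refine ⟨?_, hp⟩
      obtain ⟨i, hi, rfl⟩ := mem_vertices_iff.1 hp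
      by_cases hij : i = j
      · rwa [hij]
      · rcases hag with hag | hag
        · rw [← hag.2 i hi hij]; exact x_mem_vertices _ _
        · rw [← hag.2 i hi hij]
          have key : S.reflect.vertices ⊆ S.vertices := by
            intro q hq
            obtain ⟨i, hi, rfl⟩ := mem_vertices_iff.1 hq
            rcases Nat.eq_zero_or_pos i with rfl | i0
            · rw [reflect_x_zero]; exact x_mem_vertices _ _
            rcases hi.eq_or_lt with rfl | hid
            · rw [reflect_x_last hd]; exact x_mem_vertices _ _
            rcases Nat.lt_or_ge S.tag i with ht | ht
            · rw [reflect_x_of_lt i0 hid ht]; exact x_mem_vertices _ _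
            · rw [reflect_x_of_le i0 hid ht]; exact x_mem_vertices _ _
          exact key (x_mem_vertices _ _)
    have := Set.ncard_le_ncard hall (S.vertices_finite.subset Set.inter_subset_left)
    rw [g1, ncard_vertices h'] at this
    omega
  -- the exceptional position is neither the first nor the last one
  have hpos : ∀ i ≤ d, S'.x i ∈ ({S.x 0, S.x d} : Set (EuclideanSpace ℝ (Fin d))) → i ≠ j := by
    rintro i hi (hm | hm) rfl
    · exact hj' (hm ▸ x_mem_vertices _ _)
    · exact hj' (hm ▸ x_mem_vertices _ _)
  obtain ⟨i0, hi0, e0⟩ := mem_vertices_iff.1 m0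
  obtain ⟨i1, hi1, e1⟩ := mem_vertices_iff.1 m1
  have n0 := hpos i0 hi0 (Or.inl e0)
  have n1 := hpos i1 hi1 (Or.inr e1)
  rcases hag with hag | hag
  · have f0 : i0 = 0 := x_inj h hi0 (by omega) ((hag.2 i0 hi0 n0).trans e0)
    have f1 : i1 = d := x_inj h hi1 le_rfl ((hag.2 i1 hi1 n1).trans e1)
    rw [← e0, ← e1, f0, f1]
  · have r0 : S.reflect.x i0 = S.x 0 := (hag.2 i0 hi0 n0).trans e0
    have r1 : S.reflect.x i1 = S.x d := (hag.2 i1 hi1 n1).trans e1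
    have hinj : ∀ i ≤ d, (S.reflect.x i = S.x 0 → i = d) ∧ (S.reflect.x i = S.x d → i = 0) := by
      intro i hi
      rcases Nat.eq_zero_or_pos i with rfl | ipos
      · rw [reflect_x_zero]
        exact ⟨fun e => by have := x_inj h le_rfl (by omega) e; omega, fun _ => rfl⟩
      rcases hi.eq_or_lt with rfl | hid
      · rw [reflect_x_last hd]
        exact ⟨fun _ => rfl, fun e => by have := x_inj h (by omega) le_rfl e; omega⟩
      rcases Nat.lt_or_ge S.tag i with ht | ht
      · rw [reflect_x_of_lt ipos hid ht]
        exact ⟨fun e => by have := x_inj h (by omega) (by omega) e; omega,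
          fun e => by have := x_inj h (by omega) (by omega) e; omega⟩
      · rw [reflect_x_of_le ipos hid ht]
        exact ⟨fun e => by have := x_inj h (by omega) (by omega) e; omega,
          fun e => by have := x_inj h (by omega) (by omega) e; omega⟩
    have f0 := (hinj i0 hi0).1 r0
    have f1 := (hinj i1 hi1).2 r1
    rw [← e0, ← e1, f0, f1, Set.pair_comm]

theorem mem_carrier_of_pair_eq
    (hp : ({S.x 0, S.x d} : Set (EuclideanSpace ℝ (Fin d))) = {S'.x 0, S'.x d}) :
    S.x 0 ∈ S'.carrier ∧ S.x d ∈ S'.carrier := by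
  have h0 : S.x 0 ∈ ({S'.x 0, S'.x d} : Set (EuclideanSpace ℝ (Fin d))) := by rw [← hp]; simp
  have h1 : S.x d ∈ ({S'.x 0, S'.x d} : Set (EuclideanSpace ℝ (Fin d))) := by rw [← hp]; simp
  constructor
  · rcases h0 with h | h <;> rw [h] <;> exact vertices_subset_carrier _ (x_mem_vertices _ _)
  · rcases h1 with h | h <;> rw [h] <;> exact vertices_subset_carrier _ (x_mem_vertices _ _)

end TaggedSimplex
/-! ### Bisected time intervals -/

namespace TimeInterval

variable {I I' J J' : TimeInterval}

/-- The two intervals have a common interior point. -/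
def Overlap (I I' : TimeInterval) : Prop := max I.lo I'.lo < min I.hi I'.hi

/-- The closures of the two intervals meet in exactly one point. -/
def Touch (I I' : TimeInterval) : Prop := max I.lo I'.lo = min I.hi I'.hi

theorem closure_toSet (h : I.lo < I.hi) : closure I.toSet = Set.Icc I.lo I.hi := by
  unfold toSet
  split_ifs
  · exact isClosed_Icc.closure_eq
  · exact closure_Ico h.ne

theorem ncard_closure_inter_eq_one_iff (h : I.lo < I.hi) (h' : I'.lo < I'.hi) :
    (closure I.toSet ∩ closure I'.toSet).ncard = 1 ↔ Touch I I' := by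
  rw [closure_toSet h, closure_toSet h', Set.Icc_inter_Icc, Touch, Set.ncard_eq_one]
  constructor
  · rintro ⟨x, hx⟩
    have hne : (Set.Icc (max I.lo I'.lo) (min I.hi I'.hi)).Nonempty := hx ▸ Set.singleton_nonempty x
    have hle := Set.nonempty_Icc.1 hne
    have h1 : max I.lo I'.lo ∈ ({x} : Set ℝ) := hx ▸ Set.left_mem_Icc.2 hle
    have h2 : min I.hi I'.hi ∈ ({x} : Set ℝ) := hx ▸ Set.right_mem_Icc.2 hle
    rw [Set.mem_singleton_iff] at h1 h2
    exact h1.trans h2.symm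
  · intro he
    exact ⟨min I.hi I'.hi, by
      have : max I.lo I'.lo ⊔ min I.hi I'.hi = min I.hi I'.hi := by simp [he]
      change Set.Icc (max I.lo I'.lo) (min I.hi I'.hi) = _
      rw [he, Set.Icc_self]⟩

theorem volume_inter_pos_iff : 0 < MeasureTheory.volume (I.toSet ∩ I'.toSet) ↔ Overlap I I' := by
  unfold Overlap
  constructor
  · intro h
    by_contra hn
    have hsub : I.toSet ∩ I'.toSet ⊆ Set.Icc (max I.lo I'.lo) (min I.hi I'.hi) := by
      rw [← Set.Icc_inter_Icc]
      refine Set.inter_subset_inter ?_ ?_ <;> unfold toSet <;> split_ifs <;>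
        first | exact subset_rfl | exact Set.Ico_subset_Icc_self
    have := MeasureTheory.measure_mono (μ := MeasureTheory.volume) hsub
    rw [Real.volume_Icc, ENNReal.ofReal_of_nonpos (by linarith)] at this
    exact absurd h (by simpa using this)
  · intro h
    have hsub : Set.Ico (max I.lo I'.lo) (min I.hi I'.hi) ⊆ I.toSet ∩ I'.toSet := by
      rw [← Set.Ico_inter_Ico]
      refine Set.inter_subset_inter ?_ ?_ <;> unfold toSet <;> split_ifs <;>
        first | exact subset_rfl | exact Set.Ico_subset_Icc_self
    refine lt_of_lt_of_le ?_ (MeasureTheory.measure_mono hsub)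
    rw [Real.volume_Ico, ENNReal.ofReal_pos]
    linarith

theorem mem_bisect : J ∈ I.bisect ↔
    J = ⟨I.lo, (I.lo + I.hi) / 2, false⟩ ∨ J = ⟨(I.lo + I.hi) / 2, I.hi, I.closedRight⟩ := by
  simp [bisect]

theorem mem_bisectIter_succ {m : ℕ} :
    J ∈ I.bisectIter (m + 1) ↔ ∃ I' ∈ I.bisectIter m, J ∈ I'.bisect := by
  simp [bisectIter]

theorem mem_bisectIter_zero : J ∈ I.bisectIter 0 ↔ J = I := by
  simp [bisectIter]

theorem mem_bisectIter_add {m k : ℕ} :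
    J ∈ I.bisectIter (m + k) ↔ ∃ I' ∈ I.bisectIter m, J ∈ I'.bisectIter k := by
  induction k generalizing J with
  | zero => simp [mem_bisectIter_zero]
  | succ k ih =>
    rw [← add_assoc, mem_bisectIter_succ]
    simp only [mem_bisectIter_succ, ih]
    constructor
    · rintro ⟨K, ⟨I', h1, h2⟩, h3⟩; exact ⟨I', h1, K, h2, h3⟩
    · rintro ⟨I', h1, K, h2, h3⟩; exact ⟨K, ⟨I', h1, h2⟩, h3⟩

open Classical in
theorem card_bisectIter_le (I : TimeInterval) (m : ℕ) : (I.bisectIter m).card ≤ 2 ^ m := by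
  induction m with
  | zero => simp [bisectIter]
  | succ m ih =>
    have : (I.bisectIter (m + 1)).card ≤ (I.bisectIter m).card * 2 :=
      Finset.card_biUnion_le_card_mul _ _ _ fun J _ => Finset.card_le_two
    rw [pow_succ]; omega

theorem bisectIter_spec (h : I.lo < I.hi) {m : ℕ} (hJ : J ∈ I.bisectIter m) :
    I.lo ≤ J.lo ∧ J.hi ≤ I.hi ∧ J.hi - J.lo = (I.hi - I.lo) / 2 ^ m := by
  induction m generalizing J with
  | zero => rw [mem_bisectIter_zero] at hJ; subst hJ; simp
  | succ m ih =>
    obtain ⟨K, hK, hJ⟩ := mem_bisectIter_succ.1 hJ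
    obtain ⟨h1, h2, h3⟩ := ih hK
    have hpos : 0 < (I.hi - I.lo) / 2 ^ m := by
      have : 0 < I.hi - I.lo := by linarith
      positivity
    have hh : (I.hi - I.lo) / 2 ^ (m + 1) = (I.hi - I.lo) / 2 ^ m / 2 := by
      rw [pow_succ]; field_simp
    rw [hh]
    rcases mem_bisect.1 hJ with rfl | rfl
    · exact ⟨h1, by simp only; linarith, by simp only; linarith⟩
    · exact ⟨by simp only; linarith, h2, by simp only; linarith⟩

theorem lo_lt_hi_of_mem_bisectIter (h : I.lo < I.hi) {m : ℕ} (hJ : J ∈ I.bisectIter m) :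
    J.lo < J.hi := by
  obtain ⟨-, -, h3⟩ := bisectIter_spec h hJ
  have : 0 < (I.hi - I.lo) / 2 ^ m := by
    have : 0 < I.hi - I.lo := by linarith
    positivity
  linarith

theorem Overlap.mono (h : Overlap J J') (h1 : I.lo ≤ J.lo) (h2 : J.hi ≤ I.hi)
    (h1' : I'.lo ≤ J'.lo) (h2' : J'.hi ≤ I'.hi) : Overlap I I' := by
  unfold Overlap at *
  exact (max_le_max h1 h1').trans_lt (h.trans_le (min_le_min h2 h2'))

theorem overlap_of_subset (h : J.lo < J.hi) (h1 : I.lo ≤ J.lo) (h2 : J.hi ≤ I.hi) :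
    Overlap J I := by
  unfold Overlap; rw [max_eq_left h1, min_eq_left h2]; exact h

theorem overlap_self (h : J.lo < J.hi) : Overlap J J := overlap_of_subset h le_rfl le_rfl

theorem bisectIter_separated (h : I.lo < I.hi) {m : ℕ} (hJ : J ∈ I.bisectIter m)
    (hJ' : J' ∈ I.bisectIter m) (hne : J ≠ J') : ¬ Overlap J J' := by
  induction m generalizing J J' with
  | zero => rw [mem_bisectIter_zero] at hJ hJ'; exact absurd (hJ.trans hJ'.symm) hne
  | succ m ih =>
    obtain ⟨K, hK, hJ⟩ := mem_bisectIter_succ.1 hJ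
    obtain ⟨K', hK', hJ'⟩ := mem_bisectIter_succ.1 hJ'
    have l := lo_lt_hi_of_mem_bisectIter h hK
    have l' := lo_lt_hi_of_mem_bisectIter h hK'
    intro ho
    by_cases he : K = K'
    · subst he
      unfold Overlap at ho
      rcases mem_bisect.1 hJ with rfl | rfl <;> rcases mem_bisect.1 hJ' with rfl | rfl
      · exact hne rfl
      · simp at ho
      · simp at ho
      · exact hne rfl
    · refine ih hK hK' he (ho.mono ?_ ?_ ?_ ?_)
      · rcases mem_bisect.1 hJ with rfl | rfl <;> simp only <;> linarith
      · rcases mem_bisect.1 hJ with rfl | rfl <;> simp only <;> linarith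
      · rcases mem_bisect.1 hJ' with rfl | rfl <;> simp only <;> linarith
      · rcases mem_bisect.1 hJ' with rfl | rfl <;> simp only <;> linarith

end TimeInterval

namespace InitialMesh

variable {d : ℕ} (D : InitialMesh d)

open Classical in
/-- The time intervals of bisection depth `m`. -/
noncomputable def timeDepth (m : ℕ) : Finset TimeInterval := D.intervals.biUnion (·.bisectIter m)

variable {D} {I I' J J' : TimeInterval} {m k : ℕ}

theorem mem_intervals : I ∈ D.intervals ↔ ∃ i : Fin D.N,
    (⟨D.t i.castSucc, D.t i.succ, decide ((i : ℕ) + 1 = D.N)⟩ : TimeInterval) = I := by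
  simp [intervals]

theorem mem_timeDepth : J ∈ D.timeDepth m ↔ ∃ I ∈ D.intervals, J ∈ I.bisectIter m := by
  simp [timeDepth]

theorem mem_timeDepth_zero : J ∈ D.timeDepth 0 ↔ J ∈ D.intervals := by
  simp [mem_timeDepth, TimeInterval.mem_bisectIter_zero]

theorem intervals_lo_lt_hi (h : I ∈ D.intervals) : I.lo < I.hi := by
  obtain ⟨i, rfl⟩ := mem_intervals.1 h
  exact D.t_strictMono (Fin.castSucc_lt_succ)

theorem mem_timeDepth_add : J ∈ D.timeDepth (m + k) ↔ ∃ I ∈ D.timeDepth m, J ∈ I.bisectIter k := by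
  simp only [mem_timeDepth, TimeInterval.mem_bisectIter_add]
  constructor
  · rintro ⟨I, h1, K, h2, h3⟩; exact ⟨K, ⟨I, h1, h2⟩, h3⟩
  · rintro ⟨K, ⟨I, h1, h2⟩, h3⟩; exact ⟨I, h1, K, h2, h3⟩

theorem timeDepth_lo_lt_hi (h : J ∈ D.timeDepth m) : J.lo < J.hi := by
  obtain ⟨I, hI, hJ⟩ := mem_timeDepth.1 h
  exact TimeInterval.lo_lt_hi_of_mem_bisectIter (intervals_lo_lt_hi hI) hJ

/-- Overlapping intervals of the same depth coincide. -/
theorem timeDepth_eq_of_overlap (h : J ∈ D.timeDepth m) (h' : J' ∈ D.timeDepth m)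
    (ho : J.Overlap J') : J = J' := by
  obtain ⟨I, hI, hJ⟩ := mem_timeDepth.1 h
  obtain ⟨I', hI', hJ'⟩ := mem_timeDepth.1 h'
  have l := intervals_lo_lt_hi hI
  have l' := intervals_lo_lt_hi hI'
  have hII : I = I' := by
    obtain ⟨a1, a2, -⟩ := TimeInterval.bisectIter_spec l hJ
    obtain ⟨b1, b2, -⟩ := TimeInterval.bisectIter_spec l' hJ'
    have hO := ho.mono a1 a2 b1 b2
    obtain ⟨i, rfl⟩ := mem_intervals.1 hI
    obtain ⟨i', rfl⟩ := mem_intervals.1 hI'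
    unfold TimeInterval.Overlap at hO
    simp only [max_lt_iff, lt_min_iff] at hO
    have e1 := D.t_strictMono.lt_iff_lt.1 hO.1.2
    have e2 := D.t_strictMono.lt_iff_lt.1 hO.2.1
    rw [Fin.lt_def] at e1 e2
    simp at e1 e2
    have : i = i' := by ext; omega
    rw [this]
  subst hII
  by_contra hne
  exact TimeInterval.bisectIter_separated l hJ hJ' hne ho

theorem timeDepth_parent_unique (h : I ∈ D.timeDepth m) (h' : I' ∈ D.timeDepth m)
    (hJ : J ∈ I.bisectIter k) (hJ' : J ∈ I'.bisectIter k) : I = I' := by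
  have l := timeDepth_lo_lt_hi h
  have l' := timeDepth_lo_lt_hi h'
  obtain ⟨a1, a2, -⟩ := TimeInterval.bisectIter_spec l hJ
  obtain ⟨b1, b2, -⟩ := TimeInterval.bisectIter_spec l' hJ'
  exact timeDepth_eq_of_overlap h h' ((TimeInterval.overlap_self
    (TimeInterval.lo_lt_hi_of_mem_bisectIter l hJ)).mono a1 a2 b1 b2)

/-! ### Uniform refinements of the initial triangulation -/

open Classical in
/-- The uniform refinement of level `n` of the initial triangulation. -/
noncomputable def simplices (D : InitialMesh d) : ℕ → Finset (TaggedSimplex d)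
  | 0 => D.tri
  | n + 1 => (D.simplices n).biUnion TaggedSimplex.bisect

variable {n : ℕ} {S S' C C' A A' : TaggedSimplex d}

theorem mem_simplices_succ : S ∈ D.simplices (n + 1) ↔ ∃ A ∈ D.simplices n, S ∈ A.bisect := by
  simp [simplices]

theorem dim_pos (D : InitialMesh d) : 1 ≤ d := by have := D.γ_lt; omega

theorem simplices_spec (h : S ∈ D.simplices n) :
    AffineIndependent ℝ S.vert ∧ S.tag < d ∧ S.level = n := by
  induction n generalizing S with
  | zero => exact ⟨D.nondegenerate S h, D.tag_eq S h ▸ D.γ_lt, D.level_eq S h⟩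
  | succ n ih =>
    obtain ⟨A, hA, hS⟩ := mem_simplices_succ.1 h
    obtain ⟨h1, -, h3⟩ := ih hA
    exact ⟨TaggedSimplex.child_affineIndependent D.dim_pos h1 hS,
      TaggedSimplex.child_tag_lt D.dim_pos hS, by rw [TaggedSimplex.child_level hS, h3]⟩

theorem simplices_level (h : S ∈ D.simplices n) : S.level = n := (simplices_spec h).2.2

theorem simplices_affineIndependent (h : S ∈ D.simplices n) : AffineIndependent ℝ S.vert :=
  (simplices_spec h).1

theorem simplices_convexDim_lt (h : S ∈ D.simplices n) (h' : S' ∈ D.simplices n) (hne : S ≠ S') :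
    convexDim (S.carrier ∩ S'.carrier) < d := by
  have hd := D.dim_pos
  induction n generalizing S S' with
  | zero =>
    obtain ⟨A, hA, -, hi⟩ := D.conforming S h S' h' hne
    rw [hi, convexDim_convexHull]
    have h1 := Set.ncard_lt_ncard hA S.vertices_finite
    rw [TaggedSimplex.ncard_vertices (D.nondegenerate S h)] at h1
    have := convexDim_le_of_ncard (k := d - 1) (S.vertices_finite.subset hA.subset) (by omega)
    omega
  | succ n ih =>
    obtain ⟨A, hA, hS⟩ := mem_simplices_succ.1 h
    obtain ⟨A', hA', hS'⟩ := mem_simplices_succ.1 h'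
    by_cases he : A = A'
    · subst he
      have hdim := TaggedSimplex.convexDim_children_inter hd (simplices_affineIndependent hA)
      rcases TaggedSimplex.mem_bisect.1 hS with rfl | rfl <;>
        rcases TaggedSimplex.mem_bisect.1 hS' with rfl | rfl
      · exact absurd rfl hne
      · omega
      · rw [Set.inter_comm]; omega
      · exact absurd rfl hne
    · exact (convexDim_mono (Set.inter_subset_inter
        (TaggedSimplex.child_carrier_subset hd hS)
        (TaggedSimplex.child_carrier_subset hd hS'))).trans_lt (ih hA hA' he)

theorem simplices_eq_of_convexDim (h : S ∈ D.simplices n) (h' : S' ∈ D.simplices n)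
    (hdim : convexDim (S.carrier ∩ S'.carrier) = d) : S = S' := by
  by_contra hne
  exact (simplices_convexDim_lt h h' hne).ne hdim

theorem convexDim_eq_of_subset (h : S ∈ D.simplices n) {A : Set (EuclideanSpace ℝ (Fin d))}
    (hA : S.carrier ⊆ A) : convexDim A = d :=
  (convexDim_le A).antisymm ((TaggedSimplex.convexDim_carrier
    (simplices_affineIndependent h)).symm.le.trans (convexDim_mono hA))

theorem simplices_parent_unique (h : A ∈ D.simplices n) (h' : A' ∈ D.simplices n)
    (hS : S ∈ A.bisect) (hS' : S ∈ A'.bisect) : A = A' :=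
  simplices_eq_of_convexDim h h' (convexDim_eq_of_subset (mem_simplices_succ.2 ⟨A, h, hS⟩)
    (Set.subset_inter (TaggedSimplex.child_carrier_subset D.dim_pos hS)
      (TaggedSimplex.child_carrier_subset D.dim_pos hS')))

theorem adj_of_reflectedNeighbor (h : S.ReflectedNeighbor S') : S.Adj S' := by
  obtain ⟨-, ht, h | h⟩ := h
  · obtain ⟨j, hj⟩ := Set.ncard_eq_one.1 h
    refine ⟨j, Nat.lt_succ_iff.1 j.2, Or.inl ⟨ht, fun i hi hij => ?_⟩⟩
    by_contra hne
    rw [TaggedSimplex.x_eq_vert _ hi, TaggedSimplex.x_eq_vert _ hi] at hne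
    have : (⟨i, Nat.lt_succ_of_le hi⟩ : Fin (d + 1)) ∈ ({j} : Set (Fin (d + 1))) := hj ▸ hne
    exact hij (congrArg Fin.val this)
  · obtain ⟨j, hj⟩ := Set.ncard_eq_one.1 h
    refine ⟨j, Nat.lt_succ_iff.1 j.2, Or.inr ⟨ht, fun i hi hij => ?_⟩⟩
    by_contra hne
    rw [TaggedSimplex.x_eq_vert _ hi, TaggedSimplex.x_eq_vert _ hi] at hne
    have : (⟨i, Nat.lt_succ_of_le hi⟩ : Fin (d + 1)) ∈ ({j} : Set (Fin (d + 1))) := hj ▸ hne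
    exact hij (congrArg Fin.val this)

/-- The well-labeled initial triangulation is matching across hyperfaces. -/
theorem good_of_tri (hd : 2 ≤ d) (h : S ∈ D.tri) (h' : S' ∈ D.tri) (hne : S ≠ S')
    (hdim : convexDim (S.carrier ∩ S'.carrier) = d - 1) : S.Good S' := by
  have hd1 : 1 ≤ d := by omega
  have nS := D.nondegenerate S h
  have nS' := D.nondegenerate S' h'
  obtain ⟨A, hA, hA', hi⟩ := D.conforming S h S' h' hne
  have hV := TaggedSimplex.inter_vertices_eq nS hA.subset hA'.subset hi.subset
  have hAd : A.ncard = d := by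
    have h1 := Set.ncard_lt_ncard hA S.vertices_finite
    rw [TaggedSimplex.ncard_vertices nS] at h1
    rw [hi, convexDim_convexHull] at hdim
    have h2 : ¬ A.ncard ≤ (d - 2) + 1 := fun hc => by
      have := convexDim_le_of_ncard (S.vertices_finite.subset hA.subset) hc
      omega
    omega
  have hN : S.Neighbor S' := by rw [TaggedSimplex.Neighbor, hV, hAd]
  have hM := D.well_labeled S h S' h' hN
  unfold TaggedSimplex.Match at hM
  refine ⟨hN, by rw [hV, hi], fun hre => ?_, fun hre C hC C' hC' k k' => ?_⟩
  · rw [if_pos hre] at hM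
    exact adj_of_reflectedNeighbor hM
  · rw [if_neg hre] at hM
    refine adj_of_reflectedNeighbor (hM C hC C' hC' ?_)
    rw [TaggedSimplex.Neighbor, TaggedSimplex.inter_vertices_eq
      (TaggedSimplex.child_affineIndependent hd1 nS hC) k k', hV, hAd]
    rw [hV, ← hi]
    exact Set.inter_subset_inter (TaggedSimplex.child_carrier_subset hd1 hC)
      (TaggedSimplex.child_carrier_subset hd1 hC')

/-- Every uniform refinement is matching across hyperfaces. -/
theorem simplices_good (hd : 2 ≤ d) (h : S ∈ D.simplices n) (h' : S' ∈ D.simplices n)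
    (hne : S ≠ S') (hdim : convexDim (S.carrier ∩ S'.carrier) = d - 1) : S.Good S' := by
  have hd1 : 1 ≤ d := by omega
  induction n generalizing S S' with
  | zero => exact good_of_tri hd h h' hne hdim
  | succ n ih =>
    obtain ⟨A, hA, hS⟩ := mem_simplices_succ.1 h
    obtain ⟨A', hA', hS'⟩ := mem_simplices_succ.1 h'
    obtain ⟨nA, tA, -⟩ := simplices_spec hA
    by_cases he : A = A'
    · subst he
      have hg := TaggedSimplex.Good.siblings hd tA nA
      rcases TaggedSimplex.mem_bisect.1 hS with rfl | rfl <;>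
        rcases TaggedSimplex.mem_bisect.1 hS' with rfl | rfl
      · exact absurd rfl hne
      · exact hg
      · exact hg.symm hd1
      · exact absurd rfl hne
    · have h1 := simplices_convexDim_lt hA hA' he
      have h2 := convexDim_mono (Set.inter_subset_inter
        (TaggedSimplex.child_carrier_subset hd1 hS) (TaggedSimplex.child_carrier_subset hd1 hS'))
      exact TaggedSimplex.Good.children hd tA nA (simplices_affineIndependent hA')
        (ih hA hA' he (by omega)) hS hS' hdim

/-- If two simplices of the same level share a hyperface containing the refinement edge of one of
them, then they have the same refinement edge. -/
theorem simplices_pair_eq (hd : 2 ≤ d) (h : S ∈ D.simplices n) (h' : S' ∈ D.simplices n)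
    (hdim : convexDim (S.carrier ∩ S'.carrier) = d - 1) (hre : S.refinementEdge ⊆ S'.carrier) :
    ({S.x 0, S.x d} : Set (EuclideanSpace ℝ (Fin d))) = {S'.x 0, S'.x d} := by
  have hne : S ≠ S' := by
    rintro rfl
    rw [convexDim_eq_of_subset h (Set.subset_inter subset_rfl subset_rfl)] at hdim
    omega
  obtain ⟨h0, h1⟩ := (TaggedSimplex.refinementEdge_subset_iff S'.convex_carrier).1 hre
  exact (simplices_good hd h h' hne hdim).pair_eq D.dim_pos (simplices_affineIndependent h)
    (simplices_affineIndependent h') h0 h1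

/-- Each simplex of a finer level is contained in a child of a simplex of the coarser level. -/
theorem exists_ancestor {k : ℕ} (hk : n < k) (h : S ∈ D.simplices k) :
    ∃ A ∈ D.simplices n, ∃ C ∈ A.bisect, S.carrier ⊆ C.carrier := by
  induction k, hk using Nat.le_induction generalizing S with
  | base =>
    obtain ⟨A, hA, hS⟩ := mem_simplices_succ.1 h
    exact ⟨A, hA, S, hS, subset_rfl⟩
  | succ k _ ih =>
    obtain ⟨B, hB, hS⟩ := mem_simplices_succ.1 h
    obtain ⟨A, hA, C, hC, hBC⟩ := ih hB
    exact ⟨A, hA, C, hC, (TaggedSimplex.child_carrier_subset D.dim_pos hS).trans hBC⟩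

/-- A finer simplex that shares a piece of a hyperface with `S` does not contain the refinement
edge of `S`. -/
theorem not_refinementEdge_subset_of_lt (hd : 2 ≤ d) {k : ℕ} (hk : n < k) (h : S ∈ D.simplices n)
    (h' : S' ∈ D.simplices k) (hdim : convexDim (S.carrier ∩ S'.carrier) = d - 1) :
    ¬ S.refinementEdge ⊆ S'.carrier := by
  intro hre
  obtain ⟨A, hA, C, hC, hsub⟩ := exists_ancestor hk h'
  have hCA := TaggedSimplex.child_carrier_subset D.dim_pos hC
  have hne : S ≠ A := by
    rintro rfl
    rw [Set.inter_eq_right.2 (hsub.trans hCA),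
      TaggedSimplex.convexDim_carrier (simplices_affineIndependent h')] at hdim
    omega
  have h1 := simplices_convexDim_lt h hA hne
  have h2 := convexDim_mono (Set.inter_subset_inter_right S.carrier (hsub.trans hCA))
  have hp := simplices_pair_eq hd h hA (by omega) (hre.trans (hsub.trans hCA))
  obtain ⟨h0, hl⟩ := (TaggedSimplex.refinementEdge_subset_iff C.convex_carrier).1 (hre.trans hsub)
  refine TaggedSimplex.not_refinementEdge_subset_child D.dim_pos
    (simplices_affineIndependent hA) hC ?_
  have e0 : A.x 0 ∈ ({S.x 0, S.x d} : Set (EuclideanSpace ℝ (Fin d))) := by rw [hp]; simp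
  have e1 : A.x d ∈ ({S.x 0, S.x d} : Set (EuclideanSpace ℝ (Fin d))) := by rw [hp]; simp
  constructor
  · rcases e0 with e | e <;> rw [e] <;> assumption
  · rcases e1 with e | e <;> rw [e] <;> assumption

/-- Let `A` and `W` share a hyperface that does not contain the refinement edge of `A`. Then the
child of `A` at this hyperface shares it, and its refinement edge, with a child of `W`. -/
theorem exists_matching_child (hd : 2 ≤ d) (hA : A ∈ D.simplices n) (hW : S ∈ D.simplices n)
    (hne : A ≠ S) (hC : C ∈ A.bisect) (hdim : d - 1 ≤ convexDim (C.carrier ∩ S.carrier))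
    (hre : ¬ A.refinementEdge ⊆ S.carrier) :
    ∃ B ∈ S.bisect, convexDim (C.carrier ∩ B.carrier) = d - 1 ∧ C.refinementEdge ⊆ B.carrier ∧
      A.vertices ∩ S.vertices ⊆ C.vertices ∧ A.vertices ∩ S.vertices ⊆ B.vertices := by
  have hd1 := D.dim_pos
  have nA := simplices_affineIndependent hA
  have nW := simplices_affineIndependent hW
  have hCA := TaggedSimplex.child_carrier_subset hd1 hC
  have h1 := simplices_convexDim_lt hA hW hne
  have h2 := convexDim_mono (Set.inter_subset_inter_left S.carrier hCA)
  have hg := simplices_good hd hA hW hne (by omega)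
  have hnA : ¬ {A.x 0, A.x d} ⊆ S.vertices := fun k => hre
    ((TaggedSimplex.refinementEdge_subset_iff S.convex_carrier).2
      ⟨TaggedSimplex.vertices_subset_carrier _ (k (by simp)),
        TaggedSimplex.vertices_subset_carrier _ (k (by simp))⟩)
  have hnW : ¬ {S.x 0, S.x d} ⊆ A.vertices := by
    intro k
    have hp := (hg.symm hd1).pair_eq hd1 nW nA
      (TaggedSimplex.vertices_subset_carrier _ (k (by simp)))
      (TaggedSimplex.vertices_subset_carrier _ (k (by simp)))
    exact hre ((TaggedSimplex.refinementEdge_subset_iff S.convex_carrier).2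
      (TaggedSimplex.mem_carrier_of_pair_eq hp.symm))
  obtain ⟨g1, g2, -, -⟩ := hg
  obtain ⟨C₁, hC₁, v1, e0, e1, u1⟩ := TaggedSimplex.child_of_face hd nA Set.inter_subset_left g1
    (fun k => hnA (k.trans Set.inter_subset_right))
  obtain ⟨B, hB, v2, -, -, -⟩ := TaggedSimplex.child_of_face hd nW Set.inter_subset_right g1
    (fun k => hnW (k.trans Set.inter_subset_left))
  have hCC : C = C₁ := u1 C hC (hdim.trans (convexDim_mono (by
    rw [← g2]
    exact fun p hp => ⟨hp.1, hCA hp.1, hp.2⟩)))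
  subst hCC
  refine ⟨B, hB, ?_, ?_, v1, v2⟩
  · have hlow : convexDim (convexHull ℝ (A.vertices ∩ S.vertices)) = d - 1 := by
      rw [convexDim_convexHull]
      exact convexDim_of_subset_range nA Set.inter_subset_left (g1.trans (by omega))
    have h3 := convexDim_mono (TaggedSimplex.convexHull_subset_inter v1 v2)
    have h4 := convexDim_mono (Set.inter_subset_inter hCA
      (TaggedSimplex.child_carrier_subset hd1 hB))
    omega
  · exact (TaggedSimplex.refinementEdge_subset_iff B.convex_carrier).2
      ⟨TaggedSimplex.vertices_subset_carrier _ (v2 e0),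
        TaggedSimplex.vertices_subset_carrier _ (v2 e1)⟩

end InitialMesh
theorem forEach_iff {α σ : Type} {body : α → σ → σ → Prop} {A : Finset α} {s s' : σ} :
    ForEach body A s s' ↔ ∃ l : List α, l.Nodup ∧ (∀ a, a ∈ l ↔ a ∈ A) ∧ ForList body l s s' := by
  classical
  unfold ForEach
  constructor
  · rintro ⟨l, h1, rfl, h3⟩; exact ⟨l, h1, fun a => by simp, h3⟩
  · rintro ⟨l, h1, h2, h3⟩; exact ⟨l, h1, by ext a; simp [h2 a], h3⟩

/-! ### Refinement trees and admissible sets of split prisms -/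

/-- The tree of all prisms that arise from a set `root` of prisms by atomic splits, with two
dependency relations: `Nbr X Z` says that `X` and `Z` have to be split simultaneously, `Low X Y` that
the coarser prism `Y` has to be split before `X`. -/
structure RefinementTree (d : ℕ) (s₁ s₂ : ℝ) where
  root : Mesh d
  Node : Prism d → Prop
  Nbr : Prism d → Prism d → Prop
  Low : Prism d → Prism d → Prop
  node_root : ∀ {X}, X ∈ root → Node X
  level_root : ∀ {X}, X ∈ root → X.level = 0
  node_child : ∀ {X Y}, Node Y → X ∈ atomicSplit s₁ s₂ Y → Node X
  level_child : ∀ {X Y : Prism d}, X ∈ atomicSplit s₁ s₂ Y → X.level = Y.level + 1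
  root_or_child : ∀ {X}, Node X → X ∈ root ∨ ∃ Y, Node Y ∧ X ∈ atomicSplit s₁ s₂ Y
  parent_unique : ∀ {X Y Y'}, Node Y → Node Y' → X ∈ atomicSplit s₁ s₂ Y →
    X ∈ atomicSplit s₁ s₂ Y' → Y = Y'
  nbr_node : ∀ {X Z}, Nbr X Z → Node Z
  nbr_level : ∀ {X Z : Prism d}, Nbr X Z → Z.level = X.level
  nbr_symm : ∀ {X Z}, Nbr X Z → Nbr Z X
  low_node : ∀ {X Y}, Low X Y → Node Y
  low_level : ∀ {X Y : Prism d}, Low X Y → Y.level + 1 = X.level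

namespace RefinementTree

variable {d : ℕ} {s₁ s₂ : ℝ} (G : RefinementTree d s₁ s₂)

open Classical in
/-- The mesh that results from splitting exactly the prisms in `Q`. -/
noncomputable def leaves (Q : Mesh d) : Mesh d := (G.root ∪ Q.biUnion (atomicSplit s₁ s₂)) \ Q

/-- A set of split prisms is admissible if it is closed under parents and dependencies. -/
def Adm (Q : Mesh d) : Prop :=
  ∀ X ∈ Q, G.Node X ∧ (∀ Y, G.Node Y → X ∈ atomicSplit s₁ s₂ Y → Y ∈ Q) ∧
    (∀ Z, G.Nbr X Z → Z ∈ Q) ∧ (∀ Y, G.Low X Y → Y ∈ Q)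

/-- The prism `X` exists as soon as the prisms in `Q` are split. -/
def Ready (Q : Mesh d) (X : Prism d) : Prop :=
  G.Node X ∧ ∀ Y, G.Node Y → X ∈ atomicSplit s₁ s₂ Y → Y ∈ Q

/-- The coarser prism `Y` has to be split before `X`: either directly, or because it is the parent
of a prism that is to be split simultaneously with `X`. -/
def Dep (X Y : Prism d) : Prop := G.Low X Y ∨ ∃ Z, G.Nbr X Z ∧ G.Node Y ∧ Z ∈ atomicSplit s₁ s₂ Y

/-- Being in the same patch of prisms that are split simultaneously. -/
def Conn (X Z : Prism d) : Prop := Relation.ReflTransGen G.Nbr X Z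

/-- `Reach R Y` says that the refinement of `R` may require the one of `Y`. -/
inductive Reach : Prism d → Prism d → Prop
  | base {R Y : Prism d} : G.Conn R Y → Reach R Y
  | step {R X Z Y : Prism d} : G.Conn R X → G.Dep X Z → Reach Z Y → Reach R Y

variable {G} {Q Q' : Mesh d} {R X Y Z : Prism d}

theorem mem_leaves : X ∈ G.leaves Q ↔
    (X ∈ G.root ∨ ∃ Y ∈ Q, X ∈ atomicSplit s₁ s₂ Y) ∧ X ∉ Q := by
  simp [leaves]

theorem ready_of_mem_leaves (hQ : G.Adm Q) (hX : X ∈ G.leaves Q) : G.Ready Q X := by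
  obtain ⟨h | ⟨Y, hY, hXY⟩, -⟩ := mem_leaves.1 hX
  · refine ⟨G.node_root h, fun Y _ hXY => ?_⟩
    have h1 := G.level_root h
    have h2 := G.level_child hXY
    omega
  · have hN := (hQ Y hY).1
    exact ⟨G.node_child hN hXY, fun Y' hN' hXY' => G.parent_unique hN hN' hXY hXY' ▸ hY⟩

theorem Ready.mem_or_mem_leaves (h : G.Ready Q X) : X ∈ Q ∨ X ∈ G.leaves Q := by
  by_cases hX : X ∈ Q
  · exact Or.inl hX
  · refine Or.inr (mem_leaves.2 ⟨?_, hX⟩)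
    rcases G.root_or_child h.1 with hr | ⟨Y, hN, hXY⟩
    · exact Or.inl hr
    · exact Or.inr ⟨Y, h.2 Y hN hXY, hXY⟩

theorem Ready.mono (h : G.Ready Q X) (hQ : Q ⊆ Q') : G.Ready Q' X :=
  ⟨h.1, fun Y hN hXY => hQ (h.2 Y hN hXY)⟩

theorem Dep.node (h : G.Dep X Y) : G.Node Y := by
  rcases h with h | ⟨Z, _, h2, _⟩
  · exact G.low_node h
  · exact h2

theorem Dep.level (h : G.Dep X Y) : Y.level + 1 = X.level := by
  rcases h with h | ⟨Z, h1, _, h3⟩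
  · exact G.low_level h
  · rw [← G.level_child h3, G.nbr_level h1]

theorem Conn.level (h : G.Conn X Y) : Y.level = X.level := by
  induction h with
  | refl => rfl
  | tail _ h ih => rw [G.nbr_level h, ih]

theorem Reach.level_le (h : G.Reach R Y) : Y.level ≤ R.level := by
  induction h with
  | base h => exact h.level.le
  | step h1 h2 _ ih =>
    have := h1.level
    have := h2.level
    omega

theorem Reach.conn_of_level (h : G.Reach R Y) (hl : Y.level = R.level) : G.Conn R Y := by
  cases h with
  | base h => exact h
  | step h1 h2 h3 =>
    have := h1.level
    have := h2.level
    have := h3.level_le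
    omega

theorem Adm.mem_of_dep (hQ : G.Adm Q) (hX : X ∈ Q) (h : G.Dep X Y) : Y ∈ Q := by
  rcases h with h | ⟨Z, h1, h2, h3⟩
  · exact (hQ X hX).2.2.2 Y h
  · exact (hQ Z ((hQ X hX).2.2.1 Z h1)).2.1 Y h2 h3

theorem Adm.mem_of_conn (hQ : G.Adm Q) (hX : X ∈ Q) (h : G.Conn X Y) : Y ∈ Q := by
  induction h with
  | refl => exact hX
  | tail _ h ih => exact (hQ _ ih).2.2.1 _ h

theorem Adm.mem_of_reach (hQ : G.Adm Q) (hR : R ∈ Q) (h : G.Reach R Y) : Y ∈ Q := by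
  induction h with
  | base h => exact hQ.mem_of_conn hR h
  | step h1 h2 _ ih => exact ih (hQ.mem_of_dep (hQ.mem_of_conn hR h1) h2)

theorem Adm.child_notMem (hQ : G.Adm Q) (hN : G.Node Y) (hY : Y ∉ Q)
    (hX : X ∈ atomicSplit s₁ s₂ Y) : X ∉ Q :=
  fun h => hY ((hQ X h).2.1 Y hN hX)

theorem adm_empty : G.Adm ∅ := fun _ h => absurd h (Finset.notMem_empty _)

theorem leaves_empty : G.leaves ∅ = G.root := by
  ext X; simp [mem_leaves]

variable (G) in
theorem exists_finset_of_level (n : ℕ) :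
    ∃ B : Mesh d, ∀ X, G.Node X → X.level = n → X ∈ B := by
  classical
  induction n with
  | zero =>
    refine ⟨G.root, fun X hN hl => ?_⟩
    rcases G.root_or_child hN with h | ⟨Y, _, h⟩
    · exact h
    · have := G.level_child h; omega
  | succ n ih =>
    obtain ⟨B, hB⟩ := ih
    refine ⟨B.biUnion (atomicSplit s₁ s₂), fun X hN hl => ?_⟩
    rcases G.root_or_child hN with h | ⟨Y, hY, h⟩
    · have := G.level_root h; omega
    · have := G.level_child h
      exact Finset.mem_biUnion.2 ⟨Y, hB Y hY (by omega), h⟩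

variable (G) in
/-- The dependencies describe the necessary refinements computed on admissible meshes, and are
consistent. -/
structure Compatible : Prop where
  mem_neighbors : ∀ {Q X Y}, G.Adm Q → G.Ready Q X → Y ∈ G.leaves Q →
    (Y ∈ neighbors X (G.leaves Q) ↔ G.Nbr X Y ∨ G.Dep X Y)
  mem_spatialNeighbors : ∀ {Q X Y Z}, G.Adm Q → G.Ready Q X → Y ∈ G.leaves Q → G.Nbr X Z →
    Z ∈ atomicSplit s₁ s₂ Y → Y ∈ spatialNeighbors X (G.leaves Q)
  ready_of_dep : ∀ {Q X Y}, G.Adm Q → G.Ready Q X → G.Dep X Y → G.Ready Q Y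
  /-- If two coarser neighbours of `X` are split simultaneously, the children of them that are
  neighbours of `X` are neighbours of each other. -/
  nbr_of_conn : ∀ {Q X Y Y' Z Z'}, G.Adm Q → G.Ready Q X → G.Nbr X Z → G.Nbr X Z' → G.Node Y →
    G.Node Y' → Z ∈ atomicSplit s₁ s₂ Y → Z' ∈ atomicSplit s₁ s₂ Y' → Y ∉ Q → Y' ∉ Q →
    Y ≠ Y' → G.Conn Y Y' → G.Nbr Z Z'
  not_conn_of_low : ∀ {X Y Y' Z}, G.Low X Y → G.Nbr X Z → G.Node Y' →
    Z ∈ atomicSplit s₁ s₂ Y' → ¬ G.Conn Y Y'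

/-! ### Soundness of the loops -/

variable (G) in
/-- `X` is an admissible argument of `PATCH_REFINE` for the mesh with split prisms `Q`: it belongs to
the mesh, or it has been replaced by its children. -/
def Cand (Q : Mesh d) (n : ℕ) (X : Prism d) : Prop :=
  G.Ready Q X ∧ X.level = n ∧ ∀ C ∈ atomicSplit s₁ s₂ X, C ∉ Q

theorem Cand.mono {n : ℕ} (h : G.Cand Q n X) (hQ : Q ⊆ Q')
    (hl : ∀ Y ∈ Q', Y ∉ Q → Y.level < n) : G.Cand Q' n X := by
  refine ⟨h.1.mono hQ, h.2.1, fun C hC hCQ => ?_⟩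
  have h1 := hl C hCQ (h.2.2 C hC)
  have h2 := G.level_child hC
  have h3 := h.2.1
  omega

theorem Cand.of_mem_leaves {n : ℕ} (hQ : G.Adm Q) (hX : X ∈ G.leaves Q) (hl : X.level = n) :
    G.Cand Q n X :=
  have h := ready_of_mem_leaves hQ hX
  ⟨h, hl, fun _ hC => hQ.child_notMem h.1 (mem_leaves.1 hX).2 hC⟩

variable (G) in
/-- The outcome `Q'` of a call of `PATCH_REFINE` for `R`, in terms of split prisms. -/
def Outcome (Q Q' : Mesh d) (R : Prism d) : Prop :=
  Q ⊆ Q' ∧ G.Adm Q' ∧ R ∈ Q' ∧ ∀ Y ∈ Q', Y ∉ Q → G.Reach R Y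

variable (G) in
/-- All terminating executions of `call` for prisms of level `n` have an outcome as expected. -/
def CallSound (call : Mesh d → Prism d → Mesh d → Prop) (n : ℕ) : Prop :=
  ∀ Q R P', G.Adm Q → G.Cand Q n R → call (G.leaves Q) R P' →
    ∃ Q', P' = G.leaves Q' ∧ G.Outcome Q Q' R

variable (G) in
/-- There is a terminating execution of `call` for prisms of level `n`. -/
def CallTotal (call : Mesh d → Prism d → Mesh d → Prop) (n : ℕ) : Prop :=
  ∀ Q R, G.Adm Q → G.Cand Q n R → ∃ P', call (G.leaves Q) R P'

variable (G) in
/-- Invariant of the inner loops of `PATCH_REFINE` for `R`: `Q₀` and `Q` are the prisms split when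
`PATCH_REFINE` was called and now, and `KF` is the union of the current patch and front. -/
structure Inv (R : Prism d) (KF Q₀ Q : Mesh d) (s : Mesh d × Mesh d) : Prop where
  mesh_eq : s.1 = G.leaves Q
  adm : G.Adm Q
  subset : Q₀ ⊆ Q
  reach : ∀ Y ∈ Q, Y ∉ Q₀ → G.Reach R Y ∧ Y.level < R.level
  front : ∀ Z ∈ s.2, G.Cand Q R.level Z ∧ G.Conn R Z ∧ Z ∉ KF

variable {call : Mesh d → Prism d → Mesh d → Prop} {KF Q₀ Qs : Mesh d} {s s' : Mesh d × Mesh d}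
  {A : Prism d} {n : ℕ}

open Classical in
/-- One step of the innermost loop, for the prism `X` of the front and its neighbour `A`. The set of
split prisms was `Qs` when the list of neighbours of `X` was computed, and is `Q` now. If `A` has the
level of `X`, it joins the new front; otherwise `A` gets split, and if it is still present, its
children that have to be split with `X` join the new front. -/
theorem Inv.neighborStep (hG : G.Compatible) (hn : R.level = n + 1 → G.CallSound call n)
    (hI : G.Inv R KF Q₀ Q s) (hQs : Q₀ ⊆ Qs) (hQsQ : Qs ⊆ Q) (hQsA : G.Adm Qs)
    (hKF : ∀ Z ∈ KF, G.Ready Qs Z)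
    (hX : G.Ready Qs X) (hXl : X.level = R.level) (hRX : G.Conn R X)
    (hA : A ∈ G.leaves Qs) (hAKF : A ∉ KF) (hXA : G.Nbr X A ∨ G.Dep X A)
    (hAn : A.level ≠ R.level → A.level = n)
    (hs : NeighborStep s₁ s₂ call X A s s') :
    ∃ Q', Q ⊆ Q' ∧ G.Inv R KF Q₀ Q' s' ∧ s.2 ⊆ s'.2 ∧ (G.Nbr X A → A ∈ s'.2 ∧ Q' = Q) ∧
      (G.Dep X A → A ∈ Q' ∧ (A ∈ Q → Q' = Q)) ∧ (∀ Y ∈ Q', Y ∉ Q → G.Reach A Y) ∧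
      (∀ Z, G.Nbr X Z → Z ∈ atomicSplit s₁ s₂ A → A ∉ Q → Z ∈ s'.2) := by
  obtain ⟨h1, h2, h3, h4, h5⟩ := hI
  have hlow : ∀ Y ∈ Q, Y ∉ Qs → Y.level < R.level := fun Y hY hYs =>
    (h4 Y hY (fun h => hYs (hQs h))).2
  have hAs : A ∉ Qs := (mem_leaves.1 hA).2
  have hAR := ready_of_mem_leaves hQsA hA
  cases hs with
  | same P Fnew hl =>
    -- only prisms of lower level were split in the meantime
    have hAQ : A ∉ Q := fun h => by have := hlow A h hAs; omega
    have hAL : A ∈ G.leaves Q := ((hAR.mono hQsQ).mem_or_mem_leaves).resolve_left hAQ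
    have hN : G.Nbr X A := hXA.resolve_right fun h => by have := h.level; omega
    refine ⟨Q, subset_rfl, ⟨h1, h2, h3, h4, ?_⟩, Finset.subset_union_left,
      fun _ => ⟨by simp, rfl⟩, fun h => by have := h.level; omega, fun Y h h' => absurd h h', ?_⟩
    · intro Z hZ
      rcases Finset.mem_union.1 hZ with hZ | hZ
      · exact h5 Z hZ
      · rw [Finset.mem_singleton] at hZ
        subst hZ
        exact ⟨Cand.of_mem_leaves h2 hAL (by omega), Relation.ReflTransGen.tail hRX hN, hAKF⟩
    · intro Z hZ hZA
      have e1 := G.nbr_level hZ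
      have e2 := G.level_child hZA
      omega
  | recurse P P' Fnew hl hcall =>
    simp only at h1 h5
    subst h1
    have hD : G.Dep X A := hXA.resolve_left fun h => hl (G.nbr_level h).symm
    have hDl := hD.level
    have hAl : A.level = n := hAn (by omega)
    have hch : ∀ C ∈ atomicSplit s₁ s₂ A, C ∉ Q := by
      intro C hC hCQ
      have e := G.level_child hC
      by_cases hCs : C ∈ Qs
      · exact hQsA.child_notMem hAR.1 hAs hC hCs
      · have := hlow C hCQ hCs; omega
    obtain ⟨Q', rfl, hQQ', hQ', hAQ', hreach⟩ :=
      hn (by omega) Q A P' h2 ⟨hAR.mono hQsQ, hAl, hch⟩ hcall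
    have hnew : ∀ Y ∈ Q', Y ∉ Q → Y.level < R.level := fun Y hY hYQ => by
      have := (hreach Y hY hYQ).level_le; omega
    have hmem : ∀ Z ∈ atomicSplit s₁ s₂ A, Z ∈ G.leaves Q' := by
      intro Z hZ
      refine mem_leaves.2 ⟨Or.inr ⟨A, hAQ', hZ⟩, fun h => ?_⟩
      have := hnew Z h (hch Z hZ)
      have := G.level_child hZ
      omega
    have hXr := hX.mono (hQsQ.trans hQQ')
    refine ⟨Q', hQQ', ⟨rfl, hQ', h3.trans hQQ', ?_, ?_⟩, ?_, ?_, ?_, hreach, ?_⟩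
    · intro Y hY hY0
      by_cases hYQ : Y ∈ Q
      · exact h4 Y hYQ hY0
      · exact ⟨.step hRX hD (hreach Y hY hYQ), hnew Y hY hYQ⟩
    · have hold : ∀ Z ∈ Fnew, G.Cand Q' R.level Z ∧ G.Conn R Z ∧ Z ∉ KF := fun Z hZ =>
        ⟨(h5 Z hZ).1.mono hQQ' hnew, (h5 Z hZ).2⟩
      intro Z hZ
      simp only at hZ
      split_ifs at hZ
      · rcases Finset.mem_union.1 hZ with hZ | hZ
        · exact hold Z hZ
        · obtain ⟨hZA, hZn⟩ := Finset.mem_filter.1 hZ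
          have hZL := hmem Z hZA
          have hN : G.Nbr X Z := ((hG.mem_neighbors hQ' hXr hZL).1 hZn).resolve_right fun h => by
            have := h.level
            have := G.level_child hZA
            omega
          refine ⟨Cand.of_mem_leaves hQ' hZL (by rw [G.nbr_level hN, hXl]),
            Relation.ReflTransGen.tail hRX hN, fun hk => ?_⟩
          exact hAs ((hKF Z hk).2 A hAR.1 hZA)
      · exact hold Z hZ
    · simp only
      split_ifs
      · exact Finset.subset_union_left
      · exact subset_rfl
    · intro h; exact absurd (G.nbr_level h).symm hl
    · refine fun _ => ⟨hAQ', fun hAQ => ?_⟩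
      refine Finset.Subset.antisymm (fun Y hY => ?_) hQQ'
      by_contra hYQ
      exact hYQ (h2.mem_of_reach hAQ (hreach Y hY hYQ))
    · intro Z hZ hZA hAQ
      have hAL : A ∈ G.leaves Q := ((hAR.mono hQsQ).mem_or_mem_leaves).resolve_left hAQ
      have hsp := hG.mem_spatialNeighbors h2 (hX.mono hQsQ) hAL hZ hZA
      simp only
      rw [if_pos hsp]
      exact Finset.mem_union_right _ (Finset.mem_filter.2
        ⟨hZA, (hG.mem_neighbors hQ' hXr (hmem Z hZA)).2 (Or.inl hZ)⟩)

/-- The innermost loop, for a list of neighbours of the prism `X` of the front. A child `Z` of a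
coarser neighbour `Y` may be missed if `Y` is split by the recursive call for another neighbour; in
this case, `Z` is a neighbour of a prism of the new front. -/
theorem Inv.neighborList (hG : G.Compatible) (hn : R.level = n + 1 → G.CallSound call n)
    (hQs : Q₀ ⊆ Qs) (hQsA : G.Adm Qs)
    (hKF : ∀ Z ∈ KF, G.Ready Qs Z)
    (hX : G.Ready Qs X) (hXl : X.level = R.level) (hRX : G.Conn R X) {l : List (Prism d)}
    (hl : ∀ A ∈ l, A ∈ G.leaves Qs ∧ A ∉ KF ∧ (G.Nbr X A ∨ G.Dep X A) ∧
      (A.level ≠ R.level → A.level = n))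
    (hI : G.Inv R KF Q₀ Q s) (hQsQ : Qs ⊆ Q)
    (hs : ForList (NeighborStep s₁ s₂ call X) l s s') :
    ∃ Q', Q ⊆ Q' ∧ G.Inv R KF Q₀ Q' s' ∧ s.2 ⊆ s'.2 ∧ (∀ A ∈ l, G.Nbr X A → A ∈ s'.2) ∧
      (∀ A ∈ l, G.Dep X A → A ∈ Q') ∧
      (∀ Z Y, G.Nbr X Z → Z ∈ atomicSplit s₁ s₂ Y → Y ∈ l → Y ∉ Q →
        Z ∈ s'.2 ∨ ∃ Z' ∈ s'.2, G.Nbr Z' Z) := by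
  induction hs generalizing Q with
  | nil s => exact ⟨Q, subset_rfl, hI, subset_rfl, by simp, by simp, by simp⟩
  | @cons A l s t s' hst _ ih =>
    obtain ⟨a1, a2, a3, a4⟩ := hl A (by simp)
    obtain ⟨Q₁, hQQ₁, hI₁, hs₁, b1, b2, b3, b4⟩ :=
      hI.neighborStep hG hn hQs hQsQ hQsA hKF hX hXl hRX a1 a2 a3 a4 hst
    obtain ⟨Q', hQ', hI', hs', c1, c2, c3⟩ :=
      ih (fun B hB => hl B (by simp [hB])) hI₁ (hQsQ.trans hQQ₁)
    refine ⟨Q', hQQ₁.trans hQ', hI', hs₁.trans hs', ?_, ?_, ?_⟩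
    · intro B hB hN
      rcases List.mem_cons.1 hB with rfl | hB
      · exact hs' (b1 hN).1
      · exact c1 B hB hN
    · intro B hB hN
      rcases List.mem_cons.1 hB with rfl | hB
      · exact hQ' (b2 hN).1
      · exact c2 B hB hN
    · intro Z Y hZ hZY hY hYQ
      rcases List.mem_cons.1 hY with rfl | hYl
      · exact Or.inl (hs' (b4 Z hZ hZY hYQ))
      by_cases hYQ₁ : Y ∈ Q₁
      swap
      · exact c3 Z Y hZ hZY hYl hYQ₁
      have hNY : G.Node Y := (ready_of_mem_leaves hQsA (hl Y (by simp [hYl])).1).1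
      -- `Y` has been split by the call for `A`; hence both have the same level and are connected
      have hDA : G.Dep X A := a3.resolve_left fun h => hYQ ((b1 h).2 ▸ hYQ₁)
      have hAQ : A ∉ Q := fun h => hYQ ((b2 hDA).2 h ▸ hYQ₁)
      have hlev : Y.level = A.level := by
        have e1 := hDA.level
        have e2 := G.level_child hZY
        have e3 := G.nbr_level hZ
        omega
      have hconn : G.Conn A Y := (b3 Y hYQ₁ hYQ).conn_of_level hlev
      rcases hDA with hlow | ⟨Z', hZ', hNA, hZ'A⟩
      · exact absurd hconn (hG.not_conn_of_low hlow hZ hNY hZY)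
      by_cases hAY : A = Y
      · subst hAY
        exact Or.inl (hs' (b4 Z hZ hZY hAQ))
      · exact Or.inr ⟨Z', hs' (b4 Z' hZ' hZ'A hAQ), hG.nbr_of_conn hI.adm (hX.mono hQsQ)
          hZ' hZ hNA hNY hZ'A hZY hAQ hYQ hAY hconn⟩

variable (G) in
/-- What the loop over the neighbours of `X` achieves: the coarser prisms required by `X` are split,
and the neighbours of `X` are collected in the front or are found in the next round. -/
def Processed (KF Qs Q' F' : Mesh d) (X : Prism d) : Prop :=
  (∀ Y, G.Dep X Y → Y ∈ Q') ∧
    (∀ Z, G.Nbr X Z → G.Ready Qs Z → Z ∈ Q' ∨ Z ∈ KF ∨ Z ∈ F') ∧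
    (∀ Z, G.Nbr X Z → Z ∈ Q' ∨ Z ∈ KF ∨ Z ∈ F' ∨ ∃ Z' ∈ F', G.Nbr Z' Z)

theorem Processed.mono {Q₁ Q'' F' F'' : Mesh d} (h : G.Processed KF Q₁ Q' F' X) (hQs : Qs ⊆ Q₁)
    (hQ : Q' ⊆ Q'') (hF : F' ⊆ F'') : G.Processed KF Qs Q'' F'' X := by
  obtain ⟨h1, h2, h3⟩ := h
  refine ⟨fun Y hY => hQ (h1 Y hY), fun Z hZ hr => ?_, fun Z hZ => ?_⟩
  · rcases h2 Z hZ (hr.mono hQs) with h | h | h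
    · exact Or.inl (hQ h)
    · exact Or.inr (Or.inl h)
    · exact Or.inr (Or.inr (hF h))
  · rcases h3 Z hZ with h | h | h | ⟨Z', h, h'⟩
    · exact Or.inl (hQ h)
    · exact Or.inr (Or.inl h)
    · exact Or.inr (Or.inr (Or.inl (hF h)))
    · exact Or.inr (Or.inr (Or.inr ⟨Z', hF h, h'⟩))

open Classical in
theorem neighbors_subset (X : Prism d) (P : Mesh d) : neighbors X P ⊆ P := by
  intro Y hY
  rcases Finset.mem_union.1 hY with h | h <;> exact (Finset.mem_filter.1 h).1

/-- The static facts on the neighbours that are visited in the loop for `X`. -/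
theorem Inv.neighbors_spec (hG : G.Compatible) (hI : G.Inv R KF Q₀ Q s)
    (hX : G.Ready Q X) (hXl : X.level = R.level) (hA : A ∈ neighbors X s.1) (hAKF : A ∉ KF) :
    A ∈ G.leaves Q ∧ A ∉ KF ∧ (G.Nbr X A ∨ G.Dep X A) ∧
      (A.level ≠ R.level → A.level = R.level - 1) := by
  rw [hI.mesh_eq] at hA
  have hAL := neighbors_subset _ _ hA
  have h := (hG.mem_neighbors hI.adm hX hAL).1 hA
  refine ⟨hAL, hAKF, h, fun hne => ?_⟩
  rcases h with h | h
  · exact absurd ((G.nbr_level h).trans hXl) hne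
  · have := h.level; omega

open Classical in
/-- The loop over the neighbours of a prism `X` of the front. -/
theorem Inv.frontStep (hG : G.Compatible)
    (hn : ∀ n, R.level = n + 1 → G.CallSound call n) {K F : Mesh d}
    (hKF : ∀ Z ∈ K ∪ F, G.Ready Q Z ∧ Z.level = R.level)
    (hX : G.Ready Q X) (hXl : X.level = R.level) (hRX : G.Conn R X)
    (hI : G.Inv R (K ∪ F) Q₀ Q s) (hs : frontStep s₁ s₂ call K F X s s') :
    ∃ Q', Q ⊆ Q' ∧ G.Inv R (K ∪ F) Q₀ Q' s' ∧ s.2 ⊆ s'.2 ∧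
      G.Processed (K ∪ F) Q Q' s'.2 X := by
  obtain ⟨l, -, hl, hs⟩ := forEach_iff.1 hs
  have hmem : ∀ A, A ∈ l ↔ A ∈ neighbors X s.1 ∧ A ∉ K ∪ F := fun A =>
    (hl A).trans Finset.mem_sdiff
  obtain ⟨Q', hQ', hI', hs', c1, c2, c3⟩ := hI.neighborList (n := R.level - 1) hG
    (fun h => hn _ h) hI.subset hI.adm (fun Z hZ => (hKF Z hZ).1) hX hXl hRX
    (fun A hA => hI.neighbors_spec hG hX hXl ((hmem A).1 hA).1 ((hmem A).1 hA).2) subset_rfl hs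
  have hlist : ∀ A ∈ G.leaves Q, (G.Nbr X A ∨ G.Dep X A) → A ∉ K ∪ F → A ∈ l := by
    intro A hA h hk
    refine (hmem A).2 ⟨?_, hk⟩
    rw [hI.mesh_eq]
    exact (hG.mem_neighbors hI.adm hX hA).2 h
  have hDK : ∀ Y, G.Dep X Y → Y ∉ K ∪ F := by
    intro Y hY hk
    have h1 := (hKF Y hk).2
    have h2 := hY.level
    omega
  have hb : ∀ Z, G.Nbr X Z → G.Ready Q Z → Z ∈ Q' ∨ Z ∈ K ∪ F ∨ Z ∈ s'.2 := by
    intro Z hZ hr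
    rcases hr.mem_or_mem_leaves with h | h
    · exact Or.inl (hQ' h)
    by_cases hk : Z ∈ K ∪ F
    · exact Or.inr (Or.inl hk)
    · exact Or.inr (Or.inr (c1 Z (hlist Z h (Or.inl hZ) hk) hZ))
  refine ⟨Q', hQ', hI', hs', fun Y hY => ?_, hb, fun Z hZ => ?_⟩
  · rcases (hG.ready_of_dep hI.adm hX hY).mem_or_mem_leaves with h | h
    · exact hQ' h
    · exact c2 Y (hlist Y h (Or.inr hY) (hDK Y hY)) hY
  · by_cases hr : G.Ready Q Z
    · rcases hb Z hZ hr with h | h | h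
      · exact Or.inl h
      · exact Or.inr (Or.inl h)
      · exact Or.inr (Or.inr (Or.inl h))
    · have hN := G.nbr_node hZ
      have : ∃ Y, G.Node Y ∧ Z ∈ atomicSplit s₁ s₂ Y ∧ Y ∉ Q := by
        by_contra hc
        push Not at hc
        exact hr ⟨hN, hc⟩
      obtain ⟨Y, hNY, hZY, hYQ⟩ := this
      have hD : G.Dep X Y := Or.inr ⟨Z, hZ, hNY, hZY⟩
      have hYL := (hG.ready_of_dep hI.adm hX hD).mem_or_mem_leaves.resolve_left hYQ
      have hYl := hlist Y hYL (Or.inr hD) (hDK Y hD)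
      rcases c3 Z Y hZ hZY hYl hYQ with h | h
      · exact Or.inr (Or.inr (Or.inl h))
      · exact Or.inr (Or.inr (Or.inr h))

open Classical in
/-- The loop over a list of prisms of the front. -/
theorem Inv.frontList (hG : G.Compatible)
    (hn : ∀ n, R.level = n + 1 → G.CallSound call n) {K F : Mesh d}
    (hKF : ∀ Z ∈ K ∪ F, G.Ready Q Z ∧ Z.level = R.level) {l : List (Prism d)}
    (hl : ∀ X ∈ l, X ∈ F ∧ G.Conn R X)
    (hI : G.Inv R (K ∪ F) Q₀ Q s)
    (hs : ForList (SpaceTimeMesh.frontStep s₁ s₂ call K F) l s s') :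
    ∃ Q', Q ⊆ Q' ∧ G.Inv R (K ∪ F) Q₀ Q' s' ∧ s.2 ⊆ s'.2 ∧
      ∀ X ∈ l, G.Processed (K ∪ F) Q Q' s'.2 X := by
  induction hs generalizing Q with
  | nil s => exact ⟨Q, subset_rfl, hI, subset_rfl, by simp⟩
  | @cons X l s t s' hst _ ih =>
    obtain ⟨hXF, hRX⟩ := hl X (by simp)
    obtain ⟨hXr, hXl⟩ := hKF X (Finset.mem_union_right _ hXF)
    obtain ⟨Q₁, h1, h2, h3, h4⟩ := hI.frontStep hG hn hKF hXr hXl hRX hst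
    obtain ⟨Q', k1, k2, k3, k4⟩ := ih (fun Z hZ => ⟨(hKF Z hZ).1.mono h1, (hKF Z hZ).2⟩)
      (fun Z hZ => hl Z (by simp [hZ])) h2
    refine ⟨Q', h1.trans k1, k2, h3.trans k3, fun Z hZ => ?_⟩
    rcases List.mem_cons.1 hZ with rfl | hZ
    · exact h4.mono subset_rfl k1 k3
    · exact (k4 Z hZ).mono h1 subset_rfl subset_rfl

variable (G) in
/-- Invariant of the `while`-loop of `PATCH_REFINE` for `R`, with patch `K` and front `F`. The last
field allows a neighbour `Z` of the patch to be missed in one round, provided that it is a neighbour of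
a prism of the front. -/
structure WhileInv (R : Prism d) (Q₀ Q K F : Mesh d) : Prop where
  adm : G.Adm Q
  subset : Q₀ ⊆ Q
  reach : ∀ Y ∈ Q, Y ∉ Q₀ → G.Reach R Y ∧ Y.level < R.level
  patch : ∀ X ∈ K, G.Cand Q R.level X ∧ G.Conn R X
  front : ∀ X ∈ F, G.Cand Q R.level X ∧ G.Conn R X ∧ X ∉ K
  start : R ∈ K ∨ R ∈ F
  dep : ∀ X ∈ K, ∀ Y, G.Dep X Y → Y ∈ Q
  nbr : ∀ X ∈ K, ∀ Z, G.Nbr X Z → Z ∈ Q ∨ Z ∈ K ∨ Z ∈ F ∨ ∃ Z' ∈ F, G.Nbr Z' Z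

theorem WhileInv.inv {K F : Mesh d} {KF : Mesh d} (h : G.WhileInv R Q₀ Q K F) :
    G.Inv R KF Q₀ Q (G.leaves Q, ∅) :=
  ⟨rfl, h.adm, h.subset, h.reach, by simp⟩

open Classical in
theorem WhileInv.ready {K F : Mesh d} (h : G.WhileInv R Q₀ Q K F) :
    ∀ Z ∈ K ∪ F, G.Ready Q Z ∧ Z.level = R.level := by
  intro Z hZ
  rcases Finset.mem_union.1 hZ with hZ | hZ
  · exact ⟨(h.patch Z hZ).1.1, (h.patch Z hZ).1.2.1⟩
  · exact ⟨(h.front Z hZ).1.1, (h.front Z hZ).1.2.1⟩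

open Classical in
theorem WhileInv.forEach (hG : G.Compatible)
    (hn : ∀ n, R.level = n + 1 → G.CallSound call n) {K F P₁ Fnew : Mesh d}
    (h : G.WhileInv R Q₀ Q K F)
    (hs : ForEach (SpaceTimeMesh.frontStep s₁ s₂ call K F) F (G.leaves Q, ∅) (P₁, Fnew)) :
    ∃ Q', P₁ = G.leaves Q' ∧ G.WhileInv R Q₀ Q' (K ∪ F) Fnew := by
  obtain ⟨l, -, hmem, hs⟩ := forEach_iff.1 hs
  obtain ⟨Q', hQ', hI', -, hp⟩ := h.inv.frontList hG hn h.ready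
    (fun X hX => ⟨(hmem X).1 hX, (h.front X ((hmem X).1 hX)).2.1⟩) hs
  have hlow : ∀ Y ∈ Q', Y ∉ Q → Y.level < R.level := fun Y hY hYQ =>
    (hI'.reach Y hY fun h0 => hYQ (h.subset h0)).2
  refine ⟨Q', hI'.mesh_eq, hI'.adm, hI'.subset, hI'.reach, ?_, hI'.front, ?_, ?_, ?_⟩
  · intro X hX
    rcases Finset.mem_union.1 hX with hX | hX
    · exact ⟨(h.patch X hX).1.mono hQ' hlow, (h.patch X hX).2⟩
    · exact ⟨(h.front X hX).1.mono hQ' hlow, (h.front X hX).2.1⟩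
  · exact Or.inl (Finset.mem_union.2 h.start)
  · intro X hX Y hY
    rcases Finset.mem_union.1 hX with hX | hX
    · exact hQ' (h.dep X hX Y hY)
    · exact (hp X ((hmem X).2 hX)).1 Y hY
  · intro X hX Z hZ
    rcases Finset.mem_union.1 hX with hX | hX
    · rcases h.nbr X hX Z hZ with h' | h' | h' | ⟨Z', hZ', h'⟩
      · exact Or.inl (hQ' h')
      · exact Or.inr (Or.inl (Finset.mem_union_left _ h'))
      · exact Or.inr (Or.inl (Finset.mem_union_right _ h'))
      · -- the missed neighbour `Z` exists by now, so that it is found from `Z'`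
        have hr : G.Ready Q Z := ⟨G.nbr_node hZ, fun Y hN hZY =>
          h.dep X hX Y (Or.inr ⟨Z, hZ, hN, hZY⟩)⟩
        rcases (hp Z' ((hmem Z').2 hZ')).2.1 Z h' hr with k | k | k
        · exact Or.inl k
        · exact Or.inr (Or.inl k)
        · exact Or.inr (Or.inr (Or.inl k))
    · exact (hp X ((hmem X).2 hX)).2.2 Z hZ

theorem WhileInv.whileLoop (hG : G.Compatible)
    (hn : ∀ n, R.level = n + 1 → G.CallSound call n) {P K F P' K' : Mesh d}
    (hs : WhileLoop s₁ s₂ call P K F P' K') {Q : Mesh d} (hP : P = G.leaves Q)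
    (h : G.WhileInv R Q₀ Q K F) :
    ∃ Q', P' = G.leaves Q' ∧ G.WhileInv R Q₀ Q' K' ∅ := by
  induction hs generalizing Q with
  | done P K => exact ⟨Q, hP, h⟩
  | loop _ hfor _ ih =>
    subst hP
    obtain ⟨Q₁, e, h₁⟩ := h.forEach hG hn hfor
    exact ih e h₁

theorem WhileInv.init (hQ : G.Adm Q) (hR : G.Cand Q R.level R) : G.WhileInv R Q Q ∅ {R} := by
  refine ⟨hQ, subset_rfl, fun Y h h' => absurd h h', by simp, ?_, by simp, by simp, by simp⟩
  intro X hX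
  rw [Finset.mem_singleton] at hX
  subst hX
  exact ⟨hR, Relation.ReflTransGen.refl, by simp⟩

open Classical in
/-- When the front is empty, splitting the patch `K` restores admissibility. -/
theorem WhileInv.outcome {K : Mesh d} (h : G.WhileInv R Q₀ Q K ∅) :
    (G.leaves Q \ K) ∪ K.biUnion (atomicSplit s₁ s₂) = G.leaves (Q ∪ K) ∧
      G.Outcome Q₀ (Q ∪ K) R := by
  have hRK : R ∈ K := h.start.resolve_right (by simp)
  refine ⟨?_, h.subset.trans Finset.subset_union_left, ?_, Finset.mem_union_right _ hRK, ?_⟩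
  · have hch : ∀ X, (∃ Y ∈ K, X ∈ atomicSplit s₁ s₂ Y) → X ∉ Q ∧ X ∉ K := by
      rintro X ⟨Y, hY, hXY⟩
      refine ⟨(h.patch Y hY).1.2.2 X hXY, fun hX => ?_⟩
      have e1 := (h.patch Y hY).1.2.1
      have e2 := (h.patch X hX).1.2.1
      have e3 := G.level_child hXY
      omega
    ext X
    simp only [Finset.mem_union, Finset.mem_sdiff, Finset.mem_biUnion, mem_leaves, not_or]
    constructor
    · rintro (⟨⟨hr | ⟨Y, hY, hXY⟩, hQ⟩, hK⟩ | hX)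
      · exact ⟨Or.inl hr, hQ, hK⟩
      · exact ⟨Or.inr ⟨Y, Or.inl hY, hXY⟩, hQ, hK⟩
      · obtain ⟨Y, hY, hXY⟩ := hX
        exact ⟨Or.inr ⟨Y, Or.inr hY, hXY⟩, hch X ⟨Y, hY, hXY⟩⟩
    · rintro ⟨hr | ⟨Y, hY | hY, hXY⟩, hQ, hK⟩
      · exact Or.inl ⟨⟨Or.inl hr, hQ⟩, hK⟩
      · exact Or.inl ⟨⟨Or.inr ⟨Y, hY, hXY⟩, hQ⟩, hK⟩
      · exact Or.inr ⟨Y, hY, hXY⟩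
  · intro X hX
    rcases Finset.mem_union.1 hX with hX | hX
    · obtain ⟨a, b, c, e⟩ := h.adm X hX
      exact ⟨a, fun Y hN hY => Finset.mem_union_left _ (b Y hN hY),
        fun Z hZ => Finset.mem_union_left _ (c Z hZ), fun Y hY => Finset.mem_union_left _ (e Y hY)⟩
    · obtain ⟨⟨⟨a, b⟩, -⟩, -⟩ := h.patch X hX
      refine ⟨a, fun Y hN hY => Finset.mem_union_left _ (b Y hN hY), fun Z hZ => ?_,
        fun Y hY => Finset.mem_union_left _ (h.dep X hX Y (Or.inl hY))⟩
      rcases h.nbr X hX Z hZ with k | k | k | ⟨_, k, -⟩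
      · exact Finset.mem_union_left _ k
      · exact Finset.mem_union_right _ k
      · simp at k
      · simp at k
  · intro Y hY hY0
    rcases Finset.mem_union.1 hY with hY | hY
    · exact (h.reach Y hY hY0).1
    · exact .base (h.patch Y hY).2

theorem patchRefineDepth_sound (hG : G.Compatible) (k n : ℕ) :
    G.CallSound (PatchRefineDepth s₁ s₂ k) n := by
  induction k generalizing n with
  | zero => intro Q R P' _ _ h; exact h.elim
  | succ k ih =>
    rintro Q R P' hQ hR ⟨P₁, K, hw, rfl⟩
    have hR' : G.Cand Q R.level R := by rw [hR.2.1]; exact hR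
    obtain ⟨Q₁, rfl, h⟩ := (WhileInv.init hQ hR').whileLoop hG (fun m _ => ih m) hw rfl
    exact ⟨_, h.outcome.1, h.outcome.2⟩

/-! ### Existence of terminating executions -/

end RefinementTree

theorem ForList.exists_of_invariant {α σ : Type} {body : α → σ → σ → Prop} {p : σ → Prop}
    {l : List α} (h : ∀ a ∈ l, ∀ s, p s → (∃ s', body a s s') ∧ ∀ s', body a s s' → p s') {s : σ}
    (hs : p s) : ∃ s', ForList body l s s' := by
  induction l generalizing s with
  | nil => exact ⟨s, .nil s⟩
  | cons a l ih =>
    obtain ⟨⟨t, ht⟩, hp⟩ := h a (by simp) s hs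
    obtain ⟨s', hs'⟩ := ih (fun b hb => h b (by simp [hb])) (hp t ht)
    exact ⟨s', .cons ht hs'⟩

namespace RefinementTree

variable {d : ℕ} {s₁ s₂ : ℝ} {G : RefinementTree d s₁ s₂} {Q Q₀ : Mesh d} {R X : Prism d}
  {call : Mesh d → Prism d → Mesh d → Prop} {s : Mesh d × Mesh d}

open Classical in
theorem Inv.exists_frontStep (hG : G.Compatible)
    (hn : ∀ n, R.level = n + 1 → G.CallSound call n ∧ G.CallTotal call n) {K F : Mesh d}
    (hKF : ∀ Z ∈ K ∪ F, G.Ready Q Z ∧ Z.level = R.level)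
    (hX : G.Ready Q X) (hXl : X.level = R.level) (hRX : G.Conn R X)
    (hI : G.Inv R (K ∪ F) Q₀ Q s) : ∃ s', SpaceTimeMesh.frontStep s₁ s₂ call K F X s s' := by
  let A := neighbors X s.1 \ (K ∪ F)
  have hA : ∀ B ∈ A.toList, B ∈ neighbors X s.1 ∧ B ∉ K ∪ F := fun B hB =>
    Finset.mem_sdiff.1 (Finset.mem_toList.1 hB)
  obtain ⟨s', hs'⟩ := ForList.exists_of_invariant (body := NeighborStep s₁ s₂ call X)
    (p := fun t => ∃ Q', Q ⊆ Q' ∧ G.Inv R (K ∪ F) Q₀ Q' t) (l := A.toList) (s := s)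
    (by
      rintro B hB t ⟨Q', hQ', hI'⟩
      obtain ⟨c1, c2, c3, c4⟩ := hI.neighbors_spec hG hX hXl (hA B hB).1 (hA B hB).2
      constructor
      · by_cases hl : X.level = B.level
        · exact ⟨_, NeighborStep.same t.1 t.2 hl⟩
        · have hD : G.Dep X B := c3.resolve_left fun h => hl (G.nbr_level h).symm
          have hDl := hD.level
          have hBR := ready_of_mem_leaves hI.adm c1
          have hcand : G.Cand Q' B.level B := by
            refine ⟨hBR.mono hQ', rfl, fun C hC hCQ => ?_⟩
            by_cases hCs : C ∈ Q
            · exact hI.adm.child_notMem hBR.1 (mem_leaves.1 c1).2 hC hCs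
            · have e1 := (hI'.reach C hCQ fun h0 => hCs (hI.subset h0)).2
              have e2 := G.level_child hC
              omega
          obtain ⟨P', hP'⟩ := (hn B.level (by omega)).2 Q' B hI'.adm hcand
          rw [← hI'.mesh_eq] at hP'
          exact ⟨_, NeighborStep.recurse t.1 P' t.2 hl hP'⟩
      · intro t' ht'
        obtain ⟨Q'', h1, h2, -⟩ := hI'.neighborStep hG (fun h => (hn _ h).1) hI.subset hQ' hI.adm
          (fun Z hZ => (hKF Z hZ).1) hX hXl hRX c1 c2 c3 c4 ht'
        exact ⟨Q'', hQ'.trans h1, h2⟩)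
    ⟨Q, subset_rfl, hI⟩
  exact ⟨s', forEach_iff.2 ⟨A.toList, A.nodup_toList, fun _ => Finset.mem_toList, hs'⟩⟩

open Classical in
theorem WhileInv.exists_forEach (hG : G.Compatible)
    (hn : ∀ n, R.level = n + 1 → G.CallSound call n ∧ G.CallTotal call n) {K F : Mesh d}
    (h : G.WhileInv R Q₀ Q K F) :
    ∃ s', ForEach (SpaceTimeMesh.frontStep s₁ s₂ call K F) F (G.leaves Q, ∅) s' := by
  obtain ⟨s', hs'⟩ := ForList.exists_of_invariant
    (body := SpaceTimeMesh.frontStep s₁ s₂ call K F)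
    (p := fun t => ∃ Q', Q ⊆ Q' ∧ G.Inv R (K ∪ F) Q₀ Q' t) (l := F.toList) (s := (G.leaves Q, ∅))
    (by
      rintro X hX t ⟨Q', hQ', hI'⟩
      rw [Finset.mem_toList] at hX
      have hKF : ∀ Z ∈ K ∪ F, G.Ready Q' Z ∧ Z.level = R.level := fun Z hZ =>
        ⟨(h.ready Z hZ).1.mono hQ', (h.ready Z hZ).2⟩
      obtain ⟨hXr, hXl⟩ := hKF X (Finset.mem_union_right _ hX)
      refine ⟨hI'.exists_frontStep hG hn hKF hXr hXl (h.front X hX).2.1, fun t' ht' => ?_⟩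
      obtain ⟨Q'', h1, h2, -⟩ := hI'.frontStep hG (fun m hm => (hn m hm).1) hKF hXr hXl
        (h.front X hX).2.1 ht'
      exact ⟨Q'', hQ'.trans h1, h2⟩)
    ⟨Q, subset_rfl, h.inv⟩
  exact ⟨s', forEach_iff.2 ⟨F.toList, F.nodup_toList, fun _ => Finset.mem_toList, hs'⟩⟩

open Classical in
/-- The `while`-loop terminates since the patch grows within the finite set of prisms of the level
of `R`. -/
theorem WhileInv.exists_whileLoop (hG : G.Compatible)
    (hn : ∀ n, R.level = n + 1 → G.CallSound call n ∧ G.CallTotal call n) {K F : Mesh d}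
    (h : G.WhileInv R Q₀ Q K F) :
    ∃ P' K', WhileLoop s₁ s₂ call (G.leaves Q) K F P' K' := by
  obtain ⟨B, hB⟩ := G.exists_finset_of_level R.level
  induction hk : (B \ K).card using Nat.strong_induction_on generalizing Q K F with
  | _ k ih =>
    by_cases hF : F = ∅
    · subst hF; exact ⟨_, _, .done _ _⟩
    obtain ⟨⟨P₁, Fnew⟩, hs⟩ := h.exists_forEach hG hn
    obtain ⟨Q₁, rfl, h₁⟩ := h.forEach hG (fun m hm => (hn m hm).1) hs
    have hlt : (B \ (K ∪ F)).card < k := by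
      rw [← hk]
      obtain ⟨X, hX⟩ := Finset.nonempty_iff_ne_empty.2 hF
      obtain ⟨⟨⟨hN, -⟩, hl, -⟩, -, hXK⟩ := h.front X hX
      refine Finset.card_lt_card (Finset.ssubset_iff_of_subset ?_ |>.2 ⟨X, ?_, ?_⟩)
      · exact Finset.sdiff_subset_sdiff subset_rfl Finset.subset_union_left
      · exact Finset.mem_sdiff.2 ⟨hB X hN hl, hXK⟩
      · simp [hX]
    obtain ⟨P', K', hw⟩ := ih _ hlt h₁ rfl
    exact ⟨P', K', .loop hF hs hw⟩

/-- Each recursive call is for a prism of lower level, so that the recursion depth is at most the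
level plus one. -/
theorem patchRefineDepth_total (hG : G.Compatible) (n : ℕ) :
    G.CallTotal (PatchRefineDepth s₁ s₂ (n + 1)) n := by
  classical
  induction n with
  | zero =>
    intro Q R hQ hR
    have hR' : G.Cand Q R.level R := by rw [hR.2.1]; exact hR
    obtain ⟨P', K', hw⟩ := (WhileInv.init hQ hR').exists_whileLoop
      (call := PatchRefineDepth s₁ s₂ 0) hG (fun m hm => by have := hR.2.1; omega)
    exact ⟨_, P', K', hw, rfl⟩
  | succ n ih =>
    intro Q R hQ hR
    have hR' : G.Cand Q R.level R := by rw [hR.2.1]; exact hR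
    obtain ⟨P', K', hw⟩ := (WhileInv.init hQ hR').exists_whileLoop
      (call := PatchRefineDepth s₁ s₂ (n + 1)) hG (fun m hm => by
        have := hR.2.1
        have : m = n := by omega
        subst this
        exact ⟨patchRefineDepth_sound hG _ _, ih⟩)
    exact ⟨_, P', K', hw, rfl⟩

theorem patchRefine_sound (hG : G.Compatible) (hQ : G.Adm Q) (hR : R ∈ G.leaves Q) {P' : Mesh d}
    (h : PatchRefine s₁ s₂ (G.leaves Q) R P') : ∃ Q', P' = G.leaves Q' ∧ G.Outcome Q Q' R := by
  obtain ⟨k, hk⟩ := h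
  exact patchRefineDepth_sound hG k R.level Q R P' hQ (Cand.of_mem_leaves hQ hR rfl) hk

theorem patchRefine_total (hG : G.Compatible) (hQ : G.Adm Q) (hR : R ∈ G.leaves Q) :
    ∃ P', PatchRefine s₁ s₂ (G.leaves Q) R P' := by
  obtain ⟨P', h⟩ := patchRefineDepth_total hG R.level Q R hQ (Cand.of_mem_leaves hQ hR rfl)
  exact ⟨P', _, h⟩

end RefinementTree
/-! ### The refinement tree of an initial mesh -/

/-- The bisection depth of the time intervals of prisms of level `n`. -/
noncomputable def timeLevel (d : ℕ) (s₁ s₂ : ℝ) (n : ℕ) : ℕ := ⌈(n : ℝ) * s₂ / (s₁ * d)⌉₊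

theorem timeLevel_zero (d : ℕ) (s₁ s₂ : ℝ) : timeLevel d s₁ s₂ 0 = 0 := by simp [timeLevel]

theorem timeLevel_mono {d : ℕ} {s₁ s₂ : ℝ} (hs₁ : 0 < s₁) (hs₂ : 0 < s₂) :
    Monotone (timeLevel d s₁ s₂) := by
  intro m n h
  refine Nat.ceil_mono ?_
  have : (m : ℝ) ≤ n := by exact_mod_cast h
  gcongr

theorem mem_atomicSplit {d : ℕ} {s₁ s₂ : ℝ} {X Y : Prism d} :
    X ∈ atomicSplit s₁ s₂ Y ↔
      X.1 ∈ Y.1.bisectIter (timeLevel d s₁ s₂ (Y.2.level + 1) - timeLevel d s₁ s₂ Y.2.level) ∧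
        X.2 ∈ Y.2.bisect := by
  rw [atomicSplit, Finset.mem_product]
  simp [timeLevel]

namespace InitialMesh

variable {d : ℕ} (D : InitialMesh d) (s₁ s₂ : ℝ)

/-- The prisms that arise from the initial mesh by atomic splits. -/
def IsNode (X : Prism d) : Prop :=
  X.2 ∈ D.simplices X.2.level ∧ X.1 ∈ D.timeDepth (timeLevel d s₁ s₂ X.2.level)

/-- For `d ≥ 2`: `Z` has the same time interval and level as `X`, and shares with it a hyperface that
contains the refinement edge. -/
def IsNbr (X Z : Prism d) : Prop :=
  d ≠ 1 ∧ D.IsNode s₁ s₂ X ∧ D.IsNode s₁ s₂ Z ∧ Z.level = X.level ∧ X.1 = Z.1 ∧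
    convexDim (X.2.carrier ∩ Z.2.carrier) = d - 1 ∧ X.2.refinementEdge ⊆ Z.2.carrier

/-- `Y` is one level coarser than `X` and touches it in time or, for `d = 1`, in space. -/
def IsLow (X Y : Prism d) : Prop :=
  D.IsNode s₁ s₂ X ∧ D.IsNode s₁ s₂ Y ∧ Y.level + 1 = X.level ∧
    ((X.1.Touch Y.1 ∧ convexDim (X.2.carrier ∩ Y.2.carrier) = d) ∨
      (d = 1 ∧ X.1.Overlap Y.1 ∧ (X.2.carrier ∩ Y.2.carrier).ncard = 1))

variable {D s₁ s₂} {X Y Z : Prism d}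

theorem IsNode.lo_lt_hi (h : D.IsNode s₁ s₂ X) : X.1.lo < X.1.hi := timeDepth_lo_lt_hi h.2

theorem IsNode.subset_of_split (h : D.IsNode s₁ s₂ Y) (hX : X ∈ atomicSplit s₁ s₂ Y) :
    Y.1.lo ≤ X.1.lo ∧ X.1.hi ≤ Y.1.hi ∧ X.2.carrier ⊆ Y.2.carrier := by
  obtain ⟨h1, h2⟩ := mem_atomicSplit.1 hX
  obtain ⟨a, b, -⟩ := TimeInterval.bisectIter_spec h.lo_lt_hi h1
  exact ⟨a, b, TaggedSimplex.child_carrier_subset D.dim_pos h2⟩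

theorem IsNode.fst_eq (h : D.IsNode s₁ s₂ X) (h' : D.IsNode s₁ s₂ Y) (hl : X.level = Y.level)
    (ho : X.1.Overlap Y.1) : X.1 = Y.1 := by
  have h2 := h'.2
  rw [show Y.2.level = X.2.level from hl.symm] at h2
  exact timeDepth_eq_of_overlap h.2 h2 ho

theorem IsNode.mem_simplices (h : D.IsNode s₁ s₂ X) {n : ℕ} (hl : X.level = n) :
    X.2 ∈ D.simplices n := hl ▸ h.1

theorem IsNode.convexDim_inter (h : D.IsNode s₁ s₂ X) (h' : D.IsNode s₁ s₂ Y)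
    (hl : X.level = Y.level) (hne : X.2 ≠ Y.2)
    (hdim : d - 1 ≤ convexDim (X.2.carrier ∩ Y.2.carrier)) :
    convexDim (X.2.carrier ∩ Y.2.carrier) = d - 1 := by
  have := simplices_convexDim_lt (h.mem_simplices hl) (h'.mem_simplices rfl) hne
  omega

variable (D s₁ s₂) in
/-- The refinement tree of the initial mesh `D`. -/
noncomputable def tree (hs₁ : 0 < s₁) (hs₂ : 0 < s₂) : RefinementTree d s₁ s₂ where
  root := D.mesh
  Node := D.IsNode s₁ s₂
  Nbr := D.IsNbr s₁ s₂
  Low := D.IsLow s₁ s₂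
  node_root := by
    intro X hX
    obtain ⟨h1, h2⟩ := Finset.mem_product.1 hX
    have hl : X.2.level = 0 := D.level_eq _ h2
    exact ⟨hl ▸ h2, by rw [hl, timeLevel_zero, mem_timeDepth_zero]; exact h1⟩
  level_root := fun hX => D.level_eq _ (Finset.mem_product.1 hX).2
  node_child := by
    intro X Y hY hX
    obtain ⟨h1, h2⟩ := mem_atomicSplit.1 hX
    have hl := TaggedSimplex.child_level h2
    refine ⟨by rw [hl]; exact mem_simplices_succ.2 ⟨_, hY.1, h2⟩, ?_⟩
    rw [hl, ← Nat.add_sub_cancel' (timeLevel_mono (d := d) hs₁ hs₂ (Nat.le_succ Y.2.level))]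
    exact mem_timeDepth_add.2 ⟨_, hY.2, h1⟩
  level_child := fun hX => TaggedSimplex.child_level (mem_atomicSplit.1 hX).2
  root_or_child := by
    intro X hX
    obtain ⟨h1, h2⟩ := hX
    rcases hl : X.2.level with _ | n
    · rw [hl] at h1 h2
      rw [timeLevel_zero, mem_timeDepth_zero] at h2
      exact Or.inl (Finset.mem_product.2 ⟨h2, h1⟩)
    · right
      rw [hl] at h1 h2
      obtain ⟨A, hA, hXA⟩ := mem_simplices_succ.1 h1
      rw [← Nat.add_sub_cancel' (timeLevel_mono (d := d) hs₁ hs₂ (Nat.le_succ n))] at h2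
      obtain ⟨I, hI, hXI⟩ := mem_timeDepth_add.1 h2
      have hAl := simplices_level hA
      refine ⟨(I, A), ⟨by simpa [hAl] using hA, by simpa [hAl] using hI⟩,
        mem_atomicSplit.2 ⟨?_, hXA⟩⟩
      simpa [hAl] using hXI
  parent_unique := by
    intro X Y Y' hY hY' hX hX'
    obtain ⟨h1, h2⟩ := mem_atomicSplit.1 hX
    obtain ⟨h1', h2'⟩ := mem_atomicSplit.1 hX'
    have e1 := TaggedSimplex.child_level h2
    have e2 := TaggedSimplex.child_level h2'
    have hl : Y.2.level = Y'.2.level := by omega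
    have hS : Y.2 = Y'.2 := simplices_parent_unique hY.1 (hl ▸ hY'.1) h2 h2'
    rw [← hl] at h1'
    exact Prod.ext (timeDepth_parent_unique hY.2 (hl ▸ hY'.2) h1 h1') hS
  nbr_node := fun h => h.2.2.1
  nbr_level := fun h => h.2.2.2.1
  nbr_symm := by
    rintro X Z ⟨h1, h2, h3, h4, h5, h6, h7⟩
    have hd := D.dim_pos
    refine ⟨h1, h3, h2, h4.symm, h5.symm, by rw [Set.inter_comm]; exact h6, ?_⟩
    have := simplices_pair_eq (by omega) (h2.mem_simplices h4.symm) (h3.mem_simplices rfl) h6 h7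
    exact (TaggedSimplex.refinementEdge_subset_iff X.2.convex_carrier).2
      (TaggedSimplex.mem_carrier_of_pair_eq this.symm)
  low_node := fun h => h.2.1
  low_level := fun h => h.2.2.1

theorem mem_neighbors_iff {P : Mesh d} : Y ∈ neighbors X P ↔ Y ∈ temporalNeighbors X P ∨
    Y ∈ spatialNeighbors X P := by
  simp [neighbors]

variable {hs₁ : 0 < s₁} {hs₂ : 0 < s₂} {Q : Mesh d} {A B W : Prism d}

/-- Two prisms of the same level and time interval that share a hyperface: if a child `B` of the
first one touches the other one, then either they have to be split simultaneously, or `B` and a child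
of the other one. -/
theorem nbr_or_exists_nbr_child (hd : 2 ≤ d) (hA : D.IsNode s₁ s₂ A) (hW : D.IsNode s₁ s₂ W)
    (hl : W.level = A.level) (hI : A.1 = W.1) (hne : A ≠ W) (hB : B ∈ atomicSplit s₁ s₂ A)
    (hdim : d - 1 ≤ convexDim (B.2.carrier ∩ W.2.carrier)) :
    (D.tree s₁ s₂ hs₁ hs₂).Nbr A W ∨
      ∃ Z, (D.tree s₁ s₂ hs₁ hs₂).Nbr B Z ∧ Z ∈ atomicSplit s₁ s₂ W := by
  have hne2 : A.2 ≠ W.2 := fun h => hne (Prod.ext hI h)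
  have hsub := (hA.subset_of_split hB).2.2
  have hdimA := hA.convexDim_inter hW hl.symm hne2
    (hdim.trans (convexDim_mono (Set.inter_subset_inter_left _ hsub)))
  by_cases hre : A.2.refinementEdge ⊆ W.2.carrier
  · exact Or.inl ⟨by omega, hA, hW, hl, hI, hdimA, hre⟩
  · obtain ⟨hB1, hB2⟩ := mem_atomicSplit.1 hB
    obtain ⟨C, hC, c1, c2, -, -⟩ := exists_matching_child hd (hA.mem_simplices hl.symm)
      (hW.mem_simplices rfl) hne2 hB2 hdim hre
    have hZ : ((B.1, C) : Prism d) ∈ atomicSplit s₁ s₂ W := by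
      refine mem_atomicSplit.2 ⟨?_, hC⟩
      rw [show W.2.level = A.2.level from hl, ← hI]
      exact hB1
    have hBN := (D.tree s₁ s₂ hs₁ hs₂).node_child hA hB
    have hZN := (D.tree s₁ s₂ hs₁ hs₂).node_child hW hZ
    refine Or.inr ⟨(B.1, C), ⟨by omega, hBN, hZN, ?_, rfl, c1, c2⟩, hZ⟩
    change C.level = B.2.level
    rw [TaggedSimplex.child_level hC, TaggedSimplex.child_level hB2,
      show W.2.level = A.2.level from hl]

/-- Admissible sets of split prisms are graded: a coarser prism that shares a piece of a hyperface
with a split prism is split. -/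
theorem mem_of_adjacent_of_lt (hd : 2 ≤ d) (hQ : (D.tree s₁ s₂ hs₁ hs₂).Adm Q) (hB : B ∈ Q)
    (hW : D.IsNode s₁ s₂ W) (hl : W.level < B.level) (ho : B.1.Overlap W.1)
    (hdim : d - 1 ≤ convexDim (B.2.carrier ∩ W.2.carrier)) : W ∈ Q := by
  induction hn : B.level using Nat.strong_induction_on generalizing B with
  | _ n ih =>
    subst hn
    obtain ⟨hBN, hpar, -, -⟩ := hQ B hB
    rcases (D.tree s₁ s₂ hs₁ hs₂).root_or_child hBN with hr | ⟨A, hA, hBA⟩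
    · have := (D.tree s₁ s₂ hs₁ hs₂).level_root hr; omega
    have hAQ := hpar A hA hBA
    have hlev := (D.tree s₁ s₂ hs₁ hs₂).level_child hBA
    obtain ⟨t1, t2, t3⟩ := hA.subset_of_split hBA
    have hoA := ho.mono t1 t2 le_rfl le_rfl
    rcases Nat.lt_or_ge W.level A.level with h | h
    · exact ih A.level (by omega) hAQ h hoA
        (hdim.trans (convexDim_mono (Set.inter_subset_inter_left _ t3))) rfl
    · have he : W.level = A.level := by omega
      by_cases hAW : A = W
      · exact hAW ▸ hAQ
      rcases nbr_or_exists_nbr_child (hs₁ := hs₁) (hs₂ := hs₂) hd hA hW he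
        (IsNode.fst_eq hA hW he.symm hoA) hAW hBA hdim with h | ⟨Z, hZ, hZW⟩
      · exact (hQ A hAQ).2.2.1 W h
      · exact (hQ Z ((hQ B hB).2.2.1 Z hZ)).2.1 W hW hZW

theorem exists_parent (hX : (D.tree s₁ s₂ hs₁ hs₂).Ready Q X) (hl : 0 < X.level) :
    ∃ A ∈ Q, D.IsNode s₁ s₂ A ∧ X ∈ atomicSplit s₁ s₂ A ∧ X.level = A.level + 1 := by
  rcases (D.tree s₁ s₂ hs₁ hs₂).root_or_child hX.1 with hr | ⟨A, hA, hXA⟩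
  · have := (D.tree s₁ s₂ hs₁ hs₂).level_root hr; omega
  · exact ⟨A, hX.2 A hA hXA, hA, hXA, (D.tree s₁ s₂ hs₁ hs₂).level_child hXA⟩

open Classical in
/-- A coarser prism whose child has to be split simultaneously with `X` is a spatial neighbour of
`X`. -/
theorem mem_spatialNeighbors_of_nbr_child (hQ : (D.tree s₁ s₂ hs₁ hs₂).Adm Q)
    (hX : (D.tree s₁ s₂ hs₁ hs₂).Ready Q X) (hY : Y ∈ (D.tree s₁ s₂ hs₁ hs₂).leaves Q)
    (hZ : (D.tree s₁ s₂ hs₁ hs₂).Nbr X Z) (hZY : Z ∈ atomicSplit s₁ s₂ Y) :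
    Y ∈ spatialNeighbors X ((D.tree s₁ s₂ hs₁ hs₂).leaves Q) := by
  obtain ⟨h1, hXN, hZN, h4, h5, h6, h7⟩ := hZ
  have hYN : D.IsNode s₁ s₂ Y := (RefinementTree.ready_of_mem_leaves hQ hY).1
  obtain ⟨t1, t2, t3⟩ := hYN.subset_of_split hZY
  have hlZ := (D.tree s₁ s₂ hs₁ hs₂).level_child hZY
  obtain ⟨A, hAQ, hA, hXA, hlX⟩ := exists_parent hX (by omega)
  obtain ⟨u1, u2, u3⟩ := hA.subset_of_split hXA
  have hd := D.dim_pos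
  have ho : X.1.Overlap Y.1 := TimeInterval.overlap_of_subset hXN.lo_lt_hi (h5 ▸ t1) (h5 ▸ t2)
  have hAY : A.2 ≠ Y.2 := by
    intro h
    have : A = Y := Prod.ext (IsNode.fst_eq hA hYN (by omega) (ho.mono u1 u2 le_rfl le_rfl)) h
    exact (RefinementTree.mem_leaves.1 hY).2 (this ▸ hAQ)
  have e1 := convexDim_mono (Set.inter_subset_inter_right X.2.carrier t3)
  have e2 := convexDim_mono (Set.inter_subset_inter_left Y.2.carrier u3)
  have e3 := hA.convexDim_inter hYN (by omega) hAY (by omega)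
  refine Finset.mem_filter.2 ⟨hY, ?_, TimeInterval.volume_inter_pos_iff.2 ho, ?_⟩
  · rintro rfl; omega
  · rw [if_neg h1]
    exact ⟨by omega, h7.trans t3⟩

open Classical in
/-- In an admissible mesh, the necessary refinements of `X` are the prisms to be split simultaneously
with `X` and those to be split before `X`. -/
theorem mem_neighbors_leaves_iff (hQ : (D.tree s₁ s₂ hs₁ hs₂).Adm Q)
    (hX : (D.tree s₁ s₂ hs₁ hs₂).Ready Q X) (hY : Y ∈ (D.tree s₁ s₂ hs₁ hs₂).leaves Q) :
    Y ∈ neighbors X ((D.tree s₁ s₂ hs₁ hs₂).leaves Q) ↔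
      (D.tree s₁ s₂ hs₁ hs₂).Nbr X Y ∨ (D.tree s₁ s₂ hs₁ hs₂).Dep X Y := by
  have hXN : D.IsNode s₁ s₂ X := hX.1
  have hYN : D.IsNode s₁ s₂ Y := (RefinementTree.ready_of_mem_leaves hQ hY).1
  have hd1 := D.dim_pos
  rw [mem_neighbors_iff]
  constructor
  · rintro (h | h)
    · obtain ⟨-, -, h1, h2, h3⟩ := Finset.mem_filter.1 h
      rw [TimeInterval.ncard_closure_inter_eq_one_iff hXN.lo_lt_hi hYN.lo_lt_hi] at h1
      exact Or.inr (Or.inl ⟨hXN, hYN, h3, Or.inl ⟨h1, h2⟩⟩)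
    · obtain ⟨-, -, ho, h2⟩ := Finset.mem_filter.1 h
      rw [TimeInterval.volume_inter_pos_iff] at ho
      by_cases hd : d = 1
      · rw [if_pos hd] at h2
        exact Or.inr (Or.inl ⟨hXN, hYN, h2.2, Or.inr ⟨hd, ho, h2.1⟩⟩)
      rw [if_neg hd] at h2
      obtain ⟨hdim, hre⟩ := h2
      have hd2 : 2 ≤ d := by omega
      rcases lt_trichotomy X.level Y.level with hl | hl | hl
      · exact absurd hre (not_refinementEdge_subset_of_lt hd2 hl (hXN.mem_simplices rfl)
          (hYN.mem_simplices rfl) hdim)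
      · exact Or.inl ⟨hd, hXN, hYN, hl.symm, IsNode.fst_eq hXN hYN hl ho, hdim, hre⟩
      · right
        have hYQ := (RefinementTree.mem_leaves.1 hY).2
        obtain ⟨A, hAQ, hA, hXA, hlX⟩ := exists_parent hX (by omega)
        obtain ⟨u1, u2, u3⟩ := hA.subset_of_split hXA
        have hoA := ho.mono u1 u2 le_rfl le_rfl
        rcases Nat.lt_or_ge Y.level A.level with h | h
        · refine absurd (mem_of_adjacent_of_lt hd2 hQ hAQ hYN h hoA ?_) hYQ
          exact hdim ▸ convexDim_mono (Set.inter_subset_inter_left _ u3)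
        · have he : Y.level = A.level := by omega
          rcases nbr_or_exists_nbr_child (hs₁ := hs₁) (hs₂ := hs₂) hd2 hA hYN he
            (IsNode.fst_eq hA hYN he.symm hoA) (fun e => hYQ (e ▸ hAQ)) hXA hdim.ge
            with h | ⟨Z, hZ, hZY⟩
          · exact absurd ((hQ A hAQ).2.2.1 Y h) hYQ
          · exact Or.inr ⟨Z, hZ, hYN, hZY⟩
  · rintro (h | h | ⟨Z, hZ, -, hZY⟩)
    · obtain ⟨h1, -, -, h4, h5, h6, h7⟩ := h
      refine Or.inr (Finset.mem_filter.2 ⟨hY, ?_, ?_, ?_⟩)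
      · rintro rfl
        rw [convexDim_eq_of_subset hXN.1 (Set.subset_inter subset_rfl subset_rfl)] at h6
        omega
      · rw [TimeInterval.volume_inter_pos_iff, h5]
        exact TimeInterval.overlap_self hYN.lo_lt_hi
      · rw [if_neg h1]; exact ⟨h6, h7⟩
    · obtain ⟨-, -, h3, ⟨h4, h5⟩ | ⟨h4, h5, h6⟩⟩ := h
      · refine Or.inl (Finset.mem_filter.2 ⟨hY, ?_, ?_, h5, h3⟩)
        · rintro rfl; omega
        · rw [TimeInterval.ncard_closure_inter_eq_one_iff hXN.lo_lt_hi hYN.lo_lt_hi]; exact h4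
      · refine Or.inr (Finset.mem_filter.2 ⟨hY, ?_, ?_, ?_⟩)
        · rintro rfl; omega
        · rw [TimeInterval.volume_inter_pos_iff]; exact h5
        · rw [if_pos h4]; exact ⟨h6, h3⟩
    · exact Or.inr (mem_spatialNeighbors_of_nbr_child hQ hX hY hZ hZY)

theorem ncard_eq_one_of_convexDim {V : Set (EuclideanSpace ℝ (Fin d))} (hV : V.Nonempty)
    (h : convexDim V = 0) : V.ncard = 1 := by
  rw [convexDim, Submodule.finrank_eq_zero, vectorSpan_eq_bot_iff_subsingleton] at h
  obtain ⟨p, hp⟩ := hV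
  rw [Set.ncard_eq_one]
  exact ⟨p, Set.eq_singleton_iff_unique_mem.2 ⟨hp, fun q hq => h hq hp⟩⟩

/-- In an admissible mesh, all prisms to be split before an existing prism exist, or have been split:
levels of neighbours differ by at most one. -/
theorem ready_of_dep (hQ : (D.tree s₁ s₂ hs₁ hs₂).Adm Q)
    (hX : (D.tree s₁ s₂ hs₁ hs₂).Ready Q X) (hXY : (D.tree s₁ s₂ hs₁ hs₂).Dep X Y) :
    (D.tree s₁ s₂ hs₁ hs₂).Ready Q Y := by
  refine ⟨hXY.node, fun Y₁ hY₁ hYY₁ => ?_⟩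
  have hXN : D.IsNode s₁ s₂ X := hX.1
  have hYN : D.IsNode s₁ s₂ Y := hXY.node
  have hY₁N : D.IsNode s₁ s₂ Y₁ := hY₁
  have hl := hXY.level
  have hlY := (D.tree s₁ s₂ hs₁ hs₂).level_child hYY₁
  obtain ⟨X₁, hX₁Q, hX₁, hXX₁, hlX⟩ := exists_parent hX (by omega)
  obtain ⟨X₂, hX₂Q, hX₂, hX₁X₂, hlX₁⟩ :=
    exists_parent (X := X₁) ⟨hX₁, (hQ X₁ hX₁Q).2.1⟩ (by omega)
  obtain ⟨u1, u2, u3⟩ := hX₁.subset_of_split hXX₁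
  obtain ⟨v1, v2, v3⟩ := hX₂.subset_of_split hX₁X₂
  obtain ⟨w1, w2, w3⟩ := hY₁N.subset_of_split hYY₁
  have hlow : (D.tree s₁ s₂ hs₁ hs₂).Low X₁ Y₁ → Y₁ ∈ Q := (hQ X₁ hX₁Q).2.2.2 Y₁
  have hd1 := D.dim_pos
  have hfst : X₁.1.Overlap Y₁.1 → X₂.1 = Y₁.1 := fun ho =>
    IsNode.fst_eq hX₂ hY₁N (by omega) (ho.mono v1 v2 le_rfl le_rfl)
  rcases hXY with ⟨-, -, -, ⟨ht, hdim⟩ | ⟨hd, ho, hc⟩⟩ | ⟨Z, ⟨h1, -, hZN, h4, h5, h6, h7⟩, -, hZY⟩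
  · have hdim1 := convexDim_mono (Set.inter_subset_inter_left Y.2.carrier u3)
    have e1 : X₁.2 = Y.2 := simplices_eq_of_convexDim (hX₁.mem_simplices rfl)
      (hYN.mem_simplices (by omega)) (by have := convexDim_le (X₁.2.carrier ∩ Y.2.carrier); omega)
    have e2 : X₂.2 = Y₁.2 := simplices_parent_unique (hX₂.mem_simplices rfl)
      (hY₁N.mem_simplices (by omega)) (mem_atomicSplit.1 hX₁X₂).2
      (e1 ▸ (mem_atomicSplit.1 hYY₁).2)
    by_cases ho : X₁.1.Overlap Y₁.1
    · have : X₂ = Y₁ := Prod.ext (hfst ho) e2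
      exact this ▸ hX₂Q
    · refine hlow ⟨hX₁, hY₁N, by omega, Or.inl ⟨?_, ?_⟩⟩
      · have a1 : max X₁.1.lo Y₁.1.lo ≤ max X.1.lo Y.1.lo := max_le_max u1 w1
        have a2 : min X.1.hi Y.1.hi ≤ min X₁.1.hi Y₁.1.hi := min_le_min u2 w2
        unfold TimeInterval.Touch at ht ⊢
        unfold TimeInterval.Overlap at ho
        linarith
      · exact convexDim_eq_of_subset (hX₁.mem_simplices rfl)
          (Set.subset_inter subset_rfl (e1 ▸ w3))
  · have hoo : X₁.1.Overlap Y₁.1 := ho.mono u1 u2 w1 w2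
    by_cases e2 : X₂.2 = Y₁.2
    · have : X₂ = Y₁ := Prod.ext (hfst hoo) e2
      exact this ▸ hX₂Q
    · refine hlow ⟨hX₁, hY₁N, by omega, Or.inr ⟨hd, hoo, ?_⟩⟩
      have b1 := simplices_convexDim_lt (hX₂.mem_simplices rfl) (hY₁N.mem_simplices (by omega)) e2
      have b2 := convexDim_mono (Set.inter_subset_inter_left Y₁.2.carrier v3)
      refine ncard_eq_one_of_convexDim ?_ (by omega)
      obtain ⟨p, hp⟩ := Set.ncard_eq_one.1 hc
      have : p ∈ X.2.carrier ∩ Y.2.carrier := hp ▸ rfl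
      exact ⟨p, u3 this.1, w3 this.2⟩
  · obtain ⟨t1, t2, t3⟩ := hYN.subset_of_split hZY
    have ho : X.1.Overlap Y.1 := TimeInterval.overlap_of_subset hXN.lo_lt_hi (h5 ▸ t1) (h5 ▸ t2)
    refine mem_of_adjacent_of_lt (by omega) hQ hX₁Q hY₁N (by omega) (ho.mono u1 u2 w1 w2) ?_
    rw [← h6]
    exact convexDim_mono (Set.inter_subset_inter u3 (t3.trans w3))

theorem conn_fst_eq (h : (D.tree s₁ s₂ hs₁ hs₂).Conn X Y) : X.1 = Y.1 := by
  induction h with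
  | refl => rfl
  | tail _ h ih => exact ih.trans h.2.2.2.2.1

/-- All prisms of a patch have the same refinement edge. -/
theorem conn_pair_eq (h : (D.tree s₁ s₂ hs₁ hs₂).Conn X Y) :
    ({X.2.x 0, X.2.x d} : Set (EuclideanSpace ℝ (Fin d))) = {Y.2.x 0, Y.2.x d} := by
  induction h with
  | refl => rfl
  | tail _ h ih =>
    obtain ⟨h1, h2, h3, h4, -, h6, h7⟩ := h
    have := D.dim_pos
    exact ih.trans (simplices_pair_eq (by omega) (h2.mem_simplices h4.symm)
      (h3.mem_simplices rfl) h6 h7)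

theorem mid_eq_of_pair_eq {S S' : TaggedSimplex d}
    (h : ({S.x 0, S.x d} : Set (EuclideanSpace ℝ (Fin d))) = {S'.x 0, S'.x d}) :
    S.mid = S'.mid := by
  rcases Set.pair_eq_pair_iff.1 h with ⟨h1, h2⟩ | ⟨h1, h2⟩
  · rw [TaggedSimplex.mid, TaggedSimplex.mid, h1, h2]
  · rw [TaggedSimplex.mid, TaggedSimplex.mid, h1, h2, midpoint_comm]

/-- The midpoint of the refinement edge does not lie in a hyperface that does not contain this
edge. -/
theorem mid_notMem_face {S : TaggedSimplex d} (hd : 1 ≤ d) (h : AffineIndependent ℝ S.vert)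
    {V : Set (EuclideanSpace ℝ (Fin d))} (hV : V ⊆ S.vertices) (hn : ¬ {S.x 0, S.x d} ⊆ V) :
    S.mid ∉ convexHull ℝ V := by
  intro hm
  have key : ∀ j ≤ d, S.x j ∉ V → (j = 0 ∨ j = d) → False := by
    intro j hj hjV hj'
    obtain ⟨c, c1, c0⟩ := TaggedSimplex.exists_coord h hj
    have e1 : c S.mid = 0 := eq_zero_of_mem_convexHull (fun w hw => by
      obtain ⟨i, hi, rfl⟩ := TaggedSimplex.mem_vertices_iff.1 (hV hw)
      exact c0 i hi (fun e => hjV (e ▸ hw))) hm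
    rw [TaggedSimplex.mid, AffineMap.map_midpoint_real] at e1
    rcases hj' with rfl | rfl
    · rw [c1, c0 d le_rfl (by omega)] at e1; norm_num at e1
    · rw [c1, c0 0 (by omega) (by omega)] at e1; norm_num at e1
  by_cases h0 : S.x 0 ∈ V
  · by_cases h1 : S.x d ∈ V
    · exact hn (by rintro p (rfl | rfl) <;> assumption)
    · exact key d le_rfl h1 (Or.inr rfl)
  · exact key 0 (by omega) h0 (Or.inl rfl)

theorem mid_mem_child_vertices {S C : TaggedSimplex d} (hd : 1 ≤ d) (hC : C ∈ S.bisect) :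
    S.mid ∈ C.vertices := by
  rcases TaggedSimplex.mem_bisect.1 hC with rfl | rfl
  · rw [TaggedSimplex.child₁_vertices hd]; simp
  · rw [TaggedSimplex.child₂_vertices hd]; simp

/-- Let `Z`, `Z'` be neighbours of `X` whose parents `Y`, `Y'` lie in the same patch. Then `Z` and
`Z'` share the hyperface spanned by the intersection of their hyperfaces with `X` and the midpoint of
the common refinement edge of `Y` and `Y'`. -/
theorem nbr_of_conn {Y' Z' : Prism d} (hQ : (D.tree s₁ s₂ hs₁ hs₂).Adm Q)
    (hX : (D.tree s₁ s₂ hs₁ hs₂).Ready Q X) (hZ : (D.tree s₁ s₂ hs₁ hs₂).Nbr X Z)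
    (hZ' : (D.tree s₁ s₂ hs₁ hs₂).Nbr X Z') (hY : D.IsNode s₁ s₂ Y) (hY' : D.IsNode s₁ s₂ Y')
    (hZY : Z ∈ atomicSplit s₁ s₂ Y) (hZY' : Z' ∈ atomicSplit s₁ s₂ Y') (hYQ : Y ∉ Q)
    (hne : Y ≠ Y') (hconn : (D.tree s₁ s₂ hs₁ hs₂).Conn Y Y') :
    (D.tree s₁ s₂ hs₁ hs₂).Nbr Z Z' := by
  obtain ⟨h1, hXN, hZN, h4, h5, h6, h7⟩ := hZ
  obtain ⟨-, -, hZN', h4', h5', h6', h7'⟩ := hZ'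
  have hd1 := D.dim_pos
  have hd : 2 ≤ d := by omega
  have hlZ := (D.tree s₁ s₂ hs₁ hs₂).level_child hZY
  have hlZ' := (D.tree s₁ s₂ hs₁ hs₂).level_child hZY'
  obtain ⟨A, hAQ, hA, hXA, hlX⟩ := exists_parent hX (by omega)
  obtain ⟨u1, u2, u3⟩ := hA.subset_of_split hXA
  obtain ⟨t1, t2, t3⟩ := hY.subset_of_split hZY
  have hZ2 := (mem_atomicSplit.1 hZY).2
  have hZ2' := (mem_atomicSplit.1 hZY').2
  have nX := simplices_affineIndependent hXN.1
  have nZ := simplices_affineIndependent hZN.1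
  have nY := simplices_affineIndependent hY.1
  have hXo : X.1.Overlap Y.1 := TimeInterval.overlap_of_subset hXN.lo_lt_hi (h5 ▸ t1) (h5 ▸ t2)
  have hAY1 : A.1 = Y.1 := IsNode.fst_eq hA hY (by omega) (hXo.mono u1 u2 le_rfl le_rfl)
  have hAY : A ≠ Y := fun e => hYQ (e ▸ hAQ)
  have hAY2 : A.2 ≠ Y.2 := fun e => hAY (Prod.ext hAY1 e)
  have hdimAY : convexDim (A.2.carrier ∩ Y.2.carrier) = d - 1 :=
    hA.convexDim_inter hY (by omega) hAY2 (by
      rw [← h6]; exact convexDim_mono (Set.inter_subset_inter u3 t3))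
  -- otherwise `A` and `Y` would have to be split simultaneously
  have hre : ¬ Y.2.refinementEdge ⊆ A.2.carrier := fun hre => by
    have hN : (D.tree s₁ s₂ hs₁ hs₂).Nbr Y A :=
      ⟨h1, hY, hA, by omega, hAY1.symm, by rw [Set.inter_comm]; exact hdimAY, hre⟩
    exact hYQ ((hQ A hAQ).2.2.1 Y ((D.tree s₁ s₂ hs₁ hs₂).nbr_symm hN))
  obtain ⟨-, gi, -⟩ := simplices_good hd (hA.mem_simplices rfl) (hY.mem_simplices (by omega))
    hAY2 hdimAY
  have hmA : Y.2.mid ∉ A.2.carrier := by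
    intro hm
    have hm' : Y.2.mid ∈ convexHull ℝ (A.2.vertices ∩ Y.2.vertices) := by
      rw [← gi]; exact ⟨hm, Y.2.mid_mem_carrier⟩
    refine mid_notMem_face hd1 nY Set.inter_subset_right (fun k => hre ?_) hm'
    exact (TaggedSimplex.refinementEdge_subset_iff A.2.convex_carrier).2
      ⟨TaggedSimplex.vertices_subset_carrier _ (k (by simp)).1,
        TaggedSimplex.vertices_subset_carrier _ (k (by simp)).1⟩
  have hmid : Y.2.mid = Y'.2.mid := mid_eq_of_pair_eq (conn_pair_eq hconn)
  have hneXZ : X.2 ≠ Z.2 := by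
    intro e
    rw [← e, convexDim_eq_of_subset hXN.1 (Set.subset_inter subset_rfl subset_rfl)] at h6
    omega
  have hneXZ' : X.2 ≠ Z'.2 := by
    intro e
    rw [← e, convexDim_eq_of_subset hXN.1 (Set.subset_inter subset_rfl subset_rfl)] at h6'
    omega
  obtain ⟨g1, -⟩ := simplices_good hd (hXN.mem_simplices rfl) (hZN.mem_simplices h4) hneXZ h6
  obtain ⟨g1', -⟩ := simplices_good hd (hXN.mem_simplices rfl) (hZN'.mem_simplices h4') hneXZ' h6'
  have hneZ : Z.2 ≠ Z'.2 := by
    intro e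
    refine hne (Prod.ext (conn_fst_eq hconn) ?_)
    exact simplices_parent_unique (hY.mem_simplices rfl) (hY'.mem_simplices (by omega)) hZ2
      (e ▸ hZ2')
  set V := (X.2.vertices ∩ Z.2.vertices) ∩ (X.2.vertices ∩ Z'.2.vertices) with hV
  have hVfin : V.Finite := X.2.vertices_finite.subset fun p hp => hp.1.1
  have hVcard : d - 1 ≤ V.ncard := by
    have e1 := Set.ncard_union_add_ncard_inter (X.2.vertices ∩ Z.2.vertices)
      (X.2.vertices ∩ Z'.2.vertices) (X.2.vertices_finite.subset Set.inter_subset_left)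
      (X.2.vertices_finite.subset Set.inter_subset_left)
    have e2 := Set.ncard_le_ncard (Set.union_subset
      (Set.inter_subset_left (s := X.2.vertices) (t := Z.2.vertices))
      (Set.inter_subset_left (s := X.2.vertices) (t := Z'.2.vertices))) X.2.vertices_finite
    rw [TaggedSimplex.ncard_vertices nX] at e2
    rw [g1, g1', ← hV] at e1
    omega
  have hmV : Y.2.mid ∉ V := fun hm =>
    hmA (u3 (TaggedSimplex.vertices_subset_carrier _ hm.1.1))
  have hU : insert Y.2.mid V ⊆ Z.2.vertices :=
    Set.insert_subset (mid_mem_child_vertices hd1 hZ2) fun p hp => hp.1.2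
  have hU' : insert Y.2.mid V ⊆ Z'.2.vertices :=
    Set.insert_subset (hmid ▸ mid_mem_child_vertices hd1 hZ2') fun p hp => hp.2.2
  have hUdim : convexDim (insert Y.2.mid V) = V.ncard :=
    convexDim_of_subset_range nZ hU (Set.ncard_insert_of_notMem hmV hVfin)
  have hlow := convexDim_mono (TaggedSimplex.convexHull_subset_inter hU hU')
  rw [convexDim_convexHull, hUdim] at hlow
  have hlev : Z'.level = Z.level := h4'.trans h4.symm
  have hp : ({Z.2.x 0, Z.2.x d} : Set (EuclideanSpace ℝ (Fin d))) = {Z'.2.x 0, Z'.2.x d} :=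
    (simplices_pair_eq hd (hXN.mem_simplices rfl) (hZN.mem_simplices h4) h6 h7).symm.trans
      (simplices_pair_eq hd (hXN.mem_simplices rfl) (hZN'.mem_simplices h4') h6' h7')
  exact ⟨h1, hZN, hZN', hlev, h5.symm.trans h5',
    hZN.convexDim_inter hZN' hlev.symm hneZ (hVcard.trans hlow),
    (TaggedSimplex.refinementEdge_subset_iff Z'.2.convex_carrier).2
      (TaggedSimplex.mem_carrier_of_pair_eq hp)⟩

variable (D) in
/-- The geometric input to the analysis of `PATCH_REFINE`. -/
theorem tree_compatible (hs₁ : 0 < s₁) (hs₂ : 0 < s₂) : (D.tree s₁ s₂ hs₁ hs₂).Compatible where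
  mem_neighbors := mem_neighbors_leaves_iff
  mem_spatialNeighbors := mem_spatialNeighbors_of_nbr_child
  ready_of_dep := ready_of_dep
  nbr_of_conn := fun hQ hX hZ hZ' hY hY' hZY hZY' hYQ _ hne hconn =>
    nbr_of_conn hQ hX hZ hZ' hY hY' hZY hZY' hYQ hne hconn
  not_conn_of_low := by
    rintro X Y Y' Z ⟨hXN, -, -, hl⟩ ⟨h1, -, -, -, h5, -⟩ hY' hZY' hconn
    obtain ⟨ht, -⟩ | ⟨hd, -⟩ := hl
    · have hY'N : D.IsNode s₁ s₂ Y' := hY'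
      obtain ⟨t1, t2, -⟩ := hY'N.subset_of_split hZY'
      have ho : X.1.Overlap Y'.1 := TimeInterval.overlap_of_subset hXN.lo_lt_hi (h5 ▸ t1) (h5 ▸ t2)
      rw [← conn_fst_eq hconn] at ho
      unfold TimeInterval.Overlap at ho
      unfold TimeInterval.Touch at ht
      exact ho.ne ht
    · exact h1 hd

end InitialMesh
/-! ### Diameters of bisected simplices -/

namespace TaggedSimplex

variable {d : ℕ} {S C : TaggedSimplex d} {h : ℝ}

/-- The ordered vertices of `S` lie, after rescaling the first `γ` ones (where `γ` is the tag), on a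
path `A` starting at `0` whose `d` steps have length at most `h`. Bisection does not change the
path, up to reversal of an initial part, until the tag returns to zero, when it is halved. -/
def HasEdges (S : TaggedSimplex d) (h : ℝ) : Prop :=
  ∃ A : ℕ → EuclideanSpace ℝ (Fin d), A 0 = 0 ∧ (∀ i < d, ‖A (i + 1) - A i‖ ≤ h) ∧
    (∀ j, 1 ≤ j → j ≤ S.tag → S.x j = S.x 0 + (1 / 2 : ℝ) • A (d - S.tag + j)) ∧
    ∀ j, S.tag < j → j ≤ d → S.x j = S.x 0 + A (j - S.tag)

theorem HasEdges.reflect (ht : S.tag < d) (hS : S.HasEdges h) : S.reflect.HasEdges h := by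
  obtain ⟨A, h0, hA, h1, h2⟩ := hS
  have hd : 1 ≤ d := by omega
  have htr : S.reflect.tag = S.tag := rfl
  obtain ⟨m, hm⟩ : ∃ m, m + S.tag = d := ⟨d - S.tag, by omega⟩
  have hdm : d - S.tag = m := by omega
  have hxd : S.x d = S.x 0 + A m := by rw [h2 d ht le_rfl, hdm]
  refine ⟨fun i => if i ≤ m then A (m - i) - A m else A i - (2 : ℝ) • A m, by simp,
    fun i hi => ?_, fun j hj1 hj2 => ?_, fun j hj1 hj2 => ?_⟩
  · dsimp only
    rcases lt_trichotomy i m with hlt | rfl | hgt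
    · rw [if_pos (by omega), if_pos hlt.le, show m - i = m - (i + 1) + 1 by omega,
        sub_sub_sub_cancel_right, ← norm_sub_rev]
      exact hA _ (by omega)
    · rw [if_neg (by omega), if_pos le_rfl, Nat.sub_self, h0, two_smul,
        show A (i + 1) - (A i + A i) - (0 - A i) = A (i + 1) - A i by abel]
      exact hA i hi
    · rw [if_neg (by omega), if_neg (by omega), sub_sub_sub_cancel_right]
      exact hA i hi
  · rw [htr] at hj2 ⊢
    simp only [reflect_x_zero]
    rw [reflect_x_of_le hj1 (by omega) hj2, hdm, if_neg (by omega), h1 j hj1 hj2, hxd, hdm]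
    module
  · rw [htr] at hj1 ⊢
    simp only [reflect_x_zero]
    rw [if_pos (by omega), hxd]
    rcases hj2.lt_or_eq with hlt | rfl
    · rw [reflect_x_of_lt (by omega) hlt hj1, h2 _ (by omega) (by omega),
        show d + S.tag - j - S.tag = m - (j - S.tag) by omega]
      abel
    · rw [reflect_x_last hd, show m - (j - S.tag) = 0 by omega, h0]
      abel

theorem HasEdges.child₁ (ht : S.tag < d) (hS : S.HasEdges h) :
    S.child₁.HasEdges (if S.tag + 1 < d then h else h / 2) := by
  obtain ⟨A, h0, hA, h1, h2⟩ := hS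
  have hd : 1 ≤ d := by omega
  have htc : S.child₁.tag = (S.tag + 1) % d := rfl
  have hmid : S.mid = S.x 0 + (1 / 2 : ℝ) • A (d - S.tag) := by
    rw [mid, h2 d ht le_rfl, midpoint_eq_smul_add, invOf_eq_inv]
    module
  by_cases hlt : S.tag + 1 < d
  · rw [if_pos hlt]
    rw [Nat.mod_eq_of_lt hlt] at htc
    refine ⟨A, h0, hA, fun j hj1 hj2 => ?_, fun j hj1 hj2 => ?_⟩
    · rw [htc] at hj2 ⊢
      rw [child₁_x_zero]
      rcases hj1.lt_or_eq with hj | rfl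
      · rw [child₁_x hj (by omega), h1 _ (by omega) (by omega),
          show d - S.tag + (j - 1) = d - (S.tag + 1) + j by omega]
      · rw [child₁_x_one hd, hmid, show d - (S.tag + 1) + 1 = d - S.tag by omega]
    · rw [htc] at hj1 ⊢
      rw [child₁_x_zero, child₁_x (by omega) hj2, h2 _ (by omega) (by omega),
        show j - 1 - S.tag = j - (S.tag + 1) by omega]
  · rw [if_neg hlt]
    have hd' : S.tag + 1 = d := by omega
    rw [hd', Nat.mod_self] at htc
    refine ⟨fun i => (1 / 2 : ℝ) • A i, by simp [h0], fun i hi => ?_, fun j hj1 hj2 => ?_,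
      fun j hj1 hj2 => ?_⟩
    · rw [← smul_sub, norm_smul, Real.norm_of_nonneg (by norm_num)]
      linarith [hA i hi]
    · omega
    · rw [htc] at hj1 ⊢
      rw [child₁_x_zero, Nat.sub_zero]
      rcases (show 1 ≤ j from hj1).lt_or_eq with hj | rfl
      · rw [child₁_x hj hj2, h1 _ (by omega) (by omega),
          show d - S.tag + (j - 1) = j by omega]
      · rw [child₁_x_one hd, hmid, show d - S.tag = 1 by omega]

theorem HasEdges.child (ht : S.tag < d) (hS : S.HasEdges h) (hC : C ∈ S.bisect) :
    C.HasEdges (if S.tag + 1 < d then h else h / 2) := by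
  have hd : 1 ≤ d := by omega
  rcases mem_bisect.1 hC with rfl | rfl
  · exact hS.child₁ ht
  · rw [← reflect_child₁ hd]
    exact HasEdges.child₁ (S := S.reflect) ht (hS.reflect ht)

theorem HasEdges.of_dist {δ : ℝ} (ht : S.tag < d) (hδ : ∀ j ≤ d, ‖S.x j - S.x 0‖ ≤ δ) :
    S.HasEdges (4 * δ) := by
  set m := d - S.tag with hm
  set A : ℕ → EuclideanSpace ℝ (Fin d) := fun i => if i = 0 then 0 else
    if i ≤ m then S.x (S.tag + i) - S.x 0 else (2 : ℝ) • (S.x (i - m) - S.x 0) with hAdef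
  have hAn : ∀ i ≤ d, ‖A i‖ ≤ 2 * δ := by
    intro i hi
    have hδ0 : 0 ≤ δ := (norm_nonneg _).trans (hδ 0 (Nat.zero_le _))
    simp only [hAdef]
    split_ifs with h1 h2
    · simpa using hδ0
    · linarith [hδ (S.tag + i) (by omega)]
    · rw [norm_smul, Real.norm_of_nonneg (by norm_num)]
      linarith [hδ (i - m) (by omega)]
  refine ⟨A, by simp [hAdef], fun i hi => ?_, fun j hj1 hj2 => ?_, fun j hj1 hj2 => ?_⟩
  · linarith [norm_sub_le (A (i + 1)) (A i), hAn i hi.le, hAn (i + 1) hi]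
  · simp only [hAdef, ← hm]
    rw [if_neg (by omega), if_neg (by omega), Nat.add_sub_cancel_left]
    module
  · simp only [hAdef]
    rw [if_neg (by omega), if_pos (by omega), show S.tag + (j - S.tag) = j by omega]
    abel

theorem HasEdges.norm_le (ht : S.tag < d) (hS : S.HasEdges h) {j : ℕ} (hj : j ≤ d) :
    ‖S.x j - S.x 0‖ ≤ d * h := by
  obtain ⟨A, h0, hA, h1, h2⟩ := hS
  have hh : 0 ≤ h := (norm_nonneg _).trans (hA 0 (by omega))
  have hAn : ∀ i ≤ d, ‖A i‖ ≤ i * h := by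
    intro i hi
    induction i with
    | zero => simp [h0]
    | succ i ih =>
      have := norm_add_le (A (i + 1) - A i) (A i)
      rw [sub_add_cancel] at this
      push_cast
      linarith [ih (by omega), hA i (by omega)]
  have hAd : ∀ i ≤ d, ‖A i‖ ≤ d * h := fun i hi =>
    (hAn i hi).trans (mul_le_mul_of_nonneg_right (by exact_mod_cast hi) hh)
  rcases Nat.eq_zero_or_pos j with rfl | hj0
  · simpa using by positivity
  · by_cases hjt : j ≤ S.tag
    · rw [h1 j hj0 hjt, add_sub_cancel_left, norm_smul, Real.norm_of_nonneg (by norm_num)]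
      linarith [hAd (d - S.tag + j) (by omega), norm_nonneg (A (d - S.tag + j))]
    · rw [h2 j (by omega) hj, add_sub_cancel_left]
      exact hAd _ (by omega)

theorem carrier_subset_closedBall {r : ℝ} (hr : ∀ j ≤ d, ‖S.x j - S.x 0‖ ≤ r) :
    S.carrier ⊆ Metric.closedBall (S.x 0) r := by
  refine convexHull_min ?_ (convex_closedBall _ _)
  intro p hp
  obtain ⟨j, hj, rfl⟩ := mem_vertices_iff.1 hp
  rw [mem_closedBall_iff_norm]
  exact hr j hj

end TaggedSimplex

namespace InitialMesh

variable {d : ℕ} {D : InitialMesh d} {S : TaggedSimplex d} {n : ℕ}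

/-- The factor by which the mesh size decreases, on average, in one bisection. -/
noncomputable def sizeRate (d : ℕ) : ℝ := (1 / 2 : ℝ) ^ (1 / (d : ℝ))

theorem sizeRate_pos (d : ℕ) : 0 < sizeRate d := Real.rpow_pos_of_pos (by norm_num) _

theorem sizeRate_lt_one (hd : 1 ≤ d) : sizeRate d < 1 :=
  Real.rpow_lt_one (by norm_num) (by norm_num) (by positivity)

theorem sizeRate_pow (hd : 1 ≤ d) : sizeRate d ^ d = 1 / 2 := by
  rw [sizeRate, one_div (d : ℝ)]
  exact Real.rpow_inv_natCast_pow (by norm_num) (by omega)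

theorem simplices_hasEdges {δ : ℝ} (hδ : ∀ S ∈ D.tri, ∀ j ≤ d, ‖S.x j - S.x 0‖ ≤ δ)
    (h : S ∈ D.simplices n) : S.HasEdges (4 * δ * sizeRate d ^ n / sizeRate d ^ S.tag) := by
  have hd := D.dim_pos
  have hσ := sizeRate_pos d
  induction n generalizing S with
  | zero =>
    have ht : S.tag < d := (simplices_spec h).2.1
    obtain ⟨A, h0, hA, h1, h2⟩ := TaggedSimplex.HasEdges.of_dist ht (hδ S h)
    refine ⟨A, h0, fun i hi => (hA i hi).trans ?_, h1, h2⟩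
    have hδ0 : 0 ≤ δ := (norm_nonneg _).trans (hδ S h 0 (Nat.zero_le _))
    rw [pow_zero, mul_one, le_div_iff₀ (by positivity)]
    exact mul_le_of_le_one_right (by positivity) (pow_le_one₀ hσ.le (sizeRate_lt_one hd).le)
  | succ n ih =>
    obtain ⟨A, hA, hS⟩ := mem_simplices_succ.1 h
    have ht : A.tag < d := (simplices_spec hA).2.1
    have hE := (ih hA).child ht hS
    have htS : S.tag = (A.tag + 1) % d := by
      rcases TaggedSimplex.mem_bisect.1 hS with rfl | rfl <;> rfl
    convert hE using 1
    split_ifs with hlt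
    · rw [htS, Nat.mod_eq_of_lt hlt, pow_succ, pow_succ]
      field_simp
    · have hAd : A.tag + 1 = d := by omega
      rw [htS, hAd, Nat.mod_self]
      have h2 : sizeRate d ^ A.tag * sizeRate d = 1 / 2 := by
        rw [← pow_succ, hAd, sizeRate_pow hd]
      rw [pow_succ _ n, pow_zero, div_one, div_div, eq_div_iff (by positivity)]
      linear_combination 8 * δ * sizeRate d ^ n * h2

/-- A simplex of level `n` has size `O(2^(-n/d))`. -/
theorem simplices_subset_closedBall {δ : ℝ} (hδ : ∀ S ∈ D.tri, ∀ j ≤ d, ‖S.x j - S.x 0‖ ≤ δ)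
    (h : S ∈ D.simplices n) :
    S.carrier ⊆ Metric.closedBall (S.x 0) (8 * d * δ * sizeRate d ^ n) := by
  have hd := D.dim_pos
  have ht : S.tag < d := (simplices_spec h).2.1
  have hσ := sizeRate_pos d
  refine TaggedSimplex.carrier_subset_closedBall fun j hj => ?_
  have hE := simplices_hasEdges hδ h
  refine (hE.norm_le ht hj).trans ?_
  have h1 : 1 / 2 ≤ sizeRate d ^ S.tag := by
    rw [← sizeRate_pow hd]
    exact pow_le_pow_of_le_one hσ.le (sizeRate_lt_one hd).le ht.le
  have h2 : 0 ≤ 4 * δ * sizeRate d ^ n := by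
    obtain ⟨A, -, hA, -⟩ := hE
    have := (norm_nonneg _).trans (hA 0 (by omega))
    rw [le_div_iff₀ (by positivity), zero_mul] at this
    exact this
  have h3 : 4 * δ * sizeRate d ^ n / sizeRate d ^ S.tag ≤ 2 * (4 * δ * sizeRate d ^ n) := by
    rw [div_le_iff₀ (by positivity)]
    nlinarith
  calc (d : ℝ) * (4 * δ * sizeRate d ^ n / sizeRate d ^ S.tag)
      ≤ d * (2 * (4 * δ * sizeRate d ^ n)) := by gcongr
    _ = _ := by ring

end InitialMesh
/-! ### Volumes and packing -/

open MeasureTheory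

/-- An affine involution preserves the volume. -/
theorem volume_image_of_involutive {d : ℕ}
    (f : EuclideanSpace ℝ (Fin d) →ᵃ[ℝ] EuclideanSpace ℝ (Fin d)) (hf : ∀ p, f (f p) = p)
    (A : Set (EuclideanSpace ℝ (Fin d))) : volume (f '' A) = volume A := by
  have hlin : f.linear * f.linear = 1 := by
    ext1 v
    have h1 := f.linearMap_vsub (f v) (f 0)
    rw [hf, hf, ← f.linearMap_vsub] at h1
    simpa using h1
  have hdet : |LinearMap.det f.linear| = 1 := by
    have := congrArg LinearMap.det hlin
    rw [map_mul, map_one, mul_self_eq_one_iff] at this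
    rcases this with h | h <;> simp [h]
  have himg : f '' A = (fun p => p + f 0) '' (f.linear '' A) := by
    rw [Set.image_image]
    exact Set.image_congr fun p _ => congrFun f.decomp p
  rw [himg, Set.image_add_right, measure_preimage_add_right, Measure.addHaar_image_linearMap, hdet]
  simp

namespace TaggedSimplex

variable {d : ℕ} {S C : TaggedSimplex d}

theorem isCompact_carrier (S : TaggedSimplex d) : IsCompact S.carrier :=
  S.vertices_finite.isCompact_convexHull ℝ

theorem volume_carrier_ne_top (S : TaggedSimplex d) : volume S.carrier ≠ ⊤ :=
  S.isCompact_carrier.measure_lt_top.ne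

/-- Both children of a simplex have the same volume. -/
theorem volume_child₂ (hd : 1 ≤ d) (h : AffineIndependent ℝ S.vert) :
    volume S.child₂.carrier = volume S.child₁.carrier := by
  obtain ⟨g, g0, gd, gm, gi⟩ := exists_separating hd h
  set v := S.x d - S.x 0 with hv
  -- the affine map that exchanges the end points of the refinement edge
  let f : EuclideanSpace ℝ (Fin d) →ᵃ[ℝ] EuclideanSpace ℝ (Fin d) :=
    AffineMap.id ℝ _ + (LinearMap.toSpanSingleton ℝ _ v).toAffineMap.comp g
  have hf : ∀ p, f p = p + g p • v := fun p => rfl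
  have hgv : g.linear v = -2 := by
    have := g.linearMap_vsub (S.x d) (S.x 0)
    rw [vsub_eq_sub, ← hv, gd, g0] at this
    rw [this]; norm_num
  have hgf : ∀ p, g (f p) = -g p := by
    intro p
    rw [hf, add_comm, ← vadd_eq_add, g.map_vadd, map_smul, hgv, vadd_eq_add, smul_eq_mul]
    ring
  have hinv : ∀ p, f (f p) = p := by
    intro p
    rw [hf (f p), hgf, hf]
    module
  have hfix : ∀ p, g p = 0 → f p = p := fun p hp => by rw [hf, hp, zero_smul, add_zero]
  have himg : f '' S.child₁.vertices = S.child₂.vertices := by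
    rw [child₁_vertices hd, child₂_vertices hd, Set.image_insert_eq, Set.image_insert_eq,
      hfix _ gm, hf (S.x 0), g0, one_smul, hv, add_sub_cancel]
    congr 2
    rw [Set.image_congr fun p hp => hfix p (gi p hp), Set.image_id']
  rw [carrier, ← himg, ← AffineMap.image_convexHull, volume_image_of_involutive f hinv, carrier]

theorem volume_le_two_mul (hd : 1 ≤ d) (h : AffineIndependent ℝ S.vert) (hC : C ∈ S.bisect) :
    volume.real S.carrier ≤ 2 * volume.real C.carrier := by
  have h1 : volume S.carrier ≤ volume S.child₁.carrier + volume S.child₂.carrier :=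
    (measure_mono (carrier_subset_union hd)).trans (measure_union_le _ _)
  have h2 : volume C.carrier = volume S.child₁.carrier := by
    rcases mem_bisect.1 hC with rfl | rfl
    · rfl
    · exact volume_child₂ hd h
  rw [volume_child₂ hd h, ← h2, ← two_mul] at h1
  have h3 := ENNReal.toReal_mono (ENNReal.mul_ne_top (by simp) C.volume_carrier_ne_top) h1
  simpa [measureReal_def] using h3

theorem interior_carrier_nonempty (h : AffineIndependent ℝ S.vert) :
    (interior S.carrier).Nonempty := by
  rw [carrier, interior_convexHull_nonempty_iff_affineSpan_eq_top, vertices]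
  exact (h.affineSpan_eq_top_iff_card_eq_finrank_add_one).2 (by simp)

theorem volume_carrier_pos (h : AffineIndependent ℝ S.vert) : 0 < volume.real S.carrier := by
  refine ENNReal.toReal_pos ?_ S.volume_carrier_ne_top
  exact (Measure.measure_pos_of_nonempty_interior _ (interior_carrier_nonempty h)).ne'

/-- The radius of a ball in a simplex is controlled by the volume. -/
theorem radius_le (hd : 1 ≤ d) {ρ : ℝ} (hρ : 0 < ρ) {c : EuclideanSpace ℝ (Fin d)}
    (hc : Metric.ball c ρ ⊆ S.carrier) :
    ρ ≤ 1 + volume.real S.carrier /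
      volume.real (Metric.ball (0 : EuclideanSpace ℝ (Fin d)) 1) := by
  set ω := volume.real (Metric.ball (0 : EuclideanSpace ℝ (Fin d)) 1) with hω
  have hωpos : 0 < ω := ENNReal.toReal_pos (Metric.measure_ball_pos _ _ one_pos).ne'
    measure_ball_lt_top.ne
  have h1 : ρ ^ d * ω ≤ volume.real S.carrier := by
    have := measureReal_mono (μ := volume) hc S.volume_carrier_ne_top
    rwa [measureReal_def, Measure.addHaar_ball_of_pos _ _ hρ, finrank_euclideanSpace_fin,
      ENNReal.toReal_mul, ENNReal.toReal_ofReal (by positivity), ← measureReal_def] at this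
  have h2 : 0 ≤ volume.real S.carrier / ω := by positivity
  rcases le_total ρ 1 with h | h
  · linarith
  · have h3 : ρ ≤ ρ ^ d := le_self_pow₀ h (by omega)
    have h4 : ρ ^ d ≤ volume.real S.carrier / ω := (le_div_iff₀ hωpos).2 h1
    linarith

/-- The diameter of a simplex is controlled by its shape and volume. -/
theorem diam_le (hd : 1 ≤ d) (h : AffineIndependent ℝ S.vert) :
    Metric.diam S.carrier ≤ S.shape * (1 + volume.real S.carrier /
      volume.real (Metric.ball (0 : EuclideanSpace ℝ (Fin d)) 1)) := by
  set R := {ρ : ℝ | 0 < ρ ∧ ∃ c ∈ S.carrier, Metric.ball c ρ ⊆ S.carrier} with hR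
  have hbdd : ∀ ρ ∈ R, ρ ≤ _ := fun ρ hρ => radius_le hd hρ.1 hρ.2.choose_spec.2
  have hsup : 0 < sSup R := by
    obtain ⟨c, hc⟩ := interior_carrier_nonempty h
    obtain ⟨ρ, hρ, hb⟩ := Metric.isOpen_iff.1 isOpen_interior c hc
    exact hρ.trans_le (le_csSup ⟨_, hbdd⟩ ⟨hρ, c, interior_subset hc, hb.trans interior_subset⟩)
  have hle : sSup R ≤ _ := Real.sSup_le hbdd (by positivity)
  have hsh : Metric.diam S.carrier = S.shape * sSup R := by
    rw [shape, ← hR, div_mul_cancel₀ _ hsup.ne']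
  have hpos : 0 ≤ S.shape := by
    rw [shape, ← hR]
    exact div_nonneg Metric.diam_nonneg hsup.le
  rw [hsh]
  exact mul_le_mul_of_nonneg_left hle hpos

end TaggedSimplex

namespace InitialMesh

variable {d : ℕ} {D : InitialMesh d} {S S' : TaggedSimplex d} {n : ℕ}

theorem tri_nonempty (D : InitialMesh d) : D.tri.Nonempty := by
  by_contra hne
  rw [Finset.not_nonempty_iff_eq_empty] at hne
  have h1 := D.covers
  rw [hne] at h1
  obtain ⟨p, hp⟩ := D.domain.2.1.nonempty
  have h2 := subset_closure hp
  rw [← h1] at h2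
  simp at h2

theorem intervals_nonempty (D : InitialMesh d) : D.intervals.Nonempty := by
  have hN : 0 < D.N := by
    by_contra h
    have h1 := D.T_pos
    have h2 : Fin.last D.N = 0 := by ext; simp; omega
    rw [← D.t_last, h2, D.t_zero] at h1
    exact h1.false
  exact ⟨_, mem_intervals.2 ⟨⟨0, hN⟩, rfl⟩⟩

theorem mesh_nonempty (D : InitialMesh d) : D.mesh.Nonempty :=
  D.intervals_nonempty.product D.tri_nonempty

theorem le_sup_mesh (f : Prism d → ℝ) {R : Prism d} (hR : R ∈ D.mesh) :
    f R ≤ sSup (f '' (D.mesh : Set (Prism d))) :=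
  le_csSup (D.mesh.finite_toSet.image f).bddAbove (Set.mem_image_of_mem f hR)

theorem inf_mesh_le (f : Prism d → ℝ) {R : Prism d} (hR : R ∈ D.mesh) :
    sInf (f '' (D.mesh : Set (Prism d))) ≤ f R :=
  csInf_le (D.mesh.finite_toSet.image f).bddBelow (Set.mem_image_of_mem f hR)

theorem inf_mesh_pos (f : Prism d → ℝ) (hf : ∀ R ∈ D.mesh, 0 < f R) :
    0 < sInf (f '' (D.mesh : Set (Prism d))) := by
  have hne : (f '' (D.mesh : Set (Prism d))).Nonempty := D.mesh_nonempty.to_set.image f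
  obtain ⟨R, hR, he⟩ := hne.csInf_mem (D.mesh.finite_toSet.image f)
  rw [← he]
  exact hf R hR

theorem volume_toSet {I : TimeInterval} (h : I.lo < I.hi) : volume.real I.toSet = I.hi - I.lo := by
  unfold TimeInterval.toSet
  split_ifs
  · rw [Real.volume_real_Icc_of_le h.le]
  · rw [Real.volume_real_Ico_of_le h.le]

theorem mem_mesh {R : Prism d} : R ∈ D.mesh ↔ R.1 ∈ D.intervals ∧ R.2 ∈ D.tri := by
  simp [mesh]

theorem mu₂_pos (D : InitialMesh d) : 0 < mu₂ D.mesh :=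
  inf_mesh_pos _ fun R hR => by
    have := intervals_lo_lt_hi (mem_mesh.1 hR).1
    rw [volume_toSet this]
    linarith

theorem mu₄_pos (D : InitialMesh d) : 0 < mu₄ D.mesh :=
  inf_mesh_pos _ fun _ hR =>
    TaggedSimplex.volume_carrier_pos (D.nondegenerate _ (mem_mesh.1 hR).2)

theorem timeDepth_length {m : ℕ} {J : TimeInterval} (hJ : J ∈ D.timeDepth m) :
    mu₂ D.mesh / 2 ^ m ≤ J.hi - J.lo ∧ J.hi - J.lo ≤ mu₁ D.mesh / 2 ^ m := by
  obtain ⟨I, hI, hJI⟩ := mem_timeDepth.1 hJ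
  have hlt := intervals_lo_lt_hi hI
  obtain ⟨S, hS⟩ := D.tri_nonempty
  have hR : ((I, S) : Prism d) ∈ D.mesh := mem_mesh.2 ⟨hI, hS⟩
  rw [(TimeInterval.bisectIter_spec hlt hJI).2.2, ← volume_toSet hlt]
  exact ⟨div_le_div_of_nonneg_right (inf_mesh_le (fun R => volume.real R.1.toSet) hR) (by positivity),
    div_le_div_of_nonneg_right (le_sup_mesh (fun R => volume.real R.1.toSet) hR) (by positivity)⟩

theorem mu₁_pos (D : InitialMesh d) : 0 < mu₁ D.mesh := by
  obtain ⟨I, hI⟩ := D.intervals_nonempty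
  have := timeDepth_length (mem_timeDepth_zero.2 hI)
  have h2 := D.mu₂_pos
  simp only [pow_zero, div_one] at this
  linarith

/-- An upper bound for the distances of the vertices of an initial simplex, in terms of the
shape-regularity and the maximal volume. -/
noncomputable def sizeBound (d : ℕ) (κ m₃ : ℝ) : ℝ :=
  κ * (1 + m₃ / volume.real (Metric.ball (0 : EuclideanSpace ℝ (Fin d)) 1))

theorem tri_norm_le (hS : S ∈ D.tri) {j : ℕ} :
    ‖S.x j - S.x 0‖ ≤ sizeBound d (shapeRegularity D.mesh) (mu₃ D.mesh) := by
  obtain ⟨I, hI⟩ := D.intervals_nonempty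
  have hR : ((I, S) : Prism d) ∈ D.mesh := mem_mesh.2 ⟨hI, hS⟩
  have h1 : S.shape ≤ shapeRegularity D.mesh :=
    le_csSup (D.mesh.finite_toSet.image _).bddAbove ⟨(I, S), hR, rfl⟩
  have h3 : volume.real S.carrier ≤ mu₃ D.mesh :=
    le_sup_mesh (fun R => volume.real R.2.carrier) hR
  have h4 := TaggedSimplex.diam_le D.dim_pos (D.nondegenerate S hS)
  have h5 : dist (S.x j) (S.x 0) ≤ Metric.diam S.carrier :=
    Metric.dist_le_diam_of_mem S.isCompact_carrier.isBounded
      (S.vertices_subset_carrier (S.x_mem_vertices j))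
      (S.vertices_subset_carrier (S.x_mem_vertices 0))
  rw [dist_eq_norm] at h5
  have h6 : 0 ≤ volume.real S.carrier := measureReal_nonneg
  unfold sizeBound
  have h7 : 0 ≤ volume.real (Metric.ball (0 : EuclideanSpace ℝ (Fin d)) 1) := measureReal_nonneg
  have h8 : 0 ≤ S.shape := by
    by_contra hneg
    exact absurd (mul_neg_of_neg_of_pos (not_le.1 hneg) (by positivity))
      ((norm_nonneg _).trans (h5.trans h4)).not_gt
  refine (h5.trans h4).trans (mul_le_mul h1 ?_ (by positivity) (h8.trans h1))
  linarith [div_le_div_of_nonneg_right h3 h7]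

theorem simplices_volume (h : S ∈ D.simplices n) : mu₄ D.mesh / 2 ^ n ≤ volume.real S.carrier := by
  induction n generalizing S with
  | zero =>
    obtain ⟨I, hI⟩ := D.intervals_nonempty
    rw [pow_zero, div_one]
    exact inf_mesh_le (fun R => volume.real R.2.carrier) (R := (I, S)) (mem_mesh.2 ⟨hI, h⟩)
  | succ n ih =>
    obtain ⟨A, hA, hS⟩ := mem_simplices_succ.1 h
    have := TaggedSimplex.volume_le_two_mul D.dim_pos (simplices_affineIndependent hA) hS
    have := ih hA
    rw [pow_succ, ← div_div]
    linarith

theorem simplices_aedisjoint (h : S ∈ D.simplices n) (h' : S' ∈ D.simplices n) (hne : S ≠ S') :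
    AEDisjoint volume S.carrier S'.carrier := by
  have hlt := simplices_convexDim_lt h h' hne
  refine measure_mono_null (subset_affineSpan ℝ _) (Measure.addHaar_affineSubspace _ _ fun htop => ?_)
  rw [convexDim, ← direction_affineSpan, htop, AffineSubspace.direction_top, finrank_top,
    finrank_euclideanSpace_fin] at hlt
  exact hlt.false

/-- Only boundedly many simplices of the same level lie in a ball of a radius comparable to their
size. -/
theorem card_simplices_le {r a : ℝ} (hr : ∀ S ∈ D.simplices n,
      S.carrier ⊆ Metric.closedBall (S.x 0) (r * sizeRate d ^ n)) (hra : 0 ≤ a + r)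
    (p : EuclideanSpace ℝ (Fin d)) (F : Finset (TaggedSimplex d))
    (hF : ∀ S ∈ F, S ∈ D.simplices n ∧ dist (S.x 0) p ≤ a * sizeRate d ^ n) :
    (F.card : ℝ) ≤ (a + r) ^ d * volume.real (Metric.ball (0 : EuclideanSpace ℝ (Fin d)) 1) /
      mu₄ D.mesh := by
  have hσ := sizeRate_pos d
  have hm := D.mu₄_pos
  have h1 : volume.real (⋃ S ∈ F, S.carrier) = ∑ S ∈ F, volume.real S.carrier :=
    measureReal_biUnion_finset₀
      (fun S hS S' hS' hne => simplices_aedisjoint (hF S hS).1 (hF S' hS').1 hne)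
      (fun S _ => S.isCompact_carrier.measurableSet.nullMeasurableSet)
      (fun S _ => S.volume_carrier_ne_top)
  have h2 : (⋃ S ∈ F, S.carrier) ⊆ Metric.closedBall p ((a + r) * sizeRate d ^ n) := by
    refine Set.iUnion₂_subset fun S hS => (hr S (hF S hS).1).trans
      (Metric.closedBall_subset_closedBall' ?_)
    linarith [(hF S hS).2]
  have h3 := measureReal_mono (μ := volume) h2 measure_closedBall_lt_top.ne
  rw [h1, Measure.addHaar_real_closedBall _ _ (by positivity), finrank_euclideanSpace_fin, mul_pow,
    ← pow_mul, mul_comm n d, pow_mul, sizeRate_pow D.dim_pos] at h3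
  have h4 : (F.card : ℝ) * (mu₄ D.mesh / 2 ^ n) ≤ ∑ S ∈ F, volume.real S.carrier := by
    rw [← nsmul_eq_mul]
    exact Finset.card_nsmul_le_sum _ _ _ fun S hS => simplices_volume (hF S hS).1
  have h5 := h4.trans h3
  rw [one_div, inv_pow] at h5
  rw [le_div_iff₀ hm]
  have h6 : (0 : ℝ) < 2 ^ n := by positivity
  field_simp at h5
  linarith

/-- The factor by which the time step decreases, on average, in one atomic split. -/
noncomputable def timeRate (d : ℕ) (s₁ s₂ : ℝ) : ℝ := (1 / 2 : ℝ) ^ (s₂ / (s₁ * d))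

variable {s₁ s₂ : ℝ}

theorem timeRate_pos (d : ℕ) (s₁ s₂ : ℝ) : 0 < timeRate d s₁ s₂ :=
  Real.rpow_pos_of_pos (by norm_num) _

theorem timeRate_lt_one (hd : 1 ≤ d) (hs₁ : 0 < s₁) (hs₂ : 0 < s₂) : timeRate d s₁ s₂ < 1 :=
  Real.rpow_lt_one (by norm_num) (by norm_num) (by positivity)

theorem timeRate_pow_bounds (hs₁ : 0 < s₁) (hs₂ : 0 < s₂) (n : ℕ) :
    1 / 2 ^ timeLevel d s₁ s₂ n ≤ timeRate d s₁ s₂ ^ n ∧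
      timeRate d s₁ s₂ ^ n ≤ 2 / 2 ^ timeLevel d s₁ s₂ n := by
  have he : timeRate d s₁ s₂ ^ n = (1 / 2 : ℝ) ^ ((n : ℝ) * s₂ / (s₁ * d)) := by
    rw [timeRate, ← Real.rpow_natCast, ← Real.rpow_mul (by norm_num)]
    congr 1; ring
  have hnn : 0 ≤ (n : ℝ) * s₂ / (s₁ * d) := by positivity
  rw [he, ← one_div_pow, ← Real.rpow_natCast]
  constructor
  · exact Real.rpow_le_rpow_of_exponent_ge (by norm_num) (by norm_num) (Nat.le_ceil _)
  · have : (2 : ℝ) / 2 ^ timeLevel d s₁ s₂ n = (1 / 2 : ℝ) ^ ((timeLevel d s₁ s₂ n : ℝ) - 1) := by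
      rw [Real.rpow_sub_one (by norm_num), Real.rpow_natCast, one_div_pow]; ring
    rw [this]
    refine Real.rpow_le_rpow_of_exponent_ge (by norm_num) (by norm_num) ?_
    have := Nat.ceil_lt_add_one hnn
    unfold timeLevel
    linarith

/-- Only boundedly many time intervals of the same depth lie in an interval of a length comparable
to theirs. -/
theorem card_timeDepth_le (hs₁ : 0 < s₁) (hs₂ : 0 < s₂) {a : ℝ} (ha : 0 ≤ a) (q : ℝ)
    (F : Finset TimeInterval) (hF : ∀ I ∈ F, I ∈ D.timeDepth (timeLevel d s₁ s₂ n) ∧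
      |I.lo - q| ≤ a * timeRate d s₁ s₂ ^ n) :
    (F.card : ℝ) ≤ (4 * a + mu₁ D.mesh) / mu₂ D.mesh := by
  have hm := D.mu₂_pos
  have hm1 := D.mu₁_pos
  set m := timeLevel d s₁ s₂ n with hmdef
  set b := a * (2 / 2 ^ m) with hb
  have hb' : ∀ I ∈ F, |I.lo - q| ≤ b := fun I hI => (hF I hI).2.trans
    (mul_le_mul_of_nonneg_left (timeRate_pow_bounds hs₁ hs₂ n).2 ha)
  have h1 : volume.real (⋃ I ∈ F, Set.Ico I.lo I.hi) = ∑ I ∈ F, volume.real (Set.Ico I.lo I.hi) := by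
    refine measureReal_biUnion_finset (fun I hI I' hI' hne => ?_) (fun _ _ => measurableSet_Ico)
      fun _ _ => measure_Ico_lt_top.ne
    have : ¬ I.Overlap I' := fun ho => hne (timeDepth_eq_of_overlap (hF I hI).1 (hF I' hI').1 ho)
    unfold TimeInterval.Overlap at this
    rw [not_lt] at this
    change Disjoint _ _
    rw [Set.Ico_disjoint_Ico]
    exact this
  have h2 : (⋃ I ∈ F, Set.Ico I.lo I.hi) ⊆ Set.Icc (q - b) (q + b + mu₁ D.mesh / 2 ^ m) := by
    refine Set.iUnion₂_subset fun I hI t ht => ?_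
    have h3 := abs_le.1 (hb' I hI)
    have h4 := (timeDepth_length (hF I hI).1).2
    exact ⟨by linarith [ht.1], by linarith [ht.2]⟩
  have h3 := measureReal_mono (μ := volume) h2 measure_Icc_lt_top.ne
  rw [h1, Real.volume_real_Icc_of_le (by
    have : 0 ≤ b := by positivity
    have : 0 ≤ mu₁ D.mesh / 2 ^ m := by positivity
    linarith)] at h3
  have h4 : (F.card : ℝ) * (mu₂ D.mesh / 2 ^ m) ≤ ∑ I ∈ F, volume.real (Set.Ico I.lo I.hi) := by
    rw [← nsmul_eq_mul]
    refine Finset.card_nsmul_le_sum _ _ _ fun I hI => ?_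
    rw [Real.volume_real_Ico_of_le (timeDepth_lo_lt_hi (hF I hI).1).le]
    exact (timeDepth_length (hF I hI).1).1
  have h5 := h4.trans h3
  rw [le_div_iff₀ hm]
  have h6 : (0 : ℝ) < 2 ^ m := by positivity
  rw [hb] at h5
  field_simp at h5
  linarith

end InitialMesh
/-! ### Distances between dependent prisms, and counting -/

namespace RefinementTree

variable {d : ℕ} {s₁ s₂ : ℝ} {G : RefinementTree d s₁ s₂}

variable (G) in
/-- A pseudo-distance for which prisms of level `n` have size at most `b * ρ ^ n`, in the sense that
prisms directly related in the refinement tree are this close. -/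
structure Gauge (δ : Prism d → Prism d → ℝ) (ρ b : ℝ) : Prop where
  rate_pos : 0 < ρ
  rate_lt_one : ρ < 1
  bound_nonneg : 0 ≤ b
  symm : ∀ X Y, δ X Y = δ Y X
  triangle : ∀ X Y Z, δ X Z ≤ δ X Y + δ Y Z
  conn : ∀ {X Y : Prism d}, G.Conn X Y → δ X Y ≤ b * ρ ^ X.level
  dep : ∀ {X Y : Prism d}, G.Dep X Y → δ X Y ≤ b * ρ ^ Y.level
  split : ∀ {X Y : Prism d}, G.Node Y → X ∈ atomicSplit s₁ s₂ Y → δ X Y ≤ b * ρ ^ Y.level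

/-- The factor in the bound for the distance of two prisms such that the refinement of one of them
requires the one of the other. -/
noncomputable def reachBound (ρ b : ℝ) : ℝ := 2 * b / (ρ * (1 - ρ))

/-- The factor in the bound for the distance of two consecutive prisms of a history. -/
noncomputable def stepBound (ρ b : ℝ) : ℝ := (b + reachBound ρ b) / ρ

variable {δ : Prism d → Prism d → ℝ} {ρ b : ℝ} {R Y : Prism d}

theorem Gauge.reachBound_nonneg (h : G.Gauge δ ρ b) : 0 ≤ reachBound ρ b :=
  div_nonneg (mul_nonneg zero_le_two h.bound_nonneg)
    (mul_nonneg h.rate_pos.le (sub_nonneg.2 h.rate_lt_one.le))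

theorem Gauge.stepBound_mul (h : G.Gauge δ ρ b) : stepBound ρ b * ρ = b + reachBound ρ b :=
  div_mul_cancel₀ _ h.rate_pos.ne'

theorem Gauge.stepBound_nonneg (h : G.Gauge δ ρ b) : 0 ≤ stepBound ρ b :=
  div_nonneg (add_nonneg h.bound_nonneg h.reachBound_nonneg) h.rate_pos.le

theorem Gauge.reachBound_le (h : G.Gauge δ ρ b) : reachBound ρ b ≤ stepBound ρ b := by
  rw [stepBound, le_div_iff₀ h.rate_pos]
  have := mul_le_of_le_one_right h.reachBound_nonneg h.rate_lt_one.le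
  linarith [h.bound_nonneg]

/-- Refinement is local: along a chain of dependencies the levels decrease, so that the distances are
dominated by a geometric series. -/
theorem Gauge.reach_le (h : G.Gauge δ ρ b) (hR : G.Reach R Y) :
    δ R Y ≤ reachBound ρ b * ρ ^ Y.level := by
  have hρ := h.rate_pos
  have hρ1 : 0 < 1 - ρ := sub_pos.2 h.rate_lt_one
  have hK := h.reachBound_nonneg
  have hb := h.bound_nonneg
  have hKρ : reachBound ρ b * (ρ * (1 - ρ)) = 2 * b := div_mul_cancel₀ _ (by positivity)
  suffices hs : δ R Y ≤ reachBound ρ b * (ρ ^ Y.level - ρ ^ (R.level + 1)) by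
    refine hs.trans (mul_le_mul_of_nonneg_left ?_ hK)
    linarith [pow_pos hρ (R.level + 1)]
  induction hR with
  | @base R Y hc =>
    have h1 := h.conn hc
    rw [hc.level]
    have hp := pow_pos hρ R.level
    have h2 : b * ρ ≤ 2 * b := by nlinarith [h.rate_lt_one]
    have h3 : b ≤ reachBound ρ b * (1 - ρ) := by
      rw [← mul_le_mul_iff_left₀ hρ]
      linarith
    calc δ R Y ≤ b * ρ ^ R.level := h1
      _ ≤ reachBound ρ b * (1 - ρ) * ρ ^ R.level := mul_le_mul_of_nonneg_right h3 hp.le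
      _ = _ := by ring
  | @step R X Z Y hc hd _ ih =>
    have h1 := h.conn hc
    have h2 := h.dep hd
    have hl : R.level = Z.level + 1 := by rw [hd.level, hc.level]
    rw [hl] at h1 ⊢
    have hp := pow_pos hρ Z.level
    have h3 : b * ρ ^ (Z.level + 1) ≤ b * ρ ^ Z.level :=
      mul_le_mul_of_nonneg_left (pow_le_pow_of_le_one hρ.le h.rate_lt_one.le (Nat.le_succ _)) hb
    have h4 : reachBound ρ b * (ρ ^ (Z.level + 1) - ρ ^ (Z.level + 1 + 1)) =
        2 * b * ρ ^ Z.level := by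
      rw [← hKρ]; ring
    have h5 := h.triangle R X Y
    have h6 := h.triangle X Z Y
    linarith

variable (G) in
/-- A list of refined prisms, latest first, each of which arose by splitting a prism whose refinement
was required by the next one in the list. -/
inductive IsHistory : List (Prism d) → Prop
  | single {R : Prism d} : R.level = 0 → IsHistory [R]
  | cons {R R' A : Prism d} {l : List (Prism d)} : G.Node A → R ∈ atomicSplit s₁ s₂ A →
      G.Reach R' A → R ∉ R' :: l → IsHistory (R' :: l) → IsHistory (R :: R' :: l)

theorem IsHistory.nodup {l : List (Prism d)} (h : G.IsHistory l) : l.Nodup := by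
  induction h with
  | single _ => exact List.nodup_singleton _
  | cons _ _ _ h _ ih => exact List.nodup_cons.2 ⟨h, ih⟩

section Weight

variable {ι : Type} {δ : ι → Prism d → Prism d → ℝ} {ρ b : ι → ℝ} {q : ℝ}

open Classical in
/-- The share of the refinement of `Y` that is attributed to the marked prism `R`: it decays with
the difference of the levels, and vanishes if `Y` is finer than `R` or far away from it. -/
noncomputable def weight (δ : ι → Prism d → Prism d → ℝ) (ρ b : ι → ℝ) (q : ℝ) (Y R : Prism d) : ℝ :=
  if Y.level ≤ R.level ∧ ∀ i, δ i Y R ≤ 2 * stepBound (ρ i) (b i) * ρ i ^ Y.level then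
    q ^ (R.level - Y.level) else 0

theorem weight_nonneg (hq : 0 ≤ q) (Y R : Prism d) : 0 ≤ weight δ ρ b q Y R := by
  unfold weight
  split_ifs
  · positivity
  · exact le_rfl

/-- The marked prisms in a history starting near `Y` at a level not below the one of `Y` receive in
total at least a full share of `Y`: going back in the history, the distance to `Y` grows by a
multiple of the share at each step, so that either the history stays close until the level of `Y` is
reached, or enough shares have been collected before. -/
theorem IsHistory.one_le_sum (hG : ∀ i, G.Gauge (δ i) (ρ i) (b i)) (hq : 0 ≤ q)
    (hρq : ∀ i, ρ i ≤ q) {l : List (Prism d)} (h : G.IsHistory (R :: l)) {u : ℝ} (hu : 0 ≤ u)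
    (hl : Y.level ≤ R.level)
    (hδ : ∀ i, δ i Y R ≤ (1 + u) * stepBound (ρ i) (b i) * ρ i ^ Y.level) :
    1 ≤ u + ((R :: l).map (weight δ ρ b q Y)).sum := by
  have hsum : ∀ m : List (Prism d), 0 ≤ (m.map (weight δ ρ b q Y)).sum := fun m =>
    List.sum_nonneg fun x hx => by
      obtain ⟨Z, -, rfl⟩ := List.mem_map.1 hx
      exact weight_nonneg hq Y Z
  induction l generalizing R u with
  | nil =>
    cases h with
    | single h0 =>
      rcases le_or_gt 1 u with h1 | h1
      · linarith [hsum [R]]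
      · have hc : Y.level ≤ R.level ∧
            ∀ i, δ i Y R ≤ 2 * stepBound (ρ i) (b i) * ρ i ^ Y.level := by
          refine ⟨hl, fun i => (hδ i).trans ?_⟩
          have := mul_nonneg (hG i).stepBound_nonneg (pow_nonneg (hG i).rate_pos.le Y.level)
          nlinarith
        have : weight δ ρ b q Y R = 1 := by
          rw [weight, if_pos hc, h0, Nat.zero_sub, pow_zero]
        simp only [List.map_cons, List.map_nil, List.sum_cons, List.sum_nil, this]
        linarith
  | cons R' l ih =>
    rcases le_or_gt 1 u with h1 | h1
    · linarith [hsum (R :: R' :: l)]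
    have hc : Y.level ≤ R.level ∧ ∀ i, δ i Y R ≤ 2 * stepBound (ρ i) (b i) * ρ i ^ Y.level := by
      refine ⟨hl, fun i => (hδ i).trans ?_⟩
      have := mul_nonneg (hG i).stepBound_nonneg (pow_nonneg (hG i).rate_pos.le Y.level)
      nlinarith
    have hw : weight δ ρ b q Y R = q ^ (R.level - Y.level) := by rw [weight, if_pos hc]
    rw [List.map_cons, List.sum_cons, hw]
    rcases hl.eq_or_lt with he | hlt
    · rw [he, Nat.sub_self, pow_zero]
      linarith [hsum (R' :: l)]
    cases h with
    | @cons _ _ A _ hA hRA hR'A _ hh =>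
      have hlev := G.level_child hRA
      have hle := hR'A.level_le
      have := ih hh (u := u + q ^ (R.level - Y.level)) (by positivity) (by omega) fun i => by
        have g := hG i
        have e1 := g.triangle Y R R'
        have e2 := g.triangle R A R'
        have e3 := g.split hA hRA
        have e4 := g.reach_le hR'A
        rw [g.symm] at e4
        have e5 : ρ i * ρ i ^ A.level = ρ i ^ (R.level - Y.level) * ρ i ^ Y.level := by
          rw [← pow_succ', ← hlev, ← pow_add, Nat.sub_add_cancel hl]
        have e6 : (b i + reachBound (ρ i) (b i)) * ρ i ^ A.level =
            ρ i ^ (R.level - Y.level) * (stepBound (ρ i) (b i) * ρ i ^ Y.level) := by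
          rw [← g.stepBound_mul, mul_assoc, e5]; ring
        have e7 : ρ i ^ (R.level - Y.level) ≤ q ^ (R.level - Y.level) :=
          pow_le_pow_left₀ g.rate_pos.le (hρq i) _
        have e8 := mul_le_mul_of_nonneg_right e7
          (mul_nonneg g.stepBound_nonneg (pow_nonneg g.rate_pos.le Y.level))
        have e9 := hδ i
        calc δ i Y R' ≤ (1 + u) * stepBound (ρ i) (b i) * ρ i ^ Y.level +
              (b i + reachBound (ρ i) (b i)) * ρ i ^ A.level := by linarith
          _ ≤ (1 + u) * stepBound (ρ i) (b i) * ρ i ^ Y.level +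
              q ^ (R.level - Y.level) * (stepBound (ρ i) (b i) * ρ i ^ Y.level) := by
            rw [e6]; linarith
          _ = _ := by ring
      linarith

end Weight

variable (G) in
/-- The set `Q` of all split prisms is explained by the set `M` of prisms for which `PATCH_REFINE`
was called. -/
structure Explains (M Q : Mesh d) : Prop where
  adm : G.Adm Q
  subset : M ⊆ Q
  reach : ∀ Y ∈ Q, ∃ R ∈ M, G.Reach R Y
  history : ∀ R ∈ M, ∃ l, G.IsHistory (R :: l) ∧ ∀ X ∈ R :: l, X ∈ M

theorem explains_empty : G.Explains ∅ ∅ where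
  adm := adm_empty
  subset := subset_rfl
  reach := fun _ h => absurd h (Finset.notMem_empty _)
  history := fun _ h => absurd h (Finset.notMem_empty _)

open Classical in
theorem Explains.insert {M Q Q' : Mesh d} (h : G.Explains M Q) (hR : R ∈ G.leaves Q)
    (hQ' : G.Outcome Q Q' R) : G.Explains (insert R M) Q' := by
  obtain ⟨h1, h2, h3, h4⟩ := hQ'
  obtain ⟨hRl, hRQ⟩ := mem_leaves.1 hR
  refine ⟨h2, Finset.insert_subset h3 (h.subset.trans h1), fun Y hY => ?_, fun X hX => ?_⟩
  · by_cases hYQ : Y ∈ Q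
    · obtain ⟨X, hX, hXY⟩ := h.reach Y hYQ
      exact ⟨X, Finset.mem_insert_of_mem hX, hXY⟩
    · exact ⟨R, Finset.mem_insert_self _ _, h4 Y hY hYQ⟩
  · rcases Finset.mem_insert.1 hX with rfl | hX
    · rcases hRl with hr | ⟨A, hA, hRA⟩
      · exact ⟨[], .single (G.level_root hr), by simp⟩
      · obtain ⟨R', hR', hR'A⟩ := h.reach A hA
        obtain ⟨l, hl, hlM⟩ := h.history R' hR'
        refine ⟨R' :: l, .cons (h.adm A hA).1 hRA hR'A
          (fun hm => hRQ (h.subset (hlM _ hm))) hl, fun Z hZ => ?_⟩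
        rcases List.mem_cons.1 hZ with rfl | hZ
        · exact Finset.mem_insert_self _ _
        · exact Finset.mem_insert_of_mem (hlM Z hZ)
    · obtain ⟨l, hl, hlM⟩ := h.history X hX
      exact ⟨l, hl, fun Z hZ => Finset.mem_insert_of_mem (hlM Z hZ)⟩

open Classical in
/-- If only `N` prisms of each level are near a given one, then the number of split prisms is at most
a fixed multiple of the number of calls of `PATCH_REFINE`. -/
theorem Explains.card_le {ι : Type} {δ : ι → Prism d → Prism d → ℝ} {ρ b : ι → ℝ} {q N : ℝ}
    (hG : ∀ i, G.Gauge (δ i) (ρ i) (b i)) (hq : 0 ≤ q) (hq1 : q < 1) (hρq : ∀ i, ρ i ≤ q)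
    (hN : ∀ (R : Prism d) (n : ℕ) (F : Mesh d), (∀ Y ∈ F, G.Node Y ∧ Y.level = n ∧
      ∀ i, δ i Y R ≤ 2 * stepBound (ρ i) (b i) * ρ i ^ n) → (F.card : ℝ) ≤ N)
    {M Q : Mesh d} (h : G.Explains M Q) : (Q.card : ℝ) ≤ N / (1 - q) * M.card := by
  have hN0 : 0 ≤ N := by
    simpa using hN (⟨0, 0, false⟩, ⟨fun _ => 0, 0, 0⟩) 0 ∅ (by simp)
  have hlow : ∀ Y ∈ Q, 1 ≤ ∑ R ∈ M, weight δ ρ b q Y R := by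
    intro Y hY
    obtain ⟨R, hR, hRY⟩ := h.reach Y hY
    obtain ⟨l, hl, hlM⟩ := h.history R hR
    have h1 := hl.one_le_sum (Y := Y) hG hq hρq le_rfl hRY.level_le fun i => by
      rw [(hG i).symm, add_zero, one_mul]
      exact ((hG i).reach_le hRY).trans (mul_le_mul_of_nonneg_right (hG i).reachBound_le
        (pow_nonneg (hG i).rate_pos.le _))
    rw [zero_add, ← List.sum_toFinset _ hl.nodup] at h1
    exact h1.trans (Finset.sum_le_sum_of_subset_of_nonneg
      (fun X hX => hlM X (List.mem_toFinset.1 hX)) fun X _ _ => weight_nonneg hq Y X)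
  have hup : ∀ R ∈ M, ∑ Y ∈ Q, weight δ ρ b q Y R ≤ N / (1 - q) := by
    intro R _
    have e1 : ∀ Y ∈ Q, weight δ ρ b q Y R = ∑ n ∈ Finset.range (R.level + 1),
        if Y.level = n ∧ ∀ i, δ i Y R ≤ 2 * stepBound (ρ i) (b i) * ρ i ^ n then
          q ^ (R.level - n) else 0 := by
      intro Y _
      unfold weight
      split_ifs with hc
      · rw [Finset.sum_eq_single_of_mem Y.level (Finset.mem_range.2 (by omega))
          fun n _ hn => if_neg fun hh => hn hh.1.symm, if_pos ⟨rfl, hc.2⟩]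
      · refine (Finset.sum_eq_zero fun n hn => if_neg fun hh => hc ?_).symm
        obtain ⟨rfl, hh⟩ := hh
        exact ⟨by have := Finset.mem_range.1 hn; omega, hh⟩
    rw [Finset.sum_congr rfl e1, Finset.sum_comm]
    have e2 : ∀ n ∈ Finset.range (R.level + 1), (∑ Y ∈ Q,
        if Y.level = n ∧ ∀ i, δ i Y R ≤ 2 * stepBound (ρ i) (b i) * ρ i ^ n then
          q ^ (R.level - n) else 0) ≤ N * q ^ (R.level - n) := by
      intro n _
      rw [← Finset.sum_filter, Finset.sum_const, nsmul_eq_mul]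
      refine mul_le_mul_of_nonneg_right (hN R n _ fun Y hY => ?_) (by positivity)
      obtain ⟨hYQ, h1, h2⟩ := Finset.mem_filter.1 hY
      exact ⟨(h.adm Y hYQ).1, h1, h2⟩
    refine (Finset.sum_le_sum e2).trans ?_
    have e3 := Finset.sum_range_reflect (fun n => q ^ n) (R.level + 1)
    rw [Nat.add_sub_cancel] at e3
    rw [← Finset.mul_sum, e3, div_eq_mul_inv]
    refine mul_le_mul_of_nonneg_left ?_ hN0
    rw [← tsum_geometric_of_lt_one hq hq1]
    exact (summable_geometric_of_lt_one hq hq1).sum_le_tsum _ fun n _ => by positivity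
  calc (Q.card : ℝ) = ∑ Y ∈ Q, (1 : ℝ) := by simp
    _ ≤ ∑ Y ∈ Q, ∑ R ∈ M, weight δ ρ b q Y R := Finset.sum_le_sum hlow
    _ = ∑ R ∈ M, ∑ Y ∈ Q, weight δ ρ b q Y R := Finset.sum_comm
    _ ≤ ∑ R ∈ M, N / (1 - q) := Finset.sum_le_sum hup
    _ = _ := by rw [Finset.sum_const, nsmul_eq_mul, mul_comm]

end RefinementTree
/-! ### Locality and packing for the refinement tree of an initial mesh -/

namespace InitialMesh

open MeasureTheory

variable {d : ℕ} {D : InitialMesh d} {s₁ s₂ : ℝ} {hs₁ : 0 < s₁} {hs₂ : 0 < s₂} {X Y : Prism d}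

/-- The distance of the first vertices of the simplices of two prisms. -/
noncomputable def spaceDist (X Y : Prism d) : ℝ := dist (X.2.x 0) (Y.2.x 0)

/-- The distance of the left end points of the time intervals of two prisms. -/
noncomputable def timeDist (X Y : Prism d) : ℝ := |X.1.lo - Y.1.lo|

theorem isNode_of_conn (h : (D.tree s₁ s₂ hs₁ hs₂).Conn X Y) : X = Y ∨ D.IsNode s₁ s₂ X := by
  rcases Relation.ReflTransGen.cases_head h with h | ⟨Z, hZ, -⟩
  · exact Or.inl h
  · exact Or.inr hZ.2.1

theorem IsLow.inter_nonempty (h : D.IsLow s₁ s₂ X Y) : (X.2.carrier ∩ Y.2.carrier).Nonempty := by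
  obtain ⟨-, -, -, ⟨-, h⟩ | ⟨-, -, h⟩⟩ := h
  · by_contra hne
    have hd := D.dim_pos
    rw [Set.not_nonempty_iff_eq_empty.1 hne] at h
    rw [convexDim, vectorSpan_empty, finrank_bot] at h
    omega
  · exact Set.nonempty_of_ncard_ne_zero (by omega)

/-- Two prisms related by a dependency are not separated in time. -/
theorem lo_le_hi_of_dep (h : (D.tree s₁ s₂ hs₁ hs₂).Dep X Y) :
    D.IsNode s₁ s₂ X ∧ D.IsNode s₁ s₂ Y ∧ X.1.lo ≤ Y.1.hi ∧ Y.1.lo ≤ X.1.hi := by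
  rcases h with ⟨hX, hY, -, ho⟩ | ⟨Z, ⟨-, hX, hZ, -, he, -⟩, hY, hZY⟩
  · refine ⟨hX, hY, ?_⟩
    have : max X.1.lo Y.1.lo ≤ min X.1.hi Y.1.hi := by
      rcases ho with ⟨ho, -⟩ | ⟨-, ho, -⟩
      · exact le_of_eq ho
      · exact le_of_lt ho
    simp only [max_le_iff, le_min_iff] at this
    exact ⟨this.2.1, this.1.2⟩
  · have hY' : D.IsNode s₁ s₂ Y := hY
    obtain ⟨t1, t2, -⟩ := hY'.subset_of_split hZY
    have := hZ.lo_lt_hi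
    rw [he]
    exact ⟨hX, hY, by linarith, by linarith⟩

/-- Prisms directly related in the refinement tree are close in space: their simplices have a common
point, and their size is controlled by the level. -/
theorem spaceGauge {r : ℝ} (hr0 : 0 ≤ r) (hr : ∀ n, ∀ S ∈ D.simplices n,
      S.carrier ⊆ Metric.closedBall (S.x 0) (r * sizeRate d ^ n)) :
    (D.tree s₁ s₂ hs₁ hs₂).Gauge spaceDist (sizeRate d) (2 * r) := by
  have hσ := sizeRate_pos d
  have hmem : ∀ {X : Prism d}, D.IsNode s₁ s₂ X → ∀ p ∈ X.2.carrier,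
      dist p (X.2.x 0) ≤ r * sizeRate d ^ X.2.level := fun hX p hp =>
    Metric.mem_closedBall.1 (hr _ _ hX.1 hp)
  have hx0 : ∀ {X : Prism d}, X.2.x 0 ∈ X.2.carrier := fun {X} =>
    X.2.vertices_subset_carrier (X.2.x_mem_vertices 0)
  have htwo : ∀ n, r * sizeRate d ^ n ≤ 2 * r * sizeRate d ^ n := fun n => by
    have : 0 ≤ r * sizeRate d ^ n := by positivity
    linarith
  refine ⟨hσ, sizeRate_lt_one D.dim_pos, by positivity, fun X Y => dist_comm _ _,
    fun X Y Z => dist_triangle _ _ _, fun {X Y} h => ?_, fun {X Y} h => ?_, fun {X Y} hY h => ?_⟩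
  · unfold spaceDist
    rcases isNode_of_conn h with rfl | hX
    · rw [dist_self]; positivity
    · have hp : Y.2.x 0 ∈ ({X.2.x 0, X.2.x d} : Set (EuclideanSpace ℝ (Fin d))) := by
        rw [conn_pair_eq h]; simp
      have hc : Y.2.x 0 ∈ X.2.carrier := by
        refine X.2.vertices_subset_carrier ?_
        rcases hp with hp | hp <;> rw [hp] <;> exact X.2.x_mem_vertices _
      rw [dist_comm]
      exact (hmem hX _ hc).trans (htwo _)
  · obtain ⟨hX, hY, -⟩ := lo_le_hi_of_dep h
    have hl : Y.2.level + 1 = X.2.level := h.level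
    obtain ⟨p, hp, hp'⟩ : (X.2.carrier ∩ Y.2.carrier).Nonempty := by
      rcases h with h | ⟨Z, ⟨-, -, -, -, -, -, he⟩, -, hZY⟩
      · exact IsLow.inter_nonempty h
      · exact ⟨X.2.x 0, hx0, (hY.subset_of_split hZY).2.2 (he (left_mem_segment _ _ _))⟩
    have h1 := hmem hX p hp
    have h2 := hmem hY p hp'
    have h3 : r * sizeRate d ^ X.2.level ≤ r * sizeRate d ^ Y.2.level :=
      mul_le_mul_of_nonneg_left (pow_le_pow_of_le_one hσ.le (sizeRate_lt_one D.dim_pos).le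
        (by omega)) hr0
    have h4 := dist_triangle_left (X.2.x 0) (Y.2.x 0) p
    unfold spaceDist Prism.level
    linarith
  · have hY' : D.IsNode s₁ s₂ Y := hY
    exact (hmem hY' _ ((hY'.subset_of_split h).2.2 hx0)).trans (htwo _)

/-- Prisms directly related in the refinement tree are close in time. -/
theorem timeGauge : (D.tree s₁ s₂ hs₁ hs₂).Gauge timeDist (timeRate d s₁ s₂) (mu₁ D.mesh) := by
  have hθ := timeRate_pos d s₁ s₂
  have hθ1 := timeRate_lt_one D.dim_pos hs₁ hs₂
  have hm := D.mu₁_pos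
  have hlen : ∀ {X : Prism d}, D.IsNode s₁ s₂ X →
      X.1.hi - X.1.lo ≤ mu₁ D.mesh * timeRate d s₁ s₂ ^ X.2.level := fun {X} hX => by
    refine (timeDepth_length hX.2).2.trans ?_
    rw [div_eq_mul_one_div]
    exact mul_le_mul_of_nonneg_left (timeRate_pow_bounds hs₁ hs₂ _).1 hm.le
  refine ⟨hθ, hθ1, hm.le, fun X Y => abs_sub_comm _ _, fun X Y Z => abs_sub_le _ _ _,
    fun {X Y} h => ?_, fun {X Y} h => ?_, fun {X Y} hY h => ?_⟩
  · unfold timeDist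
    rw [conn_fst_eq h, sub_self, abs_zero]
    positivity
  · obtain ⟨hX, hY, h1, h2⟩ := lo_le_hi_of_dep h
    have hl : Y.2.level + 1 = X.2.level := h.level
    have h3 := hlen hX
    have h4 := hlen hY
    have h5 : mu₁ D.mesh * timeRate d s₁ s₂ ^ X.2.level ≤
        mu₁ D.mesh * timeRate d s₁ s₂ ^ Y.2.level :=
      mul_le_mul_of_nonneg_left (pow_le_pow_of_le_one hθ.le hθ1.le (by omega)) hm.le
    unfold timeDist Prism.level
    exact abs_le.2 ⟨by linarith, by linarith⟩
  · have hY' : D.IsNode s₁ s₂ Y := hY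
    obtain ⟨h1, h2, -⟩ := hY'.subset_of_split h
    have h3 := hlen hY'
    have h4 : X.1.lo < X.1.hi :=
      TimeInterval.lo_lt_hi_of_mem_bisectIter hY'.lo_lt_hi (mem_atomicSplit.1 h).1
    unfold timeDist Prism.level
    exact abs_le.2 ⟨by linarith, by linarith⟩

/-- A bound for the number of prisms of one level near a given prism. -/
noncomputable def packingBound (d : ℕ) (s₁ s₂ κ m₁ m₂ m₃ m₄ : ℝ) : ℝ :=
  (2 * RefinementTree.stepBound (sizeRate d) (2 * (8 * d * sizeBound d κ m₃)) +
        8 * d * sizeBound d κ m₃) ^ d *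
      volume.real (Metric.ball (0 : EuclideanSpace ℝ (Fin d)) 1) / m₄ *
    ((4 * (2 * RefinementTree.stepBound (timeRate d s₁ s₂) m₁) + m₁) / m₂)

/-- A bound for the number of split prisms per call of `PATCH_REFINE`. -/
noncomputable def splitBound (d : ℕ) (s₁ s₂ κ m₁ m₂ m₃ m₄ : ℝ) : ℝ :=
  packingBound d s₁ s₂ κ m₁ m₂ m₃ m₄ / (1 - max (sizeRate d) (timeRate d s₁ s₂))

open Classical in
/-- The number of split prisms is at most a fixed multiple of the number of calls of
`PATCH_REFINE`. -/
theorem card_le_of_explains {M Q : Mesh d} (h : (D.tree s₁ s₂ hs₁ hs₂).Explains M Q) :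
    (Q.card : ℝ) ≤ splitBound d s₁ s₂ (shapeRegularity D.mesh) (mu₁ D.mesh) (mu₂ D.mesh)
      (mu₃ D.mesh) (mu₄ D.mesh) * M.card := by
  set δ := sizeBound d (shapeRegularity D.mesh) (mu₃ D.mesh) with hδ
  set r := 8 * d * δ with hrdef
  have hδ0 : 0 ≤ δ := by
    obtain ⟨S, hS⟩ := D.tri_nonempty
    exact (norm_nonneg _).trans (tri_norm_le hS (j := 0))
  have hr0 : 0 ≤ r := by positivity
  have hr : ∀ n, ∀ S ∈ D.simplices n,
      S.carrier ⊆ Metric.closedBall (S.x 0) (r * sizeRate d ^ n) := fun n S hS =>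
    simplices_subset_closedBall (fun S hS j _ => tri_norm_le hS) hS
  have gx : (D.tree s₁ s₂ hs₁ hs₂).Gauge spaceDist (sizeRate d) (2 * r) := spaceGauge hr0 hr
  have gt : (D.tree s₁ s₂ hs₁ hs₂).Gauge timeDist (timeRate d s₁ s₂) (mu₁ D.mesh) := timeGauge
  have hx0 := gx.stepBound_nonneg
  have ht0 := gt.stepBound_nonneg
  refine h.card_le (ι := Bool) (δ := fun i => bif i then spaceDist else timeDist)
    (ρ := fun i => bif i then sizeRate d else timeRate d s₁ s₂)
    (b := fun i => bif i then 2 * r else mu₁ D.mesh)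
    (q := max (sizeRate d) (timeRate d s₁ s₂)) (Bool.forall_bool.2 ⟨gt, gx⟩)
    (le_max_of_le_left gx.rate_pos.le) (max_lt gx.rate_lt_one gt.rate_lt_one)
    (Bool.forall_bool.2 ⟨le_max_right _ _, le_max_left _ _⟩) fun R n F hF => ?_
  have hF' : ∀ Y ∈ F, D.IsNode s₁ s₂ Y ∧ Y.2.level = n ∧
      timeDist Y R ≤ 2 * RefinementTree.stepBound (timeRate d s₁ s₂) (mu₁ D.mesh) *
        timeRate d s₁ s₂ ^ n ∧
      spaceDist Y R ≤ 2 * RefinementTree.stepBound (sizeRate d) (2 * r) * sizeRate d ^ n :=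
    fun Y hY => ⟨(hF Y hY).1, (hF Y hY).2.1, (hF Y hY).2.2 false, (hF Y hY).2.2 true⟩
  have e1 := card_simplices_le (hr n) (by positivity :
    0 ≤ 2 * RefinementTree.stepBound (sizeRate d) (2 * r) + r) (R.2.x 0) (F.image Prod.snd)
    fun S hS => by
      obtain ⟨Y, hY, rfl⟩ := Finset.mem_image.1 hS
      obtain ⟨h1, h2, -, h3⟩ := hF' Y hY
      exact ⟨h2 ▸ h1.1, h3⟩
  have e2 := card_timeDepth_le (D := D) (n := n) hs₁ hs₂ (by positivity :
    0 ≤ 2 * RefinementTree.stepBound (timeRate d s₁ s₂) (mu₁ D.mesh)) R.1.lo (F.image Prod.fst)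
    fun I hI => by
      obtain ⟨Y, hY, rfl⟩ := Finset.mem_image.1 hI
      obtain ⟨h1, h2, h3, -⟩ := hF' Y hY
      exact ⟨h2 ▸ h1.2, h3⟩
  -- a prism is determined by its time interval and its simplex
  have e3 : F ⊆ F.image Prod.fst ×ˢ F.image Prod.snd := fun Y hY =>
    Finset.mem_product.2 ⟨Finset.mem_image_of_mem _ hY, Finset.mem_image_of_mem _ hY⟩
  have e4 : (F.card : ℝ) ≤ (F.image Prod.snd).card * (F.image Prod.fst).card := by
    have := Finset.card_le_card e3
    rw [Finset.card_product, mul_comm] at this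
    exact_mod_cast this
  exact e4.trans (mul_le_mul e1 e2 (Nat.cast_nonneg _) ((Nat.cast_nonneg _).trans e1))

end InitialMesh

/-! ### The number of prisms after a sequence of refinements -/

theorem card_atomicSplit_le {d : ℕ} {s₁ s₂ : ℝ} (X : Prism d) :
    (atomicSplit s₁ s₂ X).card ≤ 2 ^ ⌈s₂ / (s₁ * d)⌉₊ * 2 := by
  rw [atomicSplit, Finset.card_product]
  refine Nat.mul_le_mul ((TimeInterval.card_bisectIter_le _ _).trans
    (Nat.pow_le_pow_right two_pos ?_)) ?_
  · have := Nat.ceil_add_le ((X.2.level : ℝ) * s₂ / (s₁ * d)) (s₂ / (s₁ * d))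
    rw [← add_div, ← add_one_mul] at this
    omega
  · classical
    exact Finset.card_le_two

namespace RefinementTree

variable {d : ℕ} {s₁ s₂ : ℝ} {G : RefinementTree d s₁ s₂} {M Q : Mesh d}

theorem card_leaves_le (Q : Mesh d) :
    (G.leaves Q).card ≤ G.root.card + Q.card * (2 ^ ⌈s₂ / (s₁ * d)⌉₊ * 2) := by
  classical
  refine (Finset.card_le_card Finset.sdiff_subset).trans ((Finset.card_union_le _ _).trans ?_)
  gcongr
  exact Finset.card_biUnion_le_card_mul _ _ _ fun X _ => card_atomicSplit_le X

/-- One loop of `MARKED_REFINE` calls `PATCH_REFINE` at most once for each marked prism. -/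
theorem Explains.markedLoop (hG : G.Compatible) (h : G.Explains M Q) {mark : Mesh d → Mesh d}
    {P' : Mesh d} (hP' : MarkedLoop s₁ s₂ mark (G.leaves Q) P') :
    ∃ M' Q', P' = G.leaves Q' ∧ G.Explains M' Q' ∧
      M'.card ≤ M.card + (mark (G.leaves Q)).card := by
  classical
  obtain ⟨l, hl, hlm, hfor⟩ := forEach_iff.1 hP'
  rw [← show l.toFinset = mark (G.leaves Q) by ext a; simp [hlm a], List.toFinset_card_of_nodup hl]
  clear hl hlm hP'
  generalize hP : G.leaves Q = P at hfor
  induction hfor generalizing M Q with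
  | nil s => exact ⟨M, Q, hP.symm, h, by simp⟩
  | @cons R l P P₁ P' hstep _ ih =>
    subst hP
    rcases hstep with ⟨hR, hp⟩ | ⟨-, rfl⟩
    · obtain ⟨Q₁, rfl, ho⟩ := patchRefine_sound hG h.adm hR hp
      obtain ⟨M', Q', e1, e2, e3⟩ := ih (h.insert hR ho) rfl
      refine ⟨M', Q', e1, e2, ?_⟩
      have := Finset.card_insert_le R M
      rw [List.length_cons]
      omega
    · obtain ⟨M', Q', e1, e2, e3⟩ := ih h rfl
      exact ⟨M', Q', e1, e2, by rw [List.length_cons]; omega⟩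

/-- From every admissible mesh, the next loop of `MARKED_REFINE` has a terminating execution. -/
theorem exists_markedLoop (hG : G.Compatible) (hQ : G.Adm Q) (mark : Mesh d → Mesh d) :
    ∃ P', MarkedLoop s₁ s₂ mark (G.leaves Q) P' := by
  obtain ⟨P', hP'⟩ := ForList.exists_of_invariant
    (body := fun R Q Q' => (R ∈ Q ∧ PatchRefine s₁ s₂ Q R Q') ∨ (R ∉ Q ∧ Q' = Q))
    (p := fun P => ∃ Q, P = G.leaves Q ∧ G.Adm Q) (l := (mark (G.leaves Q)).toList)
    (s := G.leaves Q) (fun R _ P => by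
      rintro ⟨Q, rfl, hQ⟩
      constructor
      · by_cases hR : R ∈ G.leaves Q
        · obtain ⟨P', h⟩ := patchRefine_total hG hQ hR
          exact ⟨P', Or.inl ⟨hR, h⟩⟩
        · exact ⟨_, Or.inr ⟨hR, rfl⟩⟩
      · rintro P' (⟨hR, h⟩ | ⟨-, rfl⟩)
        · obtain ⟨Q', rfl, ho⟩ := patchRefine_sound hG hQ hR h
          exact ⟨Q', rfl, ho.2.1⟩
        · exact ⟨Q, rfl, hQ⟩) ⟨Q, rfl, hQ⟩
  exact ⟨P', forEach_iff.2 ⟨_, Finset.nodup_toList _, fun a => Finset.mem_toList, hP'⟩⟩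

/-- All meshes produced by `MARKED_REFINE` are explained by at most as many calls of `PATCH_REFINE` as
there are marked prisms. -/
theorem exists_explains (hG : G.Compatible) {mark : Mesh d → Mesh d} {P : ℕ → Mesh d} {k : ℕ}
    (h0 : P 0 = G.root) (h : ∀ i < k, MarkedLoop s₁ s₂ mark (P i) (P (i + 1))) :
    ∃ M Q, P k = G.leaves Q ∧ G.Explains M Q ∧
      M.card ≤ ∑ i ∈ Finset.Icc 1 k, (mark (P (i - 1))).card := by
  induction k with
  | zero => exact ⟨∅, ∅, by rw [h0, leaves_empty], explains_empty, by simp⟩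
  | succ k ih =>
    obtain ⟨M, Q, e1, e2, e3⟩ := ih fun i hi => h i (by omega)
    have hk := h k (by omega)
    rw [e1] at hk
    obtain ⟨M', Q', e4, e5, e6⟩ := e2.markedLoop hG hk
    refine ⟨M', Q', e4, e5, ?_⟩
    rw [Finset.sum_Icc_succ_top (by omega), Nat.add_sub_cancel, e1]
    omega

end RefinementTree

end SpaceTimeMesh

theorem mainTheorem3 (d : ℕ) (hd : 1 ≤ d) (s₁ s₂ : ℝ) (hs₁ : 0 < s₁) (hs₂ : 0 < s₂)
    (κ m₁ m₂ m₃ m₄ : ℝ) :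
    ∃ C : ℝ, 0 < C ∧
      ∀ D : InitialMesh d,
        shapeRegularity D.mesh = κ →
        mu₁ D.mesh = m₁ → mu₂ D.mesh = m₂ → mu₃ D.mesh = m₃ → mu₄ D.mesh = m₄ →
        ∀ mark : Mesh d → Mesh d, (∀ Q, mark Q ⊆ Q) →
          ∀ (P : ℕ → Mesh d) (k : ℕ), P 0 = D.mesh →
            (∀ i < k, MarkedLoop s₁ s₂ mark (P i) (P (i + 1))) →
            ((P k).card : ℝ) - ((P 0).card : ℝ) ≤
                C * ∑ i ∈ Finset.Icc 1 k, ((mark (P (i - 1))).card : ℝ) ∧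
              ∃ P' : Mesh d, MarkedLoop s₁ s₂ mark (P k) P' := by
  set B : ℝ := 2 ^ ⌈s₂ / (s₁ * d)⌉₊ * 2 with hB
  set N := InitialMesh.splitBound d s₁ s₂ κ m₁ m₂ m₃ m₄ with hN
  have hBpos : 0 < B := by positivity
  -- `N` bounds the number of splits per marked prism if there is an initial mesh with these parameters,
  -- `B` the number of prisms created by one split
  refine ⟨(|N| + 1) * B, by positivity, ?_⟩
  rintro D rfl rfl rfl rfl rfl mark - P k h0 h
  have hG := D.tree_compatible hs₁ hs₂
  obtain ⟨M, Q, e1, e2, e3⟩ := RefinementTree.exists_explains hG h0 h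
  refine ⟨?_, e1 ▸ RefinementTree.exists_markedLoop hG e2.adm mark⟩
  have e4 := InitialMesh.card_le_of_explains e2
  rw [← hN] at e4
  have e5 : ((P k).card : ℝ) ≤ (P 0).card + Q.card * B := by
    rw [e1, h0, hB]
    exact_mod_cast RefinementTree.card_leaves_le (G := D.tree s₁ s₂ hs₁ hs₂) Q
  have e6 : (M.card : ℝ) ≤ ∑ i ∈ Finset.Icc 1 k, ((mark (P (i - 1))).card : ℝ) := by
    exact_mod_cast e3
  have e7 : (Q.card : ℝ) ≤ (|N| + 1) * M.card :=
    e4.trans (mul_le_mul_of_nonneg_right (by linarith [le_abs_self N]) (Nat.cast_nonneg _))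
  have e8 : (|N| + 1) * (M.card : ℝ) ≤
      (|N| + 1) * ∑ i ∈ Finset.Icc 1 k, ((mark (P (i - 1))).card : ℝ) :=
    mul_le_mul_of_nonneg_left e6 (by positivity)
  calc ((P k).card : ℝ) - (P 0).card ≤ Q.card * B := by linarith
    _ ≤ ((|N| + 1) * ∑ i ∈ Finset.Icc 1 k, ((mark (P (i - 1))).card : ℝ)) * B :=
      mul_le_mul_of_nonneg_right (e7.trans e8) hBpos.le
    _ = _ := by ring
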